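/- Let $\mathcal H$ be the single-mode bosonic Fock space with number states $|m\rangle$, annihilation operator $a$, quadratures $\hat x=a+a^\dagger$, $\hat p=-i(a-a^\dagger)$, Weyl operators $W(\xi)=\exp(i\,\xi\cdot(\hat x,\hat p))$ for $\xi\in\mathbb R^2$, and characteristic function $\chi(\xi;\rho)=\operatorname{Tr}(\rho W(\xi))$ (and similarly for two modes). The Gaussian channel with matrices $(X,Y)$ is the completely positive trace-preserving map $\Phi$ on trace-class operators with $\chi(\xi;\Phi(\rho))=\chi(X\xi;\rho)\,e^{-\xi^TY\xi/2}$. The quantum-limited attenuator ($0<\kappa\le1$), amplifier ($\kappa\ge1$) and phase conjugation ($\kappa>0$) channels are those with $(X,Y)=(\kappa 1,(1-\kappa^2)1)$, $(\kappa 1,(\kappa^2-1)1)$ and $(\kappa\sigma_3,(\kappa^2+1)1)$. For $r>0$ let $|\Psi_r\rangle=\operatorname{sech} r\sum_j(\tanh r)^j|j,j\rangle$ and $\Gamma_r=\cosh^2 r\,|\Psi_r\rangle\langle\Psi_r|$. A two-mode Gaussian unitary $U_S$ implements the symplectic matrix $S$ if $U_S^\dagger W(\xi)U_S=W(S^T\xi)$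 for all $\xi\in\mathbb R^4$; its phase is fixed by $\langle0,0|U_S|0,0\rangle>0$. For each of the three families the channel $\Phi$ exists and is unique, and for every $r>0$ $$(\Phi\otimes 1)(\Gamma_r)=\sum_{n\ge0}|T_n(r,\kappa)\rangle\langle T_n(r,\kappa)|\quad\text{(in trace norm)},\qquad |T_n(r,\kappa)\rangle=\sqrt N\,x^n\,U_S^\dagger|s_n\rangle,$$ where - attenuator: $S=\begin{pmatrix}\cosh\mu\,1&-\sinh\mu\,\sigma_3\\-\sinh\mu\,\sigma_3&\cosh\mu\,1\end{pmatrix}$ with $\tanh\mu=\kappa\tanh r$, $N=(1-\kappa^2\tanh^2r)^{-1}$, $x=\big[\frac{1-\kappa^2}{\coth^2r-\kappa^2}\big]^{1/2}$, $|s_n\rangle=|0,n\rangle$; - amplifier: $S$ of the same form with $\tanh\mu=\kappa^{-1}\tanh r$, $N=(\kappa^2-\tanh^2r)^{-1}$, $x=\big[\frac{\kappa^2-1}{\kappa^2-\tanh^2r}\big]^{1/2}$, $|s_n\rangle=|n,0\rangle$; - phase conjugation: $S=\begin{pmatrix}\cos\theta\,1&-\sin\theta\,1\\\sin\theta\,1&\cos\theta\,1\end{pmatrix}$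 with $\theta=\arctan(-\tanh r/\kappa)$, $N=(1+\kappa^2)^{-1}$, $x=\big[\frac{\kappa^2+\tanh^2r}{\kappa^2+1}\big]^{1/2}$, $|s_n\rangle=|n,0\rangle$. Let $T_n(r,\kappa)$ be the operator on $\mathcal H$ obtained from $|T_n(r,\kappa)\rangle$ by flipping the second ket to a bra ($|l,m\rangle\mapsto|l\rangle\langle m|$). Then $\sum_nT_n(r,\kappa)^\dagger T_n(r,\kappa)=\sum_j(\tanh^2r)^j|j\rangle\langle j|$ strongly for every $r>0$, this tends strongly to the identity as $r\to\infty$, and for every $n\ge0$ the limit $\lim_{r\to\infty}T_n(r,\kappa)$ exists strongly (in operator norm, if $\kappa\ne1$ or the channel is the phase conjugation) and equals, respectively, $$B_n(\kappa)=\sum_{m=0}^\infty\sqrt{\tbinom{m+n}{n}}\,\kappa^m\big(\sqrt{1-\kappa^2}\big)^n|m\rangle\langle m+n|,$$ $$A_n(\kappa)=\sum_{m=0}^\infty\sqrt{\tbinom{m+n}{n}}\Big(\frac1\kappa\Big)^{m+1}\Big(\frac{\sqrt{\kappa^2-1}}{\kappa}\Big)^n|m+n\rangle\langle m|,$$ $$C_n(\kappa)=\frac1{\sqrt{1+\kappa^2}}\sum_{m=0}^n\sqrt{\tbinom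 nm}\Big[\frac{\kappa}{\sqrt{1+\kappa^2}}\Big]^{n-m}\Big[\frac1{\sqrt{1+\kappa^2}}\Big]^m|n-m\rangle\langle m|,$$ with the convention $0^0=1$ and strongly convergent sums. These are Kraus operators of the corresponding channel: writing $K_n$ for $B_n(\kappa)$, $A_n(\kappa)$ or $C_n(\kappa)$, $\Phi(\rho)=\sum_nK_n\rho K_n^\dagger$ in trace norm for every trace-class $\rho$, and $\sum_nK_n^\dagger K_n=1$ strongly; the channels are trace preserving. -/

import Mathlib

open Filter Topology
open scoped ENNReal InnerProductSpace Matrix Kronecker ComplexOrder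

noncomputable section

namespace Bosonic

/-! ### Trace-class operators -/

section TraceClass

variable {E : Type*} [NormedAddCommGroup E] [InnerProductSpace ℂ E]

/-- The trace norm, as the infimum of `∑ ‖u k‖ ‖v k‖` over all strongly convergent decompositions
`T = ∑ k, |u k⟩⟨v k|`. It is `⊤` exactly when `T` is not of trace class. -/
def traceNorm (T : E →L[ℂ] E) : ℝ≥0∞ :=
  ⨅ (u : ℕ → E) (v : ℕ → E) (_ : ∀ x, HasSum (fun k => ⟪v k, x⟫_ℂ • u k) (T x)),
    ∑' k, ‖u k‖ₑ * ‖v k‖ₑ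

theorem traceNorm_lt_top_iff (T : E →L[ℂ] E) :
    traceNorm T < ⊤ ↔ ∃ u v : ℕ → E, (∀ x, HasSum (fun k => ⟪v k, x⟫_ℂ • u k) (T x)) ∧
      ∑' k, ‖u k‖ₑ * ‖v k‖ₑ < ⊤ := by
  simp only [traceNorm, iInf_lt_iff, exists_prop]

variable (E) in
/-- The space of trace-class operators. -/
def TraceClass : Submodule ℂ (E →L[ℂ] E) where
  carrier := {T | traceNorm T < ⊤}
  zero_mem' := by
    refine (traceNorm_lt_top_iff _).2 ⟨0, 0, fun x => ?_, ?_⟩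
    · simp
    · simp
  add_mem' := by
    intro S T hS hT
    obtain ⟨u, v, h, hs⟩ := (traceNorm_lt_top_iff S).1 hS
    obtain ⟨u', v', h', hs'⟩ := (traceNorm_lt_top_iff T).1 hT
    obtain ⟨e⟩ : Nonempty (ℕ ≃ ℕ ⊕ ℕ) := ⟨Equiv.natSumNatEquivNat.symm⟩
    refine (traceNorm_lt_top_iff _).2
      ⟨fun k => Sum.elim u u' (e k), fun k => Sum.elim v v' (e k), fun x => ?_, ?_⟩
    · have hsum : HasSum (fun k : ℕ ⊕ ℕ => ⟪Sum.elim v v' k, x⟫_ℂ • Sum.elim u u' k)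
          (S x + T x) := HasSum.sum (h x) (h' x)
      exact (Equiv.hasSum_iff e
        (f := fun k : ℕ ⊕ ℕ => ⟪Sum.elim v v' k, x⟫_ℂ • Sum.elim u u' k)).2 hsum
    · rw [Equiv.tsum_eq e (fun k => ‖Sum.elim u u' k‖ₑ * ‖Sum.elim v v' k‖ₑ),
        ENNReal.summable.tsum_sum ENNReal.summable]
      exact ENNReal.add_lt_top.2 ⟨hs, hs'⟩
  smul_mem' := by
    intro c T hT
    obtain ⟨u, v, h, hs⟩ := (traceNorm_lt_top_iff T).1 hT
    refine (traceNorm_lt_top_iff _).2 ⟨fun k => c • u k, v, fun x => ?_, ?_⟩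
    · have hc : ∀ k, ⟪v k, x⟫_ℂ • c • u k = c • ⟪v k, x⟫_ℂ • u k := fun k => smul_comm _ _ _
      simp only [hc]
      exact (h x).const_smul c
    · have hc : ∀ k, ‖c • u k‖ₑ * ‖v k‖ₑ = ‖c‖ₑ * (‖u k‖ₑ * ‖v k‖ₑ) := fun k => by
        rw [enorm_smul, mul_assoc]
      rw [tsum_congr hc, ENNReal.tsum_mul_left]
      exact ENNReal.mul_lt_top enorm_lt_top hs

/-- `|u⟩⟨v|`. -/
abbrev ketBra (u v : E) : E →L[ℂ] E := InnerProductSpace.rankOne ℂ u v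

/-- Convergence of `∑ n, A n` to `T` in trace norm (unordered sum). -/
def HasTraceNormSum (A : ℕ → (E →L[ℂ] E)) (T : E →L[ℂ] E) : Prop :=
  Tendsto (fun F : Finset ℕ => traceNorm (T - ∑ n ∈ F, A n)) atTop (𝓝 0)

end TraceClass

/-! ### Fock space and Weyl operators -/

section Fock

variable {ι : Type*} [Fintype ι] [DecidableEq ι]

variable (ι) in
/-- The bosonic Fock space with mode set `ι`, with the occupation-number basis indexed
by `ι → ℕ`. -/
abbrev Fock : Type _ := lp (fun _ : ι → ℕ => ℂ) 2

/-- The Fock basis vector `|n⟩`. -/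
def ket (n : ι → ℕ) : Fock ι := lp.single 2 n (1 : ℂ)

/-- The single-mode number state `|m⟩`. -/
abbrev ket₁ (m : ℕ) : Fock (Fin 1) := ket ![m]

/-- The two-mode number state `|l, m⟩`. -/
abbrev ket₂ (l m : ℕ) : Fock (Fin 2) := ket ![l, m]

theorem memℓp_expVec (β : ι → ℂ) :
    Memℓp (fun n : ι → ℕ => ∏ i, β i ^ n i / (Real.sqrt (n i).factorial : ℂ)) 2 := by
  refine memℓp_gen ?_
  have key : ∀ n : ι → ℕ,
      ‖∏ i, β i ^ n i / (Real.sqrt (n i).factorial : ℂ)‖ ^ (2 : ℝ≥0∞).toReal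
        = ∏ i, (‖β i‖ ^ 2) ^ n i / ((n i).factorial : ℝ) := by
    intro n
    simp only [ENNReal.toReal_ofNat, Real.rpow_ofNat]
    rw [norm_prod, ← Finset.prod_pow]
    refine Finset.prod_congr rfl fun i _ => ?_
    rw [norm_div, norm_pow, div_pow, Complex.norm_real, Real.norm_eq_abs, sq_abs,
      Real.sq_sqrt (by positivity)]
    ring
  simp only [key]
  refine summable_of_sum_le (c := ∏ i, Real.exp (‖β i‖ ^ 2))
    (fun n => Finset.prod_nonneg fun i _ => by positivity) fun F => ?_
  let M := (F.sup fun n => Finset.univ.sup n) + 1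
  have hF : F ⊆ Fintype.piFinset fun _ : ι => Finset.range M := by
    intro n hn
    rw [Fintype.mem_piFinset]
    intro i
    rw [Finset.mem_range, Nat.lt_succ_iff]
    exact (Finset.le_sup (f := n) (Finset.mem_univ i)).trans
      (Finset.le_sup (f := fun n : ι → ℕ => Finset.univ.sup n) hn)
  calc ∑ n ∈ F, ∏ i, (‖β i‖ ^ 2) ^ n i / ((n i).factorial : ℝ)
      ≤ ∑ n ∈ Fintype.piFinset fun _ : ι => Finset.range M,
          ∏ i, (‖β i‖ ^ 2) ^ n i / ((n i).factorial : ℝ) :=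
        Finset.sum_le_sum_of_subset_of_nonneg hF
          fun n _ _ => Finset.prod_nonneg fun i _ => by positivity
    _ = ∏ i, ∑ k ∈ Finset.range M, (‖β i‖ ^ 2) ^ k / (k.factorial : ℝ) :=
        Finset.sum_prod_piFinset (Finset.range M)
          fun i k => (‖β i‖ ^ 2) ^ k / (k.factorial : ℝ)
    _ ≤ ∏ i, Real.exp (‖β i‖ ^ 2) :=
        Finset.prod_le_prod (fun i _ => Finset.sum_nonneg fun k _ => by positivity)
          fun i _ => Real.sum_le_exp_of_nonneg (by positivity) M

/-- The exponential vector (unnormalised coherent state)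
`ε(β) = ∑ n, ∏ i, β i ^ n i / √(n i)! |n⟩`. -/
def expVec (β : ι → ℂ) : Fock ι :=
  ⟨fun n => ∏ i, β i ^ n i / (Real.sqrt (n i).factorial : ℂ), memℓp_expVec β⟩

/-- The displacement operator `D(α) = exp (∑ i, (α i • aᵢ† - conj (α i) • aᵢ))`: the bounded
operator with `D(α) ε(β) = exp (-|α|²/2 - ⟨α, β⟩) ε(α + β)` for all `β`. As the exponential vectors
span a dense subspace and the right-hand sides have the Gram matrix of the `ε(β)`, it is
their unique continuous linear extension. -/
def displacement (α : ι → ℂ) : Fock ι →L[ℂ] Fock ι :=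
  LinearMap.extendOfNorm
    (Finsupp.linearCombination ℂ fun β : ι → ℂ =>
      Complex.exp (-∑ i, ((‖α i‖ ^ 2 / 2 : ℝ) : ℂ) - ∑ i, star (α i) * β i) • expVec (α + β))
    (Finsupp.linearCombination ℂ (expVec : (ι → ℂ) → Fock ι))

/-- The Weyl operator `W(ξ) = exp (i ∑ i, (qᵢ x̂ᵢ + pᵢ p̂ᵢ))`, `ξ (i, 0) = qᵢ`, `ξ (i, 1) = pᵢ`, with
quadratures `x̂ = a + a†`, `p̂ = -i (a - a†)`, in which the vacuum has variance matrix `1`. -/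
def weyl (ξ : ι × Fin 2 → ℝ) : Fock ι →L[ℂ] Fock ι :=
  displacement fun i => Complex.I * (ξ (i, 0) + ξ (i, 1) * Complex.I)

/-- The trace in the Fock basis. -/
def trace (T : Fock ι →L[ℂ] Fock ι) : ℂ := ∑' n, ⟪ket n, T (ket n)⟫_ℂ

/-- The characteristic function `χ(ξ; ρ) = Tr (ρ W(ξ))`. -/
def charFn (ξ : ι × Fin 2 → ℝ) (ρ : Fock ι →L[ℂ] Fock ι) : ℂ := trace (ρ ∘L weyl ξ)

/-! ### Channels and Gaussian unitaries -/

/-- A quantum channel: a completely positive trace-preserving linear map on trace-class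
operators. Complete positivity: `[ρ i j] ≥ 0` implies `[Φ (ρ i j)] ≥ 0` for finite block matrices
of any size. -/
structure IsChannel (Φ : TraceClass (Fock ι) →ₗ[ℂ] TraceClass (Fock ι)) : Prop where
  completelyPositive : ∀ (k : ℕ) (ρ : Fin k → Fin k → TraceClass (Fock ι)),
    (∀ x : Fin k → Fock ι, 0 ≤ ∑ i, ∑ j, ⟪x i, (ρ i j).1 (x j)⟫_ℂ) →
    ∀ x : Fin k → Fock ι, 0 ≤ ∑ i, ∑ j, ⟪x i, (Φ (ρ i j)).1 (x j)⟫_ℂ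
  tracePreserving : ∀ ρ, trace (Φ ρ).1 = trace ρ.1

/-- `Φ` is the Gaussian channel specified by the transmission matrix `X` and the
noise matrix `Y`. -/
structure IsGaussianChannel (X Y : Matrix (ι × Fin 2) (ι × Fin 2) ℝ)
    (Φ : TraceClass (Fock ι) →ₗ[ℂ] TraceClass (Fock ι)) : Prop extends IsChannel Φ where
  charFn_apply : ∀ ξ ρ, charFn ξ (Φ ρ).1 =
    charFn (X *ᵥ ξ) ρ.1 * (Real.exp (-(ξ ⬝ᵥ (Y *ᵥ ξ)) / 2) : ℂ)

/-- `U` is a Gaussian unitary implementing the symplectic matrix `S`, i.e.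
`χ(ξ; U ρ U†) = χ(Sᵀ ξ; ρ)`, in the form `U† W(ξ) U = W(Sᵀ ξ)`. -/
def IsGaussianUnitary (S : Matrix (ι × Fin 2) (ι × Fin 2) ℝ) (U : Fock ι ≃ₗᵢ[ℂ] Fock ι) : Prop :=
  ∀ ξ v, U.symm (weyl ξ (U v)) = weyl (Sᵀ *ᵥ ξ) v

end Fock

/-! ### Two modes: squeezed vacuum, Choi operator, and the matrices involved -/

/-- The Pauli matrix `σ₃`. -/
def pauliZ : Matrix (Fin 2) (Fin 2) ℝ := !![1, 0; 0, -1]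

/-- The single-mode matrix `X = κ σ₃`. -/
def conjX (κ : ℝ) : Matrix (Fin 1 × Fin 2) (Fin 1 × Fin 2) ℝ :=
  κ • ((1 : Matrix (Fin 1) (Fin 1) ℝ) ⊗ₖ pauliZ)

/-- The two-mode squeezing symplectic matrix with `2 × 2` blocks
`[[cosh μ 1, -sinh μ σ₃], [-sinh μ σ₃, cosh μ 1]]`. -/
def squeezeMat (μ : ℝ) : Matrix (Fin 2 × Fin 2) (Fin 2 × Fin 2) ℝ :=
  !![Real.cosh μ, 0; 0, Real.cosh μ] ⊗ₖ (1 : Matrix (Fin 2) (Fin 2) ℝ) +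
    !![0, -Real.sinh μ; -Real.sinh μ, 0] ⊗ₖ pauliZ

/-- The beam-splitter symplectic matrix with `2 × 2` blocks
`[[cos θ 1, -sin θ 1], [sin θ 1, cos θ 1]]`. -/
def beamSplitterMat (θ : ℝ) : Matrix (Fin 2 × Fin 2) (Fin 2 × Fin 2) ℝ :=
  !![Real.cos θ, -Real.sin θ; Real.sin θ, Real.cos θ] ⊗ₖ (1 : Matrix (Fin 2) (Fin 2) ℝ)

/-- The two-mode squeezed vacuum `|Ψ_r⟩ = sech r ∑ j, (tanh r)ʲ |j, j⟩`. -/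
def squeezedVacuum (r : ℝ) : Fock (Fin 2) :=
  ((Real.cosh r)⁻¹ : ℂ) • ∑' j : ℕ, ((Real.tanh r) ^ j : ℂ) • ket₂ j j

theorem summable_squeezedVacuum (r : ℝ) :
    Summable fun j : ℕ => ((Real.tanh r) ^ j : ℂ) • ket₂ j j := by
  refine Summable.of_norm ?_
  have h : ∀ j : ℕ, ‖((Real.tanh r) ^ j : ℂ) • ket₂ j j‖ = |Real.tanh r| ^ j := by
    intro j
    have : ‖ket₂ j j‖ = 1 := by
      rw [ket₂, ket, lp.norm_single (by norm_num)]
      simp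
    rw [norm_smul, this, mul_one, norm_pow, Complex.norm_real, Real.norm_eq_abs]
  simp only [h]
  exact summable_geometric_of_lt_one (abs_nonneg _) (Real.abs_tanh_lt_one r)

/-- The unnormalised operator `Γ_r = cosh² r |Ψ_r⟩⟨Ψ_r|`. -/
def squeezedGamma (r : ℝ) : Fock (Fin 2) →L[ℂ] Fock (Fin 2) :=
  ((Real.cosh r) ^ 2 : ℂ) • ketBra (squeezedVacuum r) (squeezedVacuum r)

/-- `R' = (Φ ⊗ 1) R`, with `Φ` acting on the first mode: `Φ` maps every block
`⟨·, i| R |·, j⟩` of `R` to the corresponding block of `R'`. -/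
def IsOneSidedImage (Φ : TraceClass (Fock (Fin 1)) →ₗ[ℂ] TraceClass (Fock (Fin 1)))
    (R R' : Fock (Fin 2) →L[ℂ] Fock (Fin 2)) : Prop :=
  ∀ i j : ℕ, ∃ ρ : TraceClass (Fock (Fin 1)),
    (∀ l m, ⟪ket₁ l, ρ.1 (ket₁ m)⟫_ℂ = ⟪ket₂ l i, R (ket₂ m j)⟫_ℂ) ∧
    (∀ l m, ⟪ket₁ l, (Φ ρ).1 (ket₁ m)⟫_ℂ = ⟪ket₂ l i, R' (ket₂ m j)⟫_ℂ)

/-- `T` is obtained from the vector `ψ = ∑ l m, a l m |l, m⟩` by flipping the second ket to a bra: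
`T = ∑ l m, a l m |l⟩⟨m|`. -/
def IsFlip (T : Fock (Fin 1) →L[ℂ] Fock (Fin 1)) (ψ : Fock (Fin 2)) : Prop :=
  ∀ l m, ⟪ket₁ l, T (ket₁ m)⟫_ℂ = ⟪ket₂ l m, ψ⟫_ℂ

/-- `T = ∑ m, c m |a m⟩⟨b m|` (a sum of number-state dyads converging strongly). -/
def HasDyadSum (c : ℕ → ℝ) (a b : ℕ → ℕ) (T : Fock (Fin 1) →L[ℂ] Fock (Fin 1)) : Prop :=
  ∀ v, HasSum (fun m => (c m : ℂ) • ketBra (ket₁ (a m)) (ket₁ (b m)) v) (T v)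

/-- `T r n` are the operators produced at squeezing `r > 0` by the two-mode-squeezed Choi
construction for the channel `Φ`: the operator `R = (Φ ⊗ 1) Γ_r` has the pure-state decomposition
`R = ∑ n, |T_n⟩⟨T_n|` with `|T_n⟩ = √N xⁿ U_S† |seed n⟩`, where `U_S` is a Gaussian
unitary implementing `S` (with phase fixed by `⟨0,0| U_S |0,0⟩ > 0`), and `T r n` is `|T_n⟩` with the second ket flipped to a bra. -/
def IsChoiConstruction (Φ : TraceClass (Fock (Fin 1)) →ₗ[ℂ] TraceClass (Fock (Fin 1)))
    (S : ℝ → Matrix (Fin 2 × Fin 2) (Fin 2 × Fin 2) ℝ) (N x : ℝ → ℝ) (seed : ℕ → Fock (Fin 2))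
    (T : ℝ → ℕ → (Fock (Fin 1) →L[ℂ] Fock (Fin 1))) : Prop :=
  ∀ r, 0 < r → ∃ U : Fock (Fin 2) ≃ₗᵢ[ℂ] Fock (Fin 2), IsGaussianUnitary (S r) U ∧
    0 < ⟪ket₂ 0 0, U (ket₂ 0 0)⟫_ℂ ∧
    ∃ ψ : ℕ → Fock (Fin 2),
      (∀ n, ψ n = ((Real.sqrt (N r) * x r ^ n : ℝ) : ℂ) • U.symm (seed n)) ∧
      (∃ R : TraceClass (Fock (Fin 2)), IsOneSidedImage Φ (squeezedGamma r) R.1 ∧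
        HasTraceNormSum (fun n => ketBra (ψ n) (ψ n)) R.1) ∧
      ∀ n, IsFlip (T r n) (ψ n)

/-- At finite squeezing `∑ n, T_n† T_n = diag ((tanh² r)ʲ)`, in the strong operator topology,
and this converges strongly to the identity as `r → ∞`. -/
def FiniteSqueezingCompleteness (T : ℝ → ℕ → (Fock (Fin 1) →L[ℂ] Fock (Fin 1))) : Prop :=
  ∃ D : ℝ → (Fock (Fin 1) →L[ℂ] Fock (Fin 1)),
    (∀ r j, D r (ket₁ j) = (((Real.tanh r) ^ 2) ^ j : ℂ) • ket₁ j) ∧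
    (∀ r, 0 < r → ∀ v, HasSum (fun n => ((T r n).adjoint ∘L T r n) v) (D r v)) ∧
    ∀ v, Tendsto (fun r => D r v) atTop (𝓝 v)

/-- `K` is a sequence of Kraus operators of `Φ`: `Φ ρ = ∑ n, K_n ρ K_n†` in trace norm, and
`∑ n, K_n† K_n = 1` in the strong operator topology. -/
structure IsKrausFamily (Φ : TraceClass (Fock (Fin 1)) →ₗ[ℂ] TraceClass (Fock (Fin 1)))
    (K : ℕ → (Fock (Fin 1) →L[ℂ] Fock (Fin 1))) : Prop where
  hasSum : ∀ ρ, HasTraceNormSum (fun n => K n ∘L ρ.1 ∘L (K n).adjoint) (Φ ρ).1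
  completeness : ∀ v, HasSum (fun n => ((K n).adjoint ∘L K n) v) v

end Bosonic

end

namespace Bosonic

/-! ### Power series -/

/-! Every identity is tested on the exponential vectors `ε(β)`. They span a dense subspace, because
pairing a vector with them gives an entire function whose Taylor coefficients are the Fock
coordinates up to factorials (`fock_ext`), and their Gram matrix is `exp ⟨β, γ⟩`. Any family with
this Gram matrix is therefore the image of the `ε(β)` under an isometry. This produces the
displacement operators and, from a vector `ψ` whose characteristic function is the vacuum one
transported by a symplectic map, a Gaussian unitary (`exists_unitary_of_symplectic`).

Surjectivity of these unitaries and uniqueness of the channels share one source: the Gaussian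
average of the displacements is a multiple of the vacuum projection
(`integral_gaussWeight_smul_displacement`). Hence the displacements act irreducibly, and a
trace-class operator is determined by its characteristic function (`traceClass_ext_charFn`).

Existence comes from a dilation. The input is coupled to a vacuum mode by a Gaussian unitary `V` and
the second mode is traced out; the Kraus operators are the partial matrix elements `⟨n| V e`.
Completeness expresses that `V e` is isometric. The Gaussian form follows in the Heisenberg picture:
`V` transforms the displacement linearly, one component acts on the input and gives `X`, the other
acts on the vacuum and gives the noise `Y`. The attenuator uses a beam splitter with `cos θ = κ`,
the amplifier a squeezer with `cosh μ = κ`, and phase conjugation a squeezer with `sinh μ = κ` and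
the input in the other port. Generating functions turn the kernels of `V` into the stated Kraus
coefficients.

For the Choi construction, `cosh r • Ψ_r = ∑ tʲ |j, j⟩` with `t = tanh r`, so each `T_n` should be
`K_n tᴺ` with `N` the number operator. It remains to match coordinates with `√N xⁿ U_S† |s_n⟩`,
where `U_S` is a second Gaussian unitary, distinct from the one in the dilation
(`isChoiConstruction_of_flip`). Completeness at finite squeezing and the limits `r → ∞` then follow
from `tᴺ → 1` strongly; the limit is in norm when the dyad coefficients of `K_n` are absolutely
summable. -/

theorem powerSeries_coeff_eq_zero {a : ℕ → ℂ} (h : ∀ z : ℂ, HasSum (fun n => a n * z ^ n) 0) :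
    a = 0 := by
  have hp : HasFPowerSeriesAt (0 : ℂ → ℂ) (FormalMultilinearSeries.ofScalars ℂ a) 0 := by
    rw [hasFPowerSeriesAt_iff]
    refine Eventually.of_forall fun z => ?_
    simpa [FormalMultilinearSeries.coeff_ofScalars, mul_comm] using h z
  funext n
  have := congrArg (fun p => FormalMultilinearSeries.coeff p n) hp.eq_zero
  simp only [FormalMultilinearSeries.coeff_ofScalars] at this
  rw [this]
  rfl

theorem powerSeries_coeff_unique {a b : ℕ → ℂ} {f : ℂ → ℂ}
    (ha : ∀ z : ℂ, HasSum (fun n => a n * z ^ n) (f z))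
    (hb : ∀ z : ℂ, HasSum (fun n => b n * z ^ n) (f z)) : a = b := by
  refine sub_eq_zero.1 (powerSeries_coeff_eq_zero fun z => ?_)
  simpa [sub_mul] using (ha z).sub (hb z)

/-! ### Power series in several variables and exponential vectors -/

section MultiIndex

variable {ι : Type*} [Fintype ι]

/-- On each ray `t ↦ t z` the series becomes a one-variable power series whose coefficients are its
homogeneous parts at `z`. These vanish for every `z`, and a polynomial vanishing everywhere on `ℂ`
is zero. -/
theorem multiPowerSeries_coeff_eq_zero {c : (ι → ℕ) → ℂ}
    (h : ∀ z : ι → ℂ, HasSum (fun n => c n * ∏ i, z i ^ n i) 0) : c = 0 := by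
  classical
  -- The multi-indices of total degree `N`; the surrounding box makes the set finite.
  let F : ℕ → Finset (ι → ℕ) := fun N =>
    (Fintype.piFinset fun _ : ι => Finset.range (N + 1)).filter fun n => ∑ i, n i = N
  have hF : ∀ N n, n ∈ F N ↔ ∑ i, n i = N := by
    intro N n
    simp only [F, Finset.mem_filter, Fintype.mem_piFinset, Finset.mem_range, and_iff_right_iff_imp]
    rintro rfl i
    exact Nat.lt_succ_of_le (Finset.single_le_sum (f := n) (fun _ _ => Nat.zero_le _)
      (Finset.mem_univ i))
  have hsum : ∀ (z : ι → ℂ) N, ∑ n ∈ F N, c n * ∏ i, z i ^ n i = 0 := by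
    intro z N
    refine congrFun (powerSeries_coeff_eq_zero
      (a := fun N => ∑ n ∈ F N, c n * ∏ i, z i ^ n i) fun t => ?_) N
    have h1 := (h fun i => t * z i).tsum_fiberwise fun n : ι → ℕ => ∑ i, n i
    refine h1.congr_fun fun N => ?_
    have hset : ((fun n : ι → ℕ => ∑ i, n i) ⁻¹' {N}) = (F N : Set (ι → ℕ)) := by
      ext n; simp [hF]
    rw [hset, Finset.tsum_subtype' (F N) fun n : ι → ℕ => c n * ∏ i, (t * z i) ^ n i,
      Finset.sum_mul]
    refine Finset.sum_congr rfl fun n hn => ?_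
    simp only [mul_pow, Finset.prod_mul_distrib, Finset.prod_pow_eq_pow_sum, (hF N n).1 hn]
    ring
  funext n
  let P : MvPolynomial ι ℂ :=
    ∑ m ∈ F (∑ i, n i), MvPolynomial.monomial (Finsupp.equivFunOnFinite.symm m) (c m)
  have hP : P = 0 := by
    refine MvPolynomial.funext fun z => ?_
    rw [map_zero, ← hsum z (∑ i, n i)]
    simp only [P, map_sum, MvPolynomial.eval_monomial]
    refine Finset.sum_congr rfl fun m _ => ?_
    rw [Finsupp.prod_fintype _ _ (by simp)]
    simp
  have := congrArg (MvPolynomial.coeff (Finsupp.equivFunOnFinite.symm n)) hP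
  simpa [P, MvPolynomial.coeff_sum, MvPolynomial.coeff_monomial, hF] using this

theorem multiPowerSeries_coeff_unique {a b : (ι → ℕ) → ℂ} {f : (ι → ℂ) → ℂ}
    (ha : ∀ z, HasSum (fun n => a n * ∏ i, z i ^ n i) (f z))
    (hb : ∀ z, HasSum (fun n => b n * ∏ i, z i ^ n i) (f z)) : a = b := by
  refine sub_eq_zero.1 (multiPowerSeries_coeff_eq_zero fun z => ?_)
  simpa [sub_mul] using (ha z).sub (hb z)

/-! ### Exponential vectors -/

@[simp] theorem inner_ket_left (n : ι → ℕ) (x : Fock ι) : ⟪ket n, x⟫_ℂ = x n := by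
  simp [ket, lp.inner_single_left]

theorem ket_apply (n m : ι → ℕ) : (ket n : Fock ι) m = if m = n then 1 else 0 := by
  rw [ket, lp.single_apply]
  by_cases h : m = n
  · subst h; simp
  · simp [h]

theorem norm_ket (n : ι → ℕ) : ‖(ket n : Fock ι)‖ = 1 := by
  rw [ket, lp.norm_single (by norm_num)]; simp

theorem hasSum_ket (x : Fock ι) : HasSum (fun n => x n • ket n) x := by
  refine (lp.hasSum_single (by simp) x).congr_fun fun n => ?_
  rw [ket, ← lp.single_smul]
  simp

variable [DecidableEq ι]

theorem expVec_apply (β : ι → ℂ) (n : ι → ℕ) :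
    expVec β n = ∏ i, β i ^ n i / (Real.sqrt (n i).factorial : ℂ) := rfl

theorem sqrt_factorial_ne_zero (k : ℕ) : (Real.sqrt (k.factorial : ℝ) : ℂ) ≠ 0 := by
  have : (0 : ℝ) < k.factorial := by positivity
  exact_mod_cast (Real.sqrt_pos.2 this).ne'

theorem sqrt_factorial_mul_self (k : ℕ) :
    (Real.sqrt (k.factorial : ℝ) : ℂ) * (Real.sqrt (k.factorial : ℝ) : ℂ) = k.factorial := by
  rw [← Complex.ofReal_mul, Real.mul_self_sqrt (by positivity)]
  simp

theorem hasSum_prod_pow_div_factorial (x : ι → ℂ) :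
    HasSum (fun n : ι → ℕ => ∏ i, x i ^ n i / ((n i).factorial : ℂ)) (Complex.exp (∑ i, x i)) := by
  have hs : Summable (fun n : ι → ℕ => ∏ i, x i ^ n i / ((n i).factorial : ℂ)) := by
    -- Summability is free: the terms are those of the `ℓ²` pairing of `ε(1)` with `ε(x)`. The value
    -- is then computed along cubes, where the sum factorises over the modes.
    refine (lp.summable_inner (𝕜 := ℂ) (expVec (1 : ι → ℂ)) (expVec x)).congr fun n => ?_
    simp only [expVec_apply, RCLike.inner_apply, map_prod, ← Finset.prod_mul_distrib]
    refine Finset.prod_congr rfl fun i _ => ?_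
    rw [← sqrt_factorial_mul_self]
    simp [div_eq_mul_inv]
    ring
  have ht : Tendsto (fun M : ℕ => Fintype.piFinset fun _ : ι => Finset.range M) atTop atTop := by
    refine tendsto_atTop_finset_of_monotone (fun a b hab => ?_) fun n => ?_
    · exact Fintype.piFinset_subset _ _ fun _ => Finset.range_mono hab
    · refine ⟨Finset.univ.sup n + 1, ?_⟩
      simp only [Fintype.mem_piFinset, Finset.mem_range]
      exact fun i => Nat.lt_succ_of_le (Finset.le_sup (Finset.mem_univ i))
  have h1 := hs.hasSum.comp ht
  have h2 : Tendsto (fun M : ℕ => ∏ i : ι, ∑ k ∈ Finset.range M, x i ^ k / (k.factorial : ℂ)) atTop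
      (𝓝 (∏ i, Complex.exp (x i))) := by
    refine tendsto_finsetProd _ fun i _ => ?_
    have := (NormedSpace.expSeries_div_hasSum_exp (𝔸 := ℂ) (x i)).tendsto_sum_nat
    rwa [← Complex.exp_eq_exp_ℂ] at this
  have h3 : ∑' n : ι → ℕ, ∏ i, x i ^ n i / ((n i).factorial : ℂ) = Complex.exp (∑ i, x i) := by
    rw [Complex.exp_sum]
    refine tendsto_nhds_unique h1 (h2.congr fun M => ?_)
    exact (Finset.sum_prod_piFinset (Finset.range M)
      fun i k => x i ^ k / (k.factorial : ℂ)).symm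
  rw [← h3]
  exact hs.hasSum

theorem inner_expVec_expVec (β γ : ι → ℂ) :
    ⟪expVec β, expVec γ⟫_ℂ = Complex.exp (∑ i, star (β i) * γ i) := by
  refine (lp.hasSum_inner (expVec β) (expVec γ)).unique
    ((hasSum_prod_pow_div_factorial fun i => star (β i) * γ i).congr_fun fun n => ?_)
  simp only [expVec_apply, RCLike.inner_apply, map_prod, ← Finset.prod_mul_distrib]
  refine Finset.prod_congr rfl fun i _ => ?_
  rw [← sqrt_factorial_mul_self]
  simp [div_eq_mul_inv, mul_pow]
  ring

/-- The pairing with exponential vectors, as a power series. -/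
theorem hasSum_inner_expVec (z : ι → ℂ) (x : Fock ι) :
    HasSum (fun n => x n / (∏ i, (Real.sqrt (n i).factorial : ℂ)) * ∏ i, z i ^ n i)
      ⟪expVec (star z), x⟫_ℂ := by
  refine (lp.hasSum_inner (𝕜 := ℂ) (expVec (star z)) x).congr_fun fun n => ?_
  simp only [expVec_apply, RCLike.inner_apply, map_prod, Finset.prod_div_distrib, map_div₀, map_pow,
    Pi.star_apply, Complex.conj_ofReal, Complex.star_def, Complex.conj_conj]
  ring

/-- The Fock coordinates of `x` are, up to nonzero factorials, the Taylor coefficients of the entire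
function `z ↦ ⟨ε(star z), x⟩`. -/
theorem fock_ext {x y : Fock ι} (h : ∀ β : ι → ℂ, ⟪expVec β, x⟫_ℂ = ⟪expVec β, y⟫_ℂ) : x = y := by
  have := multiPowerSeries_coeff_unique (fun z => hasSum_inner_expVec z x)
    (fun z => by rw [h]; exact hasSum_inner_expVec z y)
  ext n
  have hn := congrFun this n
  have h0 : (∏ i, (Real.sqrt (n i).factorial : ℂ)) ≠ 0 :=
    Finset.prod_ne_zero_iff.2 fun i _ => sqrt_factorial_ne_zero _
  simpa [div_left_inj' h0] using hn

theorem span_expVec : (Submodule.span ℂ (Set.range (expVec : (ι → ℂ) → Fock ι))).topologicalClosure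
    = ⊤ := by
  rw [Submodule.topologicalClosure_eq_top_iff, Submodule.eq_bot_iff]
  intro x hx
  refine fock_ext fun β => ?_
  rw [inner_zero_right]
  exact (Submodule.mem_orthogonal _ _).1 hx _ (Submodule.subset_span ⟨β, rfl⟩)

theorem denseRange_expVec :
    DenseRange (Finsupp.linearCombination ℂ (expVec : (ι → ℂ) → Fock ι)) := by
  have h := Submodule.dense_iff_topologicalClosure_eq_top.2 (span_expVec (ι := ι))
  rw [← Finsupp.range_linearCombination] at h
  exact h

theorem clm_ext_expVec {F : Type*} [NormedAddCommGroup F] [NormedSpace ℂ F]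
    {A B : Fock ι →L[ℂ] F} (h : ∀ β, A (expVec β) = B (expVec β)) : A = B := by
  refine ContinuousLinearMap.ext_on (s := Set.range (expVec : (ι → ℂ) → Fock ι)) ?_ ?_
  · exact Submodule.dense_iff_topologicalClosure_eq_top.2 span_expVec
  · rintro _ ⟨β, rfl⟩; exact h β

theorem expVec_zero : expVec (0 : ι → ℂ) = ket 0 := by
  ext n
  rw [ket_apply, expVec_apply]
  split_ifs with h
  · simp [h]
  · obtain ⟨i, hi⟩ : ∃ i, n i ≠ 0 := by
      by_contra! hn; exact h (funext hn)
    exact Finset.prod_eq_zero (Finset.mem_univ i) (by simp [hi])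

/-! ### Isometries defined on exponential vectors -/

section Isometry

variable {H : Type*} [NormedAddCommGroup H] [InnerProductSpace ℂ H] {f : (ι → ℂ) → H}

/-- The norm of a linear combination depends only on the Gram matrix, so `ε(β) ↦ f β` extends
isometrically, and no linear independence of the `ε(β)` is needed. -/
theorem norm_linearCombination_eq_of_gram
    (hf : ∀ β γ, ⟪f β, f γ⟫_ℂ = Complex.exp (∑ i, star (β i) * γ i)) (c : (ι → ℂ) →₀ ℂ) :
    ‖Finsupp.linearCombination ℂ f c‖ =
      ‖Finsupp.linearCombination ℂ (expVec : (ι → ℂ) → Fock ι) c‖ := by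
  have h : ⟪Finsupp.linearCombination ℂ f c, Finsupp.linearCombination ℂ f c⟫_ℂ =
      ⟪Finsupp.linearCombination ℂ (expVec : (ι → ℂ) → Fock ι) c,
        Finsupp.linearCombination ℂ expVec c⟫_ℂ := by
    simp only [Finsupp.linearCombination_apply, Finsupp.sum, sum_inner, inner_sum, inner_smul_left,
      inner_smul_right, hf, inner_expVec_expVec]
  rw [inner_self_eq_norm_sq_to_K, inner_self_eq_norm_sq_to_K] at h
  have h' : ‖Finsupp.linearCombination ℂ f c‖ ^ 2 =
      ‖Finsupp.linearCombination ℂ (expVec : (ι → ℂ) → Fock ι) c‖ ^ 2 := by exact_mod_cast h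
  exact (sq_eq_sq₀ (norm_nonneg _) (norm_nonneg _)).1 h'

variable [CompleteSpace H]

theorem extendOfNorm_expVec
    (hf : ∀ β γ, ⟪f β, f γ⟫_ℂ = Complex.exp (∑ i, star (β i) * γ i)) (β : ι → ℂ) :
    LinearMap.extendOfNorm (Finsupp.linearCombination ℂ f)
      (Finsupp.linearCombination ℂ (expVec : (ι → ℂ) → Fock ι)) (expVec β) = f β := by
  have := LinearMap.extendOfNorm_eq (f := Finsupp.linearCombination ℂ f) denseRange_expVec
    ⟨1, fun x => by rw [one_mul]; exact (norm_linearCombination_eq_of_gram hf x).le⟩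
    (Finsupp.single β 1)
  simpa using this

theorem norm_extendOfNorm_expVec
    (hf : ∀ β γ, ⟪f β, f γ⟫_ℂ = Complex.exp (∑ i, star (β i) * γ i)) (x : Fock ι) :
    ‖LinearMap.extendOfNorm (Finsupp.linearCombination ℂ f)
      (Finsupp.linearCombination ℂ (expVec : (ι → ℂ) → Fock ι)) x‖ = ‖x‖ := by
  refine denseRange_expVec.induction_on (p := fun x => ‖LinearMap.extendOfNorm
    (Finsupp.linearCombination ℂ f) (Finsupp.linearCombination ℂ expVec) x‖ = ‖x‖) x
    (isClosed_eq (by fun_prop) (by fun_prop)) fun c => ?_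
  rw [LinearMap.extendOfNorm_eq denseRange_expVec
    ⟨1, fun x => by rw [one_mul]; exact (norm_linearCombination_eq_of_gram hf x).le⟩]
  exact norm_linearCombination_eq_of_gram hf c

end Isometry

end MultiIndex

/-! ### Displacement operators -/

section Displacement

variable {ι : Type*} [Fintype ι] [DecidableEq ι]

theorem ofReal_norm_sq_div_two (z : ℂ) : ((‖z‖ ^ 2 / 2 : ℝ) : ℂ) = z * star z / 2 := by
  rw [Complex.star_def, Complex.mul_conj, Complex.normSq_eq_norm_sq]
  push_cast
  ring

theorem gram_displacement (α β γ : ι → ℂ) :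
    ⟪Complex.exp (-∑ i, ((‖α i‖ ^ 2 / 2 : ℝ) : ℂ) - ∑ i, star (α i) * β i) • expVec (α + β),
      Complex.exp (-∑ i, ((‖α i‖ ^ 2 / 2 : ℝ) : ℂ) - ∑ i, star (α i) * γ i) • expVec (α + γ)⟫_ℂ =
      Complex.exp (∑ i, star (β i) * γ i) := by
  rw [inner_smul_left, inner_smul_right, inner_expVec_expVec, ← Complex.exp_conj,
    ← Complex.exp_add, ← Complex.exp_add]
  congr 1
  simp only [map_sub, map_neg, map_sum, ofReal_norm_sq_div_two,
    ← Finset.sum_neg_distrib, ← Finset.sum_sub_distrib, ← Finset.sum_add_distrib]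
  refine Finset.sum_congr rfl fun i _ => ?_
  simp [map_ofNat]
  ring

theorem displacement_expVec (α β : ι → ℂ) : displacement α (expVec β) =
    Complex.exp (-∑ i, ((‖α i‖ ^ 2 / 2 : ℝ) : ℂ) - ∑ i, star (α i) * β i) • expVec (α + β) :=
  extendOfNorm_expVec (gram_displacement α) β

theorem norm_displacement (α : ι → ℂ) (x : Fock ι) : ‖displacement α x‖ = ‖x‖ :=
  norm_extendOfNorm_expVec (gram_displacement α) x

theorem displacement_zero : displacement (0 : ι → ℂ) = 1 := by
  refine clm_ext_expVec fun β => ?_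
  rw [displacement_expVec]
  simp

/-- The Weyl relations: the phase is half the symplectic form, which is all that a symplectic map
has to preserve in order to respect products of displacements. -/
theorem displacement_displacement (α β : ι → ℂ) (x : Fock ι) :
    displacement α (displacement β x) =
      Complex.exp (∑ i, (α i * star (β i) - star (α i) * β i) / 2) • displacement (α + β) x := by
  suffices h : displacement α ∘L displacement β =
      Complex.exp (∑ i, (α i * star (β i) - star (α i) * β i) / 2) • displacement (α + β) from
    DFunLike.congr_fun h x
  refine clm_ext_expVec fun γ => ?_
  simp only [ContinuousLinearMap.comp_apply, smul_apply, displacement_expVec,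
    map_smul, smul_smul, ← Complex.exp_add, add_assoc]
  congr 2
  simp only [ofReal_norm_sq_div_two, ← Finset.sum_neg_distrib, ← Finset.sum_sub_distrib,
    ← Finset.sum_add_distrib]
  refine Finset.sum_congr rfl fun i _ => ?_
  simp
  ring

theorem displacement_neg_displacement (α : ι → ℂ) (x : Fock ι) :
    displacement (-α) (displacement α x) = x := by
  rw [displacement_displacement, neg_add_cancel, displacement_zero]
  have : ∑ i, ((-α) i * star (α i) - star ((-α) i) * α i) / 2 = 0 :=
    Finset.sum_eq_zero fun i _ => by simp; ring
  rw [this]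
  simp

theorem inner_displacement_displacement (α : ι → ℂ) (x y : Fock ι) :
    ⟪displacement α x, displacement α y⟫_ℂ = ⟪x, y⟫_ℂ :=
  LinearIsometry.inner_map_map
    (⟨(displacement α).toLinearMap, norm_displacement α⟩ : Fock ι →ₗᵢ[ℂ] Fock ι) x y

theorem inner_displacement_left (α : ι → ℂ) (x y : Fock ι) :
    ⟪displacement α x, y⟫_ℂ = ⟪x, displacement (-α) y⟫_ℂ := by
  rw [← inner_displacement_displacement (-α), displacement_neg_displacement]

theorem displacement_ket_zero (α : ι → ℂ) : displacement α (ket 0) =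
    Complex.exp (-∑ i, ((‖α i‖ ^ 2 / 2 : ℝ) : ℂ)) • expVec α := by
  rw [← expVec_zero, displacement_expVec]
  simp

theorem continuous_expVec : Continuous (expVec : (ι → ℂ) → Fock ι) := by
  have hsq : ∀ β γ : ι → ℂ, ‖(expVec β : Fock ι) - expVec γ‖ ^ 2 =
      (Complex.exp (∑ i, star (β i) * β i) - Complex.exp (∑ i, star (β i) * γ i) -
        (Complex.exp (∑ i, star (γ i) * β i) - Complex.exp (∑ i, star (γ i) * γ i))).re := by
    intro β γ
    rw [← inner_self_eq_norm_sq (𝕜 := ℂ)]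
    simp only [inner_sub_left, inner_sub_right, inner_expVec_expVec]
    simp
    ring
  rw [continuous_iff_continuousAt]
  intro γ
  rw [ContinuousAt, tendsto_iff_norm_sub_tendsto_zero]
  have h2 : Tendsto (fun β : ι → ℂ => ‖(expVec β : Fock ι) - expVec γ‖ ^ 2) (𝓝 γ) (𝓝 0) := by
    simp only [hsq]
    have hc : Continuous fun β : ι → ℂ =>
      (Complex.exp (∑ i, star (β i) * β i) - Complex.exp (∑ i, star (β i) * γ i) -
        (Complex.exp (∑ i, star (γ i) * β i) - Complex.exp (∑ i, star (γ i) * γ i))).re := by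
      fun_prop
    have := hc.tendsto γ
    simpa using this
  have h3 := (Real.continuous_sqrt.tendsto 0).comp h2
  rw [Real.sqrt_zero] at h3
  exact h3.congr fun β => Real.sqrt_sq (norm_nonneg _)

theorem continuous_displacement (x : Fock ι) : Continuous fun α : ι → ℂ => displacement α x := by
  have hd := denseRange_expVec (ι := ι) x
  rw [mem_closure_iff_frequently] at hd
  -- Displacements are isometric, so orbit maps of nearby vectors are uniformly close in `α`;
  -- continuity passes from combinations of exponential vectors to their limits.
  have hu : TendstoUniformly (fun (y : Fock ι) (α : ι → ℂ) => displacement α y)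
      (fun α => displacement α x) (𝓝 x) := by
    rw [Metric.tendstoUniformly_iff]
    intro ε hε
    filter_upwards [Metric.ball_mem_nhds x hε] with y hy α
    rwa [dist_eq_norm, ← map_sub, norm_displacement, ← dist_eq_norm, dist_comm]
  refine hu.continuous (hd.mono ?_)
  rintro _ ⟨c, rfl⟩
  simp only [Finsupp.linearCombination_apply, Finsupp.sum, map_sum, map_smul, displacement_expVec]
  refine continuous_finsetSum _ fun β _ => ?_
  have h1 : Continuous fun α : ι → ℂ => (expVec (α + β) : Fock ι) :=
    continuous_expVec.comp (continuous_id.add continuous_const)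
  have h2 : Continuous fun α : ι → ℂ =>
      Complex.exp (-∑ i, ((‖α i‖ ^ 2 / 2 : ℝ) : ℂ) - ∑ i, star (α i) * β i) := by fun_prop
  exact (h2.smul h1).const_smul (c β)

end Displacement

/-! ### Gaussian integrals -/

/-- With `w = x + iy` the integral is a product of two real Gaussians with linear terms `(A + B) x`
and `i (A - B) y`, and `((A + B)² - (A - B)²) / 4a = AB / a`. -/
theorem integral_complex_gaussian {a : ℝ} (ha : 0 < a) (A B : ℂ) :
    ∫ w : ℂ, Complex.exp (-(a * (w * star w)) + A * w + B * star w) =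
      Real.pi / a * Complex.exp (A * B / a) := by
  rw [← Complex.volume_preserving_equiv_real_prod.symm.integral_comp
    Complex.measurableEquivRealProd.symm.measurableEmbedding]
  have h1 : ∀ p : ℝ × ℝ, Complex.exp (-(a * (Complex.measurableEquivRealProd.symm p *
      star (Complex.measurableEquivRealProd.symm p))) +
      A * Complex.measurableEquivRealProd.symm p + B * star (Complex.measurableEquivRealProd.symm p))
      = Complex.exp (-a * (p.1 : ℂ) ^ 2 + (A + B) * p.1 + 0) *
        Complex.exp (-a * (p.2 : ℂ) ^ 2 + (A - B) * Complex.I * p.2 + 0) := by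
    rintro ⟨x, y⟩
    have e1 : Complex.measurableEquivRealProd.symm (x, y) = (x : ℂ) + y * Complex.I := by
      apply Complex.ext <;> simp [Complex.measurableEquivRealProd]
    rw [e1, ← Complex.exp_add]
    congr 1
    simp only [Complex.star_def, map_add, map_mul, Complex.conj_ofReal, Complex.conj_I]
    linear_combination (-(a : ℂ) * y ^ 2 * -1) * Complex.I_sq
  simp only [h1]
  rw [MeasureTheory.Measure.volume_eq_prod, MeasureTheory.integral_prod_mul
    (f := fun x : ℝ => Complex.exp (-a * (x : ℂ) ^ 2 + (A + B) * x + 0))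
    (g := fun y : ℝ => Complex.exp (-a * (y : ℂ) ^ 2 + (A - B) * Complex.I * y + 0)),
    integral_cexp_quadratic (by simpa using ha), integral_cexp_quadratic (by simpa using ha)]
  have ha' : (a : ℂ) ≠ 0 := by exact_mod_cast ha.ne'
  have hp : (Real.pi / a : ℂ) ≠ 0 :=
    div_ne_zero (by exact_mod_cast Real.pi_ne_zero) ha'
  rw [neg_neg, mul_mul_mul_comm, ← Complex.cpow_add _ _ hp, ← Complex.exp_add]
  norm_num
  field_simp
  ring_nf
  rw [Complex.I_sq]
  ring_nf
  exact Or.inl trivial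

theorem integrable_exp_neg_mul_norm_sq {a : ℝ} (ha : 0 < a) :
    MeasureTheory.Integrable fun w : ℂ => Real.exp (-a * ‖w‖ ^ 2) := by
  rw [← Complex.volume_preserving_equiv_real_prod.symm.integrable_comp_emb
    Complex.measurableEquivRealProd.symm.measurableEmbedding]
  have h := (integrable_exp_neg_mul_sq ha).mul_prod (integrable_exp_neg_mul_sq ha)
  refine h.congr (Eventually.of_forall ?_)
  rintro ⟨x, y⟩
  have e1 : Complex.measurableEquivRealProd.symm (x, y) = (x : ℂ) + y * Complex.I := by
    apply Complex.ext <;> simp [Complex.measurableEquivRealProd]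
  simp only [Function.comp, e1, ← Complex.normSq_eq_norm_sq, Complex.normSq_add_mul_I,
    ← Real.exp_add]
  ring_nf

/-! ### Irreducibility of the displacement operators -/

section Irreducible

variable {ι : Type*} [Fintype ι]

/-- The Gaussian weight `exp (-|α|² / 2)`. -/
noncomputable def gaussWeight (α : ι → ℂ) : ℂ := Complex.exp (-∑ i, ((‖α i‖ ^ 2 / 2 : ℝ) : ℂ))

theorem norm_gaussWeight (α : ι → ℂ) :
    ‖gaussWeight α‖ = ∏ i, Real.exp (-(1 / 2) * ‖α i‖ ^ 2) := by
  rw [gaussWeight, Complex.norm_exp, ← Real.exp_sum, ← Complex.ofReal_sum, ← Complex.ofReal_neg,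
    Complex.ofReal_re, ← Finset.sum_neg_distrib]
  congr 1
  exact Finset.sum_congr rfl fun i _ => by ring

theorem continuous_gaussWeight : Continuous (gaussWeight : (ι → ℂ) → ℂ) := by
  unfold gaussWeight
  fun_prop

theorem integrable_gaussWeight : MeasureTheory.Integrable (gaussWeight : (ι → ℂ) → ℂ) := by
  rw [← MeasureTheory.integrable_norm_iff continuous_gaussWeight.aestronglyMeasurable]
  simp only [norm_gaussWeight]
  exact MeasureTheory.Integrable.fintype_prod
    (f := fun (_ : ι) (w : ℂ) => Real.exp (-(1 / 2) * ‖w‖ ^ 2))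
    fun _ => integrable_exp_neg_mul_norm_sq (by norm_num)

variable [DecidableEq ι]

theorem integrable_gaussWeight_smul_displacement (u : Fock ι) :
    MeasureTheory.Integrable fun α : ι → ℂ => gaussWeight α • displacement α u := by
  refine (integrable_gaussWeight.norm.mul_const ‖u‖).mono'
    (continuous_gaussWeight.smul (continuous_displacement u)).aestronglyMeasurable
    (Eventually.of_forall fun α => ?_)
  rw [norm_smul, norm_displacement]

/-- The integrand is `exp ⟨β, γ⟩` times one-mode Gaussians with integrals `π exp (-star (β i) γ i)`.
The exponentials cancel, leaving the constant matrix elements of a multiple of the vacuum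
projection. -/
theorem integral_inner_expVec_displacement (β γ : ι → ℂ) :
    ∫ α : ι → ℂ, gaussWeight α * ⟪expVec β, displacement α (expVec γ)⟫_ℂ =
      (Real.pi : ℂ) ^ Fintype.card ι := by
  have h1 : ∀ α : ι → ℂ, gaussWeight α * ⟪expVec β, displacement α (expVec γ)⟫_ℂ =
      Complex.exp (∑ i, star (β i) * γ i) * ∏ i, Complex.exp (-(((1 : ℝ) : ℂ) *
        (α i * star (α i))) + star (β i) * α i + -γ i * star (α i)) := by
    intro α
    rw [displacement_expVec, inner_smul_right, inner_expVec_expVec, gaussWeight, ← Complex.exp_sum,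
      ← Complex.exp_add, ← Complex.exp_add, ← Complex.exp_add]
    congr 1
    simp only [ofReal_norm_sq_div_two, ← Finset.sum_neg_distrib, ← Finset.sum_sub_distrib,
      ← Finset.sum_add_distrib]
    refine Finset.sum_congr rfl fun i _ => ?_
    simp
    ring
  simp only [h1]
  rw [MeasureTheory.integral_const_mul, MeasureTheory.volume_pi,
    MeasureTheory.integral_fintype_prod_eq_prod (fun i (w : ℂ) => Complex.exp (-(((1 : ℝ) : ℂ) *
        (w * star w)) + star (β i) * w + -γ i * star w))]
  simp only [integral_complex_gaussian one_pos, Finset.prod_mul_distrib, ← Complex.exp_sum]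
  rw [mul_left_comm, ← Complex.exp_add, ← Finset.sum_add_distrib]
  simp

theorem integral_gaussWeight_smul_displacement (u : Fock ι) :
    ∫ α : ι → ℂ, gaussWeight α • displacement α u =
      ((Real.pi : ℂ) ^ Fintype.card ι * u 0) • ket 0 := by
  -- Packaging the integral as a bounded operator allows the identity to be checked on exponential
  -- vectors only.
  let P : Fock ι →L[ℂ] Fock ι := LinearMap.mkContinuous
    { toFun := fun u => ∫ α : ι → ℂ, gaussWeight α • displacement α u
      map_add' := fun u v => by
        simp only [map_add, smul_add]
        exact MeasureTheory.integral_add (integrable_gaussWeight_smul_displacement u)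
          (integrable_gaussWeight_smul_displacement v)
      map_smul' := fun c u => by
        simp only [map_smul, smul_comm _ c, RingHom.id_apply]
        exact MeasureTheory.integral_smul c _ }
    (∫ α : ι → ℂ, ‖gaussWeight α‖) fun u => by
      refine (MeasureTheory.norm_integral_le_integral_norm _).trans_eq ?_
      simp only [norm_smul, norm_displacement]
      exact MeasureTheory.integral_mul_const _ _
  have hP : P = (Real.pi : ℂ) ^ Fintype.card ι • ketBra (ket 0) (ket 0) := by
    refine clm_ext_expVec fun γ => fock_ext fun β => ?_
    have h1 : ⟪expVec β, P (expVec γ)⟫_ℂ =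
        ∫ α : ι → ℂ, ⟪expVec β, gaussWeight α • displacement α (expVec γ)⟫_ℂ :=
      (integral_inner (integrable_gaussWeight_smul_displacement _) _).symm
    rw [h1]
    simp only [inner_smul_right, integral_inner_expVec_displacement]
    rw [smul_apply, inner_smul_right, InnerProductSpace.rankOne_apply, inner_smul_right,
      ← expVec_zero, inner_expVec_expVec, inner_expVec_expVec]
    simp
  refine (DFunLike.congr_fun hP u : P u = _).trans ?_
  simp [smul_smul]

variable {u v : ℕ → Fock ι}

/-- For `T = ∑ |u k⟩⟨v k|` the hypothesis says `Tr (T D(α)) = 0`. Integrating it against the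
Gaussian weight and exchanging sum and integral, which is dominated by `∑ ‖u k‖ ‖v k‖`, gives `π ^
card ι` times `⟨0|T|0⟩`. -/
theorem tsum_vacuum_eq_zero_of_displacement (hs : Summable fun k => ‖u k‖ * ‖v k‖)
    (h : ∀ α, ∑' k, ⟪v k, displacement α (u k)⟫_ℂ = 0) :
    ∑' k, ⟪v k, ket 0⟫_ℂ * ⟪ket 0, u k⟫_ℂ = 0 := by
  let F : ℕ → (ι → ℂ) → ℂ := fun k α => ⟪v k, gaussWeight α • displacement α (u k)⟫_ℂ
  have hn : ∀ k α, ‖F k α‖ ≤ ‖gaussWeight α‖ * (‖u k‖ * ‖v k‖) := fun k α => by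
    refine (norm_inner_le_norm _ _).trans_eq ?_
    rw [norm_smul, norm_displacement]; ring
  have hF : ∀ k, MeasureTheory.Integrable (F k) := fun k =>
    (integrable_gaussWeight_smul_displacement (u k)).const_inner (v k)
  have hsum : Summable fun k => ∫ α, ‖F k α‖ := by
    refine Summable.of_nonneg_of_le (fun _ => MeasureTheory.integral_nonneg fun _ => norm_nonneg _)
      (fun k => ?_) (hs.mul_left (∫ α : ι → ℂ, ‖gaussWeight α‖))
    rw [← MeasureTheory.integral_mul_const]
    exact MeasureTheory.integral_mono (hF k).norm (integrable_gaussWeight.norm.mul_const _) (hn k)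
  have h1 := MeasureTheory.hasSum_integral_of_summable_integral_norm hF hsum
  have h2 : ∀ α, ∑' k, F k α = 0 := fun α => by
    simp only [F, inner_smul_right, tsum_mul_left, h, mul_zero]
  have h3 : ∀ k, ∫ α, F k α = (Real.pi : ℂ) ^ Fintype.card ι *
      (⟪v k, ket 0⟫_ℂ * ⟪ket 0, u k⟫_ℂ) := fun k => by
    rw [integral_inner (integrable_gaussWeight_smul_displacement _),
      integral_gaussWeight_smul_displacement, inner_smul_right, inner_ket_left]
    ring
  simp only [h2, h3, MeasureTheory.integral_zero] at h1
  have := h1.tsum_eq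
  rw [tsum_mul_left] at this
  exact (mul_eq_zero.1 this).resolve_left (pow_ne_zero _ (by exact_mod_cast Real.pi_ne_zero))

/-- Displacing `u` and `v` shifts the argument of the characteristic function and multiplies it by a
phase, so it still vanishes, while the vacuum expectation becomes a nonzero multiple of
`⟨ε(γ)|T|ε(β)⟩`. -/
theorem tsum_expVec_eq_zero_of_displacement (hs : Summable fun k => ‖u k‖ * ‖v k‖)
    (h : ∀ α, ∑' k, ⟪v k, displacement α (u k)⟫_ℂ = 0) (β γ : ι → ℂ) :
    ∑' k, ⟪v k, expVec β⟫_ℂ * ⟪expVec γ, u k⟫_ℂ = 0 := by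
  have h1 := tsum_vacuum_eq_zero_of_displacement (u := fun k => displacement (-γ) (u k))
    (v := fun k => displacement (-β) (v k)) (by simpa only [norm_displacement] using hs)
    fun α => by
      have : ∀ k, ⟪displacement (-β) (v k), displacement α (displacement (-γ) (u k))⟫_ℂ =
          (Complex.exp (∑ i, (α i * star ((-γ) i) - star (α i) * (-γ) i) / 2) *
            Complex.exp (∑ i, (β i * star ((α + -γ) i) - star (β i) * (α + -γ) i) / 2)) *
          ⟪v k, displacement (β + (α + -γ)) (u k)⟫_ℂ := fun k => by
        rw [inner_displacement_left, neg_neg, displacement_displacement α, map_smul,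
          displacement_displacement β, inner_smul_right, inner_smul_right, mul_assoc]
      simp only [this, tsum_mul_left, h, mul_zero]
  have h2 : ∀ k, ⟪displacement (-β) (v k), ket 0⟫_ℂ * ⟪ket 0, displacement (-γ) (u k)⟫_ℂ =
      (gaussWeight β * star (gaussWeight γ)) * (⟪v k, expVec β⟫_ℂ * ⟪expVec γ, u k⟫_ℂ) := fun k => by
    rw [inner_displacement_left, neg_neg, ← inner_displacement_left γ (ket 0), displacement_ket_zero,
      displacement_ket_zero, inner_smul_right, inner_smul_left, ← gaussWeight, ← gaussWeight]
    simp only [Complex.star_def]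
    ring
  simp only [h2, tsum_mul_left] at h1
  refine (mul_eq_zero.1 h1).resolve_left (mul_ne_zero (Complex.exp_ne_zero _) ?_)
  rw [Complex.star_def, map_ne_zero]
  exact Complex.exp_ne_zero _

/-- A bounded operator `∑ k, |u k⟩⟨v k|` of trace class vanishes if its characteristic function
does. -/
theorem clm_eq_zero_of_displacement {T : Fock ι →L[ℂ] Fock ι}
    (hT : ∀ x, HasSum (fun k => ⟪v k, x⟫_ℂ • u k) (T x)) (hs : Summable fun k => ‖u k‖ * ‖v k‖)
    (h : ∀ α, ∑' k, ⟪v k, displacement α (u k)⟫_ℂ = 0) : T = 0 := by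
  refine clm_ext_expVec fun β => fock_ext fun γ => ?_
  have h1 := ((hT (expVec β)).mapL (innerSL ℂ (expVec γ))).tsum_eq
  simp only [innerSL_apply_apply, inner_smul_right] at h1
  rw [← h1, tsum_expVec_eq_zero_of_displacement hs h]
  simp

/-- The rank-one case `T = |ψ⟩⟨φ|`: every nonzero vector is cyclic for the displacements. This is
what makes the implementing isometries surjective. -/
theorem eq_zero_of_inner_displacement {φ ψ : Fock ι} (hψ : ψ ≠ 0)
    (h : ∀ α, ⟪φ, displacement α ψ⟫_ℂ = 0) : φ = 0 := by
  have key := tsum_expVec_eq_zero_of_displacement (u := Pi.single 0 ψ) (v := fun _ => φ)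
    (summable_of_ne_finset_zero (s := {0}) fun k hk => by
      simp [Pi.single_eq_of_ne (Finset.notMem_singleton.1 hk)])
    fun α => by
      rw [tsum_eq_single 0 fun k hk => by simp [Pi.single_eq_of_ne hk]]
      simpa using h α
  have key' : ∀ β γ, ⟪φ, expVec β⟫_ℂ * ⟪expVec γ, ψ⟫_ℂ = 0 := fun β γ => by
    have := key β γ
    rwa [tsum_eq_single 0 fun k hk => by simp [Pi.single_eq_of_ne hk], Pi.single_eq_same] at this
  obtain ⟨γ, hγ⟩ : ∃ γ, ⟪expVec γ, ψ⟫_ℂ ≠ 0 := by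
    by_contra! hc
    exact hψ (fock_ext fun γ => by rw [hc, inner_zero_right])
  refine fock_ext fun β => ?_
  rw [inner_zero_right, inner_eq_zero_symm]
  exact (mul_eq_zero.1 (key' β γ)).resolve_right hγ

end Irreducible

/-! ### Unitaries implementing symplectic transformations -/

section Unitary

variable {ι : Type*}

/-- The phase-space coordinates of the Weyl operator `W(ξ)`. -/
noncomputable def weylParam (ξ : ι × Fin 2 → ℝ) : ι → ℂ :=
  fun i => Complex.I * (ξ (i, 0) + ξ (i, 1) * Complex.I)

theorem exists_weylParam_eq (α : ι → ℂ) : ∃ ξ : ι × Fin 2 → ℝ, weylParam ξ = α := by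
  -- Since `i (q + ip) = -p + iq`, the preimage is `q = Im α`, `p = -Re α`.
  refine ⟨fun p => if p.2 = 0 then (α p.1).im else -(α p.1).re, funext fun i => ?_⟩
  apply Complex.ext <;> simp [weylParam]

variable [Fintype ι] [DecidableEq ι]

theorem weyl_eq_displacement (ξ : ι × Fin 2 → ℝ) : weyl ξ = displacement (weylParam ξ) := rfl

/-- A real-linear symplectic transformation of phase space, in complex coordinates. -/
def IsSymplecticMap (A : (ι → ℂ) ≃+ (ι → ℂ)) : Prop :=
  ∀ α β, ∑ i, (A α i * star (A β i) - star (A α i) * A β i) / 2 =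
    ∑ i, (α i * star (β i) - star (α i) * β i) / 2

variable {A : (ι → ℂ) ≃+ (ι → ℂ)} {ψ : Fock ι}

/-- Since `ε(β) = (gaussWeight β)⁻¹ • D(β)|0⟩`, the inner products on both sides reduce by the Weyl
relations to the same phases and to a vacuum-type expectation, and `hψ` says that these expectations
agree. -/
theorem gram_symplectic (hA : IsSymplecticMap A)
    (hψ : ∀ α, ⟪ψ, displacement (A α) ψ⟫_ℂ = gaussWeight α) (β γ : ι → ℂ) :
    ⟪(gaussWeight β)⁻¹ • displacement (A β) ψ, (gaussWeight γ)⁻¹ • displacement (A γ) ψ⟫_ℂ =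
      Complex.exp (∑ i, star (β i) * γ i) := by
  have h := hA (-β) γ
  rw [inner_smul_left, inner_smul_right, inner_displacement_left, ← map_neg,
    displacement_displacement, h, ← map_add, inner_smul_right, hψ]
  simp only [gaussWeight, ← Complex.exp_neg, ← Complex.exp_conj, ← Complex.exp_add]
  congr 1
  simp only [neg_neg, map_sum, ofReal_norm_sq_div_two, ← Finset.sum_neg_distrib,
    ← Finset.sum_add_distrib]
  refine Finset.sum_congr rfl fun i _ => ?_
  simp [map_ofNat]
  ring

/-- A GNS argument: `D(α)` with the vacuum and `D(A α)` with `ψ` obey the same relations and have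
the same expectation function, so they are intertwined by an isometry, which is onto because `ψ` is
cyclic. -/
theorem exists_unitary_of_symplectic (hA : IsSymplecticMap A)
    (hψ : ∀ α, ⟪ψ, displacement (A α) ψ⟫_ℂ = gaussWeight α) :
    ∃ V : Fock ι ≃ₗᵢ[ℂ] Fock ι, (∀ α x, V (displacement α x) = displacement (A α) (V x)) ∧
      V (ket 0) = ψ := by
  let f : (ι → ℂ) → Fock ι := fun β => (gaussWeight β)⁻¹ • displacement (A β) ψ
  have hf := gram_symplectic hA hψ
  let V₀ : Fock ι →ₗᵢ[ℂ] Fock ι := ⟨(LinearMap.extendOfNorm (Finsupp.linearCombination ℂ f)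
    (Finsupp.linearCombination ℂ expVec)).toLinearMap, norm_extendOfNorm_expVec hf⟩
  have hV : ∀ β, V₀ (expVec β) = f β := extendOfNorm_expVec hf
  have hψ0 : ψ ≠ 0 := by
    rintro rfl
    have := hψ 0
    simp [gaussWeight] at this
  -- The range is closed, and as `A` is onto, a vector orthogonal to it is orthogonal to every `D(α)
  -- ψ`.
  have hsurj : Function.Surjective V₀ := by
    have hcl : IsClosed (LinearMap.range V₀.toLinearMap : Set (Fock ι)) := by
      rw [LinearMap.coe_range]
      exact V₀.isometry.isClosedEmbedding.isClosed_range
    have htop : LinearMap.range V₀.toLinearMap = ⊤ := by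
      rw [← hcl.submodule_topologicalClosure_eq, Submodule.topologicalClosure_eq_top_iff,
        Submodule.eq_bot_iff]
      intro φ hφ
      refine eq_zero_of_inner_displacement hψ0 fun α => ?_
      have h1 : ⟪V₀ (expVec (A.symm α)), φ⟫_ℂ = 0 :=
        (Submodule.mem_orthogonal _ _).1 hφ _ ⟨_, rfl⟩
      rw [hV, inner_smul_left, AddEquiv.apply_symm_apply] at h1
      rw [inner_eq_zero_symm]
      refine (mul_eq_zero.1 h1).resolve_left ?_
      exact fun h => inv_ne_zero (Complex.exp_ne_zero _) ((map_eq_zero _).1 h)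
    exact LinearMap.range_eq_top.1 htop
  refine ⟨LinearIsometryEquiv.ofSurjective V₀ hsurj, fun α x => ?_, ?_⟩
  · suffices h : V₀.toContinuousLinearMap ∘L displacement α =
        displacement (A α) ∘L V₀.toContinuousLinearMap from DFunLike.congr_fun h x
    refine clm_ext_expVec fun β => ?_
    simp only [ContinuousLinearMap.comp_apply, LinearIsometry.coe_toContinuousLinearMap,
      displacement_expVec, map_smul, hV, f, displacement_displacement, hA α β, smul_smul, map_add,
      gaussWeight, ← Complex.exp_neg, ← Complex.exp_add]
    congr 2
    simp only [neg_neg, ofReal_norm_sq_div_two, ← Finset.sum_neg_distrib,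
      ← Finset.sum_add_distrib, ← Finset.sum_sub_distrib]
    refine Finset.sum_congr rfl fun i _ => ?_
    simp
    ring
  · rw [LinearIsometryEquiv.coe_ofSurjective, ← expVec_zero, hV]
    simp [f, gaussWeight, displacement_zero]

theorem apply_expVec_of_intertwines {V : Fock ι ≃ₗᵢ[ℂ] Fock ι}
    (hV : ∀ α x, V (displacement α x) = displacement (A α) (V x)) (h0 : V (ket 0) = ψ)
    (β : ι → ℂ) : gaussWeight β • V (expVec β) = displacement (A β) ψ := by
  rw [← h0, ← hV, displacement_ket_zero, map_smul, gaussWeight]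

/-- The defining relation conjugates by `U† · U`, so the operator that moves displacements forward
along `Sᵀ` is `U†`, and `U` is `V.symm`. -/
theorem isGaussianUnitary_symm {S : Matrix (ι × Fin 2) (ι × Fin 2) ℝ} {V : Fock ι ≃ₗᵢ[ℂ] Fock ι}
    (hV : ∀ α x, V (displacement α x) = displacement (A α) (V x))
    (hS : ∀ ξ, weylParam (Sᵀ *ᵥ ξ) = A (weylParam ξ)) : IsGaussianUnitary S V.symm := by
  intro ξ v
  rw [LinearIsometryEquiv.symm_symm, weyl_eq_displacement, hV, LinearIsometryEquiv.apply_symm_apply,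
    weyl_eq_displacement, hS]

end Unitary

/-! ### Traces -/

section Trace

variable {ι : Type*}

theorem hasSum_coord_mul (x y : Fock ι) : HasSum (fun n => star (x n) * y n) ⟪x, y⟫_ℂ := by
  refine (lp.hasSum_inner (𝕜 := ℂ) x y).congr_fun fun n => ?_
  simp [mul_comm]

theorem summable_norm_coord_mul (x y : Fock ι) : Summable fun n => ‖x n‖ * ‖y n‖ :=
  lp.summable_mul (Real.holderConjugate_iff.2 (by norm_num)) x y

theorem tsum_norm_coord_mul_le (x y : Fock ι) : ∑' n, ‖x n‖ * ‖y n‖ ≤ ‖x‖ * ‖y‖ :=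
  lp.tsum_mul_le_mul_norm' (Real.holderConjugate_iff.2 (by norm_num)) x y

variable [Fintype ι] {u v : ℕ → Fock ι}

theorem exists_hasSum_of_summable_prod {κ : Type*} {g : ℕ × κ → ℂ} (hg : Summable g) {a : ℕ → ℂ}
    {b : κ → ℂ} (ha : ∀ k, HasSum (fun n => g (k, n)) (a k))
    (hb : ∀ n, HasSum (fun k => g (k, n)) (b n)) : ∃ s, HasSum a s ∧ HasSum b s := by
  have h3 : HasSum (fun p : κ × ℕ => g (p.2, p.1)) (∑' p, g p) :=
    (Equiv.prodComm κ ℕ).hasSum_iff (f := g) |>.2 hg.hasSum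
  exact ⟨∑' p, g p, hg.hasSum.prod_fiberwise ha, h3.prod_fiberwise hb⟩

/-- Fubini for the double family `star (v k n) * u k n`, absolutely summable by Cauchy–Schwarz.
Summing over `n` first gives `⟨v k, u k⟩`, over `k` first the diagonal entries of `T`; the trace can
thus be read off any decomposition. -/
theorem exists_hasSum_diagonal {T : Fock ι →L[ℂ] Fock ι}
    (hT : ∀ x, HasSum (fun k => ⟪v k, x⟫_ℂ • u k) (T x)) (hs : Summable fun k => ‖u k‖ * ‖v k‖) :
    ∃ a, HasSum (fun k => ⟪v k, u k⟫_ℂ) a ∧ HasSum (fun n => ⟪ket n, T (ket n)⟫_ℂ) a := by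
  let g : ℕ × (ι → ℕ) → ℂ := fun p => star (v p.1 p.2) * u p.1 p.2
  have hnorm : ∀ p, ‖g p‖ = ‖v p.1 p.2‖ * ‖u p.1 p.2‖ := fun p => by
    simp only [g, norm_mul, norm_star]
  have hsum : Summable g := by
    have h : Summable fun p => ‖g p‖ := by
      refine (summable_prod_of_nonneg fun p => norm_nonneg (g p)).2 ⟨fun k => ?_, ?_⟩
      · simp only [hnorm]
        exact summable_norm_coord_mul _ _
      · simp only [hnorm]
        exact Summable.of_nonneg_of_le (fun k => tsum_nonneg fun n => by positivity)
          (fun k => (tsum_norm_coord_mul_le _ _).trans_eq (mul_comm _ _)) hs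
    exact h.of_norm
  have h2 : ∀ n, HasSum (fun k => g (k, n)) ⟪ket n, T (ket n)⟫_ℂ := fun n => by
    have := (hT (ket n)).mapL (innerSL ℂ (ket n))
    simp only [innerSL_apply_apply, inner_smul_right, inner_ket_left] at this
    rw [inner_ket_left]
    refine this.congr_fun fun k => ?_
    rw [← inner_conj_symm, inner_ket_left]
    rfl
  exact exists_hasSum_of_summable_prod hsum (fun k => hasSum_coord_mul (v k) (u k)) h2

theorem hasSum_trace {T : Fock ι →L[ℂ] Fock ι}
    (hT : ∀ x, HasSum (fun k => ⟪v k, x⟫_ℂ • u k) (T x)) (hs : Summable fun k => ‖u k‖ * ‖v k‖) :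
    HasSum (fun k => ⟪v k, u k⟫_ℂ) (trace T) := by
  obtain ⟨a, h1, h2⟩ := exists_hasSum_diagonal hT hs
  rwa [trace, h2.tsum_eq]

variable [DecidableEq ι]

theorem hasSum_comp_weyl {T : Fock ι →L[ℂ] Fock ι}
    (hT : ∀ x, HasSum (fun k => ⟪v k, x⟫_ℂ • u k) (T x)) (ξ : ι × Fin 2 → ℝ) (x : Fock ι) :
    HasSum (fun k => ⟪displacement (-weylParam ξ) (v k), x⟫_ℂ • u k) ((T ∘L weyl ξ) x) := by
  simp only [inner_displacement_left, neg_neg]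
  exact hT _

theorem hasSum_charFn {T : Fock ι →L[ℂ] Fock ι}
    (hT : ∀ x, HasSum (fun k => ⟪v k, x⟫_ℂ • u k) (T x)) (hs : Summable fun k => ‖u k‖ * ‖v k‖)
    (ξ : ι × Fin 2 → ℝ) :
    HasSum (fun k => ⟪v k, displacement (weylParam ξ) (u k)⟫_ℂ) (charFn ξ T) := by
  have := hasSum_trace (hasSum_comp_weyl hT ξ) (by simpa only [norm_displacement] using hs)
  simp only [inner_displacement_left, neg_neg] at this
  exact this

theorem exists_traceClass_decomposition {E : Type*} [NormedAddCommGroup E]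
    [InnerProductSpace ℂ E] {T : E →L[ℂ] E} (hT : traceNorm T < ⊤) : ∃ u v : ℕ → E,
      (∀ x, HasSum (fun k => ⟪v k, x⟫_ℂ • u k) (T x)) ∧ Summable fun k => ‖u k‖ * ‖v k‖ := by
  obtain ⟨u, v, h, hs⟩ := (traceNorm_lt_top_iff _).1 hT
  refine ⟨u, v, h, ?_⟩
  have : ∀ k, ‖u k‖ₑ * ‖v k‖ₑ = ((‖u k‖₊ * ‖v k‖₊ : NNReal) : ℝ≥0∞) := fun k => by
    simp [enorm_eq_nnnorm]
  simp only [this] at hs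
  exact NNReal.summable_coe.2 (ENNReal.tsum_coe_ne_top_iff_summable.1 hs.ne)

theorem charFn_sub (ρ σ : TraceClass (Fock ι)) (ξ : ι × Fin 2 → ℝ) :
    charFn ξ (ρ.1 - σ.1) = charFn ξ ρ.1 - charFn ξ σ.1 := by
  -- The trace is a `tsum`, so additivity needs the diagonal series to converge, which the
  -- trace-class property supplies.
  have key : ∀ τ : TraceClass (Fock ι),
      HasSum (fun n => ⟪ket n, (τ.1 ∘L weyl ξ) (ket n)⟫_ℂ) (charFn ξ τ.1) := fun τ => by
    obtain ⟨u, v, huv, hs⟩ := exists_traceClass_decomposition τ.2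
    obtain ⟨a, -, h⟩ := exists_hasSum_diagonal (hasSum_comp_weyl huv ξ)
      (by simpa only [norm_displacement] using hs)
    exact h.summable.hasSum
  refine HasSum.tsum_eq (((key ρ).sub (key σ)).congr_fun fun n => ?_)
  rw [← inner_sub_right]
  rfl

theorem traceClass_ext_charFn {ρ σ : TraceClass (Fock ι)}
    (h : ∀ ξ, charFn ξ ρ.1 = charFn ξ σ.1) : ρ = σ := by
  obtain ⟨u, v, huv, hs⟩ := exists_traceClass_decomposition (ρ - σ).2
  rw [← sub_eq_zero]
  refine Subtype.ext (clm_eq_zero_of_displacement huv hs fun α => ?_)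
  obtain ⟨ξ, rfl⟩ := exists_weylParam_eq α
  rw [(hasSum_charFn huv hs ξ).tsum_eq]
  exact (charFn_sub ρ σ ξ).trans (sub_eq_zero.2 (h ξ))

end Trace

/-! ### Two-mode product vectors -/

section Tensor

theorem vecCons_apply_zero {M : Type*} (n : Fin 1 → M) : ![n 0] = n := by
  ext i; fin_cases i; rfl

theorem vecCons_apply_zero_one {M : Type*} (n : Fin 2 → M) : ![n 0, n 1] = n := by
  ext i; fin_cases i <;> rfl

/-- Indices of a single mode. -/
def vecOneEquiv : ℕ ≃ (Fin 1 → ℕ) where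
  toFun k := ![k]
  invFun n := n 0
  left_inv _ := rfl
  right_inv n := vecCons_apply_zero n

theorem summable_norm_sq_coord₁ (u : Fock (Fin 1)) : Summable fun k : ℕ => ‖u ![k]‖ ^ 2 := by
  have h := (lp.memℓp u).summable (by norm_num)
  simp only [ENNReal.toReal_ofNat, Real.rpow_ofNat] at h
  exact h.comp_injective vecOneEquiv.injective

theorem memℓp_tensor (u v : Fock (Fin 1)) :
    Memℓp (fun n : Fin 2 → ℕ => u ![n 0] * v ![n 1]) 2 := by
  refine memℓp_gen ?_
  have h := (summable_norm_sq_coord₁ u).mul_of_nonneg (summable_norm_sq_coord₁ v)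
    (fun _ => sq_nonneg _) (fun _ => sq_nonneg _)
  have h2 := ((finTwoArrowEquiv ℕ).summable_iff (f := fun p : ℕ × ℕ =>
    ‖u ![p.1]‖ ^ 2 * ‖v ![p.2]‖ ^ 2)).2 h
  refine h2.congr fun n => ?_
  simp [mul_pow]

/-- The product vector `u ⊗ v`. -/
noncomputable def tensorVec (u v : Fock (Fin 1)) : Fock (Fin 2) :=
  ⟨fun n => u ![n 0] * v ![n 1], memℓp_tensor u v⟩

theorem tensorVec_apply (u v : Fock (Fin 1)) (n : Fin 2 → ℕ) :
    tensorVec u v n = u ![n 0] * v ![n 1] := rfl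

theorem hasSum_mul_fin_two {f g : ℕ → ℂ} {a b : ℂ} (hf : HasSum f a) (hg : HasSum g b) :
    HasSum (fun n : Fin 2 → ℕ => f (n 0) * g (n 1)) (a * b) := by
  have hs : Summable fun p : ℕ × ℕ => f p.1 * g p.2 :=
    summable_mul_of_summable_norm hf.summable.norm hg.summable.norm
  exact (finTwoArrowEquiv ℕ).hasSum_iff (f := fun p : ℕ × ℕ => f p.1 * g p.2) |>.2 (hf.mul hg hs)

theorem hasSum_coord₁ (x y : Fock (Fin 1)) :
    HasSum (fun k : ℕ => star (x ![k]) * y ![k]) ⟪x, y⟫_ℂ :=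
  vecOneEquiv.hasSum_iff (f := fun n => star (x n) * y n) |>.2 (hasSum_coord_mul x y)

theorem inner_tensorVec (u v u' v' : Fock (Fin 1)) :
    ⟪tensorVec u v, tensorVec u' v'⟫_ℂ = ⟪u, u'⟫_ℂ * ⟪v, v'⟫_ℂ := by
  have h := hasSum_mul_fin_two (hasSum_coord₁ u u') (hasSum_coord₁ v v')
  refine (hasSum_coord_mul (tensorVec u v) (tensorVec u' v')).unique (h.congr_fun fun n => ?_)
  simp only [tensorVec_apply, star_mul']
  ring

theorem norm_tensorVec (u v : Fock (Fin 1)) : ‖tensorVec u v‖ = ‖u‖ * ‖v‖ := by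
  have h := inner_tensorVec u v u v
  simp only [inner_self_eq_norm_sq_to_K] at h
  have h' : ‖tensorVec u v‖ ^ 2 = (‖u‖ * ‖v‖) ^ 2 := by rw [mul_pow]; exact_mod_cast h
  exact (sq_eq_sq₀ (norm_nonneg _) (by positivity)).1 h'

/-- The tensor product of vectors as a continuous bilinear map. -/
noncomputable def tensor : Fock (Fin 1) →L[ℂ] Fock (Fin 1) →L[ℂ] Fock (Fin 2) :=
  LinearMap.mkContinuous₂
    (LinearMap.mk₂ ℂ tensorVec
      (fun u u' v => by ext n; simp [tensorVec_apply, add_mul])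
      (fun c u v => by ext n; simp [tensorVec_apply, mul_assoc])
      (fun u v v' => by ext n; simp [tensorVec_apply, mul_add])
      (fun c u v => by ext n; simp [tensorVec_apply, mul_left_comm])) 1
    fun u v => by simp [norm_tensorVec]

theorem tensor_apply (u v : Fock (Fin 1)) : tensor u v = tensorVec u v := rfl

theorem tensor_expVec (β γ : Fin 1 → ℂ) :
    tensor (expVec β) (expVec γ) = expVec ![β 0, γ 0] := by
  ext n
  simp [tensor_apply, tensorVec_apply, expVec_apply, div_mul_div_comm]

theorem tensor_ket (l m : ℕ) : tensor (ket₁ l) (ket₁ m) = ket₂ l m := by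
  ext n
  rw [tensor_apply, tensorVec_apply, ket_apply, ket_apply, ket_apply]
  have : n = ![l, m] ↔ n 0 = l ∧ n 1 = m := by
    rw [← vecCons_apply_zero_one n]; simp
  by_cases h0 : n 0 = l <;> by_cases h1 : n 1 = m <;> simp [this, h0, h1]

/-- Checked on pairs of exponential vectors and extended by density in one tensor factor at a time.
-/
theorem displacement_tensor (a b : ℂ) (u v : Fock (Fin 1)) :
    displacement ![a, b] (tensor u v) = tensor (displacement ![a] u) (displacement ![b] v) := by
  have h1 : ∀ β γ, displacement ![a, b] (tensor (expVec β) (expVec γ)) =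
      tensor (displacement ![a] (expVec β)) (displacement ![b] (expVec γ)) := fun β γ => by
    simp only [tensor_expVec, displacement_expVec, map_smul, smul_apply, smul_smul,
      ← Complex.exp_add]
    congr 2
    · simp
      ring
    · simp
  have h2 : ∀ γ, displacement ![a, b] (tensor u (expVec γ)) =
      tensor (displacement ![a] u) (displacement ![b] (expVec γ)) := fun γ => by
    have : displacement ![a, b] ∘L tensor.flip (expVec γ) =
        tensor.flip (displacement ![b] (expVec γ)) ∘L displacement ![a] :=
      clm_ext_expVec fun β => h1 β γ
    exact DFunLike.congr_fun this u
  have : displacement ![a, b] ∘L tensor u =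
      tensor (displacement ![a] u) ∘L displacement ![b] :=
    clm_ext_expVec h2
  exact DFunLike.congr_fun this v

/-- The embedding `u ↦ u ⊗ |n⟩`. -/
noncomputable def rightEmbed (n : ℕ) : Fock (Fin 1) →L[ℂ] Fock (Fin 2) := tensor.flip (ket₁ n)

/-- The embedding `u ↦ |0⟩ ⊗ u`. -/
noncomputable def leftEmbed : Fock (Fin 1) →L[ℂ] Fock (Fin 2) := tensor (ket₁ 0)

theorem rightEmbed_apply (n : ℕ) (u : Fock (Fin 1)) : rightEmbed n u = tensor u (ket₁ n) := rfl

theorem leftEmbed_apply (u : Fock (Fin 1)) : leftEmbed u = tensor (ket₁ 0) u := rfl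

theorem rightEmbed_ket (n m : ℕ) : rightEmbed n (ket₁ m) = ket₂ m n := tensor_ket m n

theorem leftEmbed_ket (m : ℕ) : leftEmbed (ket₁ m) = ket₂ 0 m := tensor_ket 0 m

theorem inner_rightEmbed (n : ℕ) (u v : Fock (Fin 1)) :
    ⟪rightEmbed n u, rightEmbed n v⟫_ℂ = ⟪u, v⟫_ℂ := by
  simp [rightEmbed_apply, tensor_apply, inner_tensorVec, norm_ket]

theorem inner_leftEmbed (u v : Fock (Fin 1)) : ⟪leftEmbed u, leftEmbed v⟫_ℂ = ⟪u, v⟫_ℂ := by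
  simp [leftEmbed_apply, tensor_apply, inner_tensorVec, norm_ket]

theorem displacement_rightEmbed (a : ℂ) (n : ℕ) (u : Fock (Fin 1)) :
    displacement ![a, 0] (rightEmbed n u) = rightEmbed n (displacement ![a] u) := by
  have h : (![0] : Fin 1 → ℂ) = 0 := by ext i; fin_cases i; rfl
  rw [rightEmbed_apply, displacement_tensor, h, displacement_zero]
  rfl

theorem ket₁_zero : ket₁ 0 = ket 0 := by
  have h : (![0] : Fin 1 → ℕ) = 0 := by ext i; fin_cases i; rfl
  rw [ket₁, h]

theorem inner_vacuum_displacement (a : ℂ) :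
    ⟪ket₁ 0, displacement ![a] (ket₁ 0)⟫_ℂ = Real.exp (-‖a‖ ^ 2 / 2) := by
  rw [ket₁_zero, displacement_ket_zero, inner_smul_right, ← expVec_zero, inner_expVec_expVec]
  simp
  ring_nf

/-- The component acting on the vacuum ancilla contributes only its Gaussian expectation; this
factor becomes the noise matrix `Y`. -/
theorem inner_rightEmbed_displacement (a b : ℂ) (u v : Fock (Fin 1)) :
    ⟪rightEmbed 0 v, displacement ![a, b] (rightEmbed 0 u)⟫_ℂ =
      Real.exp (-‖b‖ ^ 2 / 2) * ⟪v, displacement ![a] u⟫_ℂ := by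
  rw [rightEmbed_apply, rightEmbed_apply, displacement_tensor, tensor_apply, tensor_apply,
    inner_tensorVec, inner_vacuum_displacement, mul_comm]

theorem inner_leftEmbed_displacement (a b : ℂ) (u v : Fock (Fin 1)) :
    ⟪leftEmbed v, displacement ![a, b] (leftEmbed u)⟫_ℂ =
      Real.exp (-‖a‖ ^ 2 / 2) * ⟪v, displacement ![b] u⟫_ℂ := by
  rw [leftEmbed_apply, leftEmbed_apply, displacement_tensor, tensor_apply, tensor_apply,
    inner_tensorVec, inner_vacuum_displacement]

theorem hasSum_ket₁ (x : Fock (Fin 1)) : HasSum (fun k : ℕ => x ![k] • ket₁ k) x :=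
  vecOneEquiv.hasSum_iff (f := fun n => x n • ket n) |>.2 (hasSum_ket x)

theorem adjoint_rightEmbed_apply (n l : ℕ) (x : Fock (Fin 2)) :
    (rightEmbed n).adjoint x ![l] = x ![l, n] := by
  rw [← inner_ket_left, ContinuousLinearMap.adjoint_inner_right, rightEmbed_ket, inner_ket_left]

/-- The resolution of the identity `∑ n, 1 ⊗ |n⟩⟨n|`, applied to `x`. -/
theorem hasSum_rightEmbed_adjoint (x : Fock (Fin 2)) :
    HasSum (fun n => rightEmbed n ((rightEmbed n).adjoint x)) x := by
  have h1 : HasSum (fun p : ℕ × ℕ => x ![p.1, p.2] • ket₂ p.1 p.2) x := by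
    refine (((finTwoArrowEquiv ℕ).symm.hasSum_iff).2 (hasSum_ket x)).congr_fun fun p => ?_
    simp [finTwoArrowEquiv]
  have h2 : HasSum (fun p : ℕ × ℕ => x ![p.2, p.1] • ket₂ p.2 p.1) x :=
    (Equiv.prodComm ℕ ℕ).hasSum_iff (f := fun p : ℕ × ℕ => x ![p.1, p.2] • ket₂ p.1 p.2) |>.2 h1
  refine h2.prod_fiberwise fun n => ?_
  have := (hasSum_ket₁ ((rightEmbed n).adjoint x)).mapL (rightEmbed n)
  simpa only [map_smul, rightEmbed_ket, adjoint_rightEmbed_apply] using this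

end Tensor

/-! ### Kraus operators from a unitary dilation -/

section Dilation

/-- The Kraus operators `⟨n| V e` of the map `ρ ↦ Tr₂ (V e ρ e† V†)`. -/
noncomputable def dilationKraus (V : Fock (Fin 2) ≃ₗᵢ[ℂ] Fock (Fin 2))
    (e : Fock (Fin 1) →L[ℂ] Fock (Fin 2)) (n : ℕ) : Fock (Fin 1) →L[ℂ] Fock (Fin 1) :=
  (rightEmbed n).adjoint ∘L (V : Fock (Fin 2) →L[ℂ] Fock (Fin 2)) ∘L e

variable {V : Fock (Fin 2) ≃ₗᵢ[ℂ] Fock (Fin 2)} {e : Fock (Fin 1) →L[ℂ] Fock (Fin 2)}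

theorem dilationKraus_apply (n : ℕ) (u : Fock (Fin 1)) :
    dilationKraus V e n u = (rightEmbed n).adjoint (V (e u)) := rfl

theorem dilationKraus_coord (n l : ℕ) (u : Fock (Fin 1)) :
    dilationKraus V e n u ![l] = V (e u) ![l, n] := by
  rw [dilationKraus_apply, adjoint_rightEmbed_apply]

/-- `D(a) ⊗ 1` commutes with `u ↦ u ⊗ |n⟩`, so inserting the resolution of the identity on the
traced-out mode yields the Heisenberg action `∑ n, K_n† D(a) K_n`. -/
theorem hasSum_inner_dilationKraus (a : ℂ) (u v : Fock (Fin 1)) :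
    HasSum (fun n => ⟪dilationKraus V e n v, displacement ![a] (dilationKraus V e n u)⟫_ℂ)
      ⟪V (e v), displacement ![a, 0] (V (e u))⟫_ℂ := by
  have h := ((hasSum_rightEmbed_adjoint (V (e u))).mapL (displacement ![a, 0])).mapL
    (innerSL ℂ (V (e v)))
  refine h.congr_fun fun n => ?_
  rw [innerSL_apply_apply, displacement_rightEmbed, dilationKraus_apply, dilationKraus_apply,
    ContinuousLinearMap.adjoint_inner_left]

theorem hasSum_adjoint_dilationKraus (he : ∀ u v, ⟪e u, e v⟫_ℂ = ⟪u, v⟫_ℂ) (v : Fock (Fin 1)) :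
    HasSum (fun n => ((dilationKraus V e n).adjoint ∘L dilationKraus V e n) v) v := by
  have h := (hasSum_rightEmbed_adjoint (V (e v))).mapL
    (e.adjoint ∘L (V : Fock (Fin 2) →L[ℂ] Fock (Fin 2)).adjoint)
  have hv : (e.adjoint ∘L (V : Fock (Fin 2) →L[ℂ] Fock (Fin 2)).adjoint) (V (e v)) = v := by
    refine ext_inner_left ℂ fun w => ?_
    rw [ContinuousLinearMap.comp_apply, ContinuousLinearMap.adjoint_inner_right,
      ContinuousLinearMap.adjoint_inner_right, ← he w v]
    exact V.inner_map_map _ _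
  rw [hv] at h
  refine h.congr_fun fun n => ?_
  simp only [dilationKraus, ContinuousLinearMap.adjoint_comp, ContinuousLinearMap.adjoint_adjoint]
  rfl

end Dilation

/-! ### Trace-norm convergent sums -/

section TraceNorm

variable {E : Type*} [NormedAddCommGroup E]

theorem tsum_enorm_mul_enorm_lt_top {κ : Type*} {u v : κ → E}
    (hs : Summable fun k => ‖u k‖ * ‖v k‖) : ∑' k, ‖u k‖ₑ * ‖v k‖ₑ < ⊤ := by
  have : ∀ k, ‖u k‖ₑ * ‖v k‖ₑ = ((‖u k‖₊ * ‖v k‖₊ : NNReal) : ℝ≥0∞) := fun k => by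
    simp [enorm_eq_nnnorm]
  simp only [this]
  exact (ENNReal.tsum_coe_ne_top_iff_summable.2 (NNReal.summable_coe.1 hs)).lt_top

variable [InnerProductSpace ℂ E]

theorem traceNorm_le_of_hasSum {κ : Type*} (e : ℕ ≃ κ) {T : E →L[ℂ] E} {u v : κ → E}
    (h : ∀ x, HasSum (fun k => ⟪v k, x⟫_ℂ • u k) (T x)) :
    traceNorm T ≤ ∑' k, ‖u k‖ₑ * ‖v k‖ₑ := by
  refine (iInf₂_le (u ∘ e) (v ∘ e)).trans ((iInf_le _ fun x => ?_).trans_eq ?_)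
  · exact e.hasSum_iff.2 (h x)
  · exact e.tsum_eq fun k => ‖u k‖ₑ * ‖v k‖ₑ

/-- A sum of operators `A n = ∑ k, |u (n, k)⟩⟨v (n, k)|` with a jointly summable family of
dyads converges in trace norm. -/
theorem hasTraceNormSum_of_hasSum {κ : Type*} (e : ℕ ≃ ℕ × κ) {T : E →L[ℂ] E}
    {A : ℕ → (E →L[ℂ] E)} {u v : ℕ × κ → E}
    (hT : ∀ x, HasSum (fun p => ⟪v p, x⟫_ℂ • u p) (T x))
    (hA : ∀ n x, HasSum (fun k => ⟪v (n, k), x⟫_ℂ • u (n, k)) (A n x))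
    (hs : Summable fun p => ‖u p‖ * ‖v p‖) : HasTraceNormSum A T := by
  have hfin := tsum_enorm_mul_enorm_lt_top hs
  let a : ℕ → ℝ≥0∞ := fun n => ∑' k, ‖u (n, k)‖ₑ * ‖v (n, k)‖ₑ
  have ha : ∑' n, a n ≠ ⊤ := by
    rw [← ENNReal.summable.tsum_prod' (f := fun p => ‖u p‖ₑ * ‖v p‖ₑ)
      fun _ => ENNReal.summable]
    exact hfin.ne
  refine tendsto_of_tendsto_of_tendsto_of_le_of_le tendsto_const_nhds
    (ENNReal.tendsto_tsum_compl_atTop_zero ha) (fun _ => zero_le) fun F => ?_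
  -- Deleting the dyads with first index in `F` decomposes the remainder `T - ∑ n ∈ F, A n`, whose
  -- trace norm is then at most the tail of `∑ a n`.
  let w : ℕ × κ → E := fun p => if p.1 ∈ F then 0 else u p
  have hw : ∀ x, HasSum (fun p => ⟪v p, x⟫_ℂ • w p) ((T - ∑ n ∈ F, A n) x) := by
    intro x
    have h1 : HasSum (fun p : ℕ × κ => if p.1 ∈ F then ⟪v p, x⟫_ℂ • u p else 0)
        (∑ n ∈ F, A n x) := by
      have h2 : ∀ n ∈ F, HasSum (fun p : ℕ × κ => if p.1 = n then ⟪v p, x⟫_ℂ • u p else 0)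
          (A n x) := by
        intro n _
        have hinj : Function.Injective (fun k : κ => (n, k)) := fun a b h => by simpa using h
        refine (hinj.hasSum_iff ?_).1 ((hA n x).congr_fun fun k => ?_)
        · rintro ⟨m, k⟩ hmk
          rw [if_neg]
          rintro rfl
          exact hmk ⟨k, rfl⟩
        · simp
      refine (hasSum_sum h2).congr_fun fun p => ?_
      simp [Finset.sum_ite_eq]
    have h3 := (hT x).sub h1
    rw [sub_apply, sum_apply]
    refine h3.congr_fun fun p => ?_
    by_cases hp : p.1 ∈ F <;> simp [w, hp]
  refine (traceNorm_le_of_hasSum e hw).trans_eq ?_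
  rw [ENNReal.summable.tsum_prod' fun _ => ENNReal.summable]
  have h4 : ∀ n, ∑' k, ‖w (n, k)‖ₑ * ‖v (n, k)‖ₑ = Set.indicator {n | n ∉ F} a n := by
    intro n
    by_cases hn : n ∈ F <;> simp [w, hn, a]
  simp only [h4]
  exact (tsum_subtype {n | n ∉ F} a).symm

theorem norm_apply_le_traceNorm (T : E →L[ℂ] E) (x : E) : ‖T x‖ₑ ≤ traceNorm T * ‖x‖ₑ := by
  by_cases hx : x = 0
  · simp [hx]
  have hx0 : ‖x‖ₑ ≠ 0 := by simpa using hx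
  rw [← ENNReal.div_le_iff hx0 enorm_ne_top]
  refine le_iInf₂ fun u v => le_iInf fun h => ?_
  rw [ENNReal.div_le_iff hx0 enorm_ne_top, ← ENNReal.tsum_mul_right]
  rw [← (h x).tsum_eq]
  refine enorm_tsum_le_tsum_enorm.trans (ENNReal.tsum_le_tsum fun k => ?_)
  rw [enorm_smul, mul_comm ‖u k‖ₑ, mul_right_comm]
  gcongr
  simp only [enorm_eq_nnnorm]
  exact_mod_cast nnnorm_inner_le_nnnorm (𝕜 := ℂ) (v k) x

theorem HasTraceNormSum.hasSum_apply {A : ℕ → (E →L[ℂ] E)} {T : E →L[ℂ] E}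
    (h : HasTraceNormSum A T) (x : E) : HasSum (fun n => A n x) (T x) := by
  rw [HasSum, SummationFilter.unconditional_filter, tendsto_iff_edist_tendsto_0]
  have h1 : Tendsto (fun F : Finset ℕ => traceNorm (T - ∑ n ∈ F, A n) * ‖x‖ₑ) atTop (𝓝 0) := by
    have := ENNReal.Tendsto.mul_const h (b := ‖x‖ₑ) (Or.inr enorm_ne_top)
    rwa [zero_mul] at this
  refine tendsto_of_tendsto_of_tendsto_of_le_of_le tendsto_const_nhds h1 (fun _ => zero_le)
    fun F => ?_
  refine (norm_apply_le_traceNorm _ x).trans' (le_of_eq ?_)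
  rw [edist_comm, edist_eq_enorm_sub, sub_apply,
    sum_apply]

end TraceNorm

/-! ### The channel of a Kraus family -/

section Kraus

variable {E : Type*} [NormedAddCommGroup E] [InnerProductSpace ℂ E]

theorem norm_le_tsum_of_hasSum {u v : ℕ → E} {T : E →L[ℂ] E}
    (hT : ∀ x, HasSum (fun k => ⟪v k, x⟫_ℂ • u k) (T x))
    (hs : Summable fun k => ‖u k‖ * ‖v k‖) : ‖T‖ ≤ ∑' k, ‖u k‖ * ‖v k‖ := by
  refine T.opNorm_le_bound (tsum_nonneg fun k => by positivity) fun x => ?_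
  have hle : ∀ k, ‖⟪v k, x⟫_ℂ • u k‖ ≤ ‖u k‖ * ‖v k‖ * ‖x‖ := fun k => by
    rw [norm_smul, mul_comm, mul_assoc]
    gcongr
    exact norm_inner_le_norm _ _
  rw [← (hT x).tsum_eq]
  exact tsum_of_norm_bounded (hs.hasSum.mul_right ‖x‖) hle

variable [CompleteSpace E] {K : ℕ → (E →L[ℂ] E)}

theorem hasSum_norm_sq_kraus (hK : ∀ v, HasSum (fun n => ((K n).adjoint ∘L K n) v) v) (v : E) :
    HasSum (fun n => ‖K n v‖ ^ 2) (‖v‖ ^ 2) := by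
  have h := (hK v).mapL (innerSL ℂ v)
  simp only [innerSL_apply_apply, ContinuousLinearMap.comp_apply,
    ContinuousLinearMap.adjoint_inner_right, inner_self_eq_norm_sq_to_K] at h
  exact_mod_cast h

/-- Cauchy–Schwarz in `n` with `∑ ‖K n u‖² = ‖u‖²`. Applied to each dyad of a trace-class operator,
it makes all dyads of the image jointly summable. -/
theorem summable_norm_kraus_mul (hK : ∀ v, HasSum (fun n => ((K n).adjoint ∘L K n) v) v)
    (u v : E) : (Summable fun n => ‖K n u‖ * ‖K n v‖) ∧
      ∑' n, ‖K n u‖ * ‖K n v‖ ≤ ‖u‖ * ‖v‖ := by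
  have hu := hasSum_norm_sq_kraus hK u
  have hv := hasSum_norm_sq_kraus hK v
  have h2 : (2 : ℝ).HolderConjugate 2 := Real.holderConjugate_iff.2 (by norm_num)
  have hu' : Summable fun n => ‖K n u‖ ^ (2 : ℝ) := by
    simpa only [Real.rpow_ofNat] using hu.summable
  have hv' : Summable fun n => ‖K n v‖ ^ (2 : ℝ) := by
    simpa only [Real.rpow_ofNat] using hv.summable
  refine ⟨Real.summable_mul_of_Lp_Lq_of_nonneg h2 (fun _ => norm_nonneg _)
    (fun _ => norm_nonneg _) hu' hv', (Real.inner_le_Lp_mul_Lq_tsum_of_nonneg h2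
    (fun _ => norm_nonneg _) (fun _ => norm_nonneg _) hu' hv').trans_eq ?_⟩
  simp only [Real.rpow_ofNat]
  rw [hu.tsum_eq, hv.tsum_eq, ← Real.sqrt_eq_rpow, ← Real.sqrt_eq_rpow]
  rw [Real.sqrt_sq (norm_nonneg _), Real.sqrt_sq (norm_nonneg _)]

variable {u v : ℕ → E} {T : E →L[ℂ] E}

theorem summable_kraus_dyads (hK : ∀ v, HasSum (fun n => ((K n).adjoint ∘L K n) v) v)
    (hs : Summable fun k => ‖u k‖ * ‖v k‖) :
    Summable fun p : ℕ × ℕ => ‖K p.1 (u p.2)‖ * ‖K p.1 (v p.2)‖ := by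
  have h : Summable fun p : ℕ × ℕ => ‖K p.2 (u p.1)‖ * ‖K p.2 (v p.1)‖ := by
    refine (summable_prod_of_nonneg fun p => by positivity).2 ⟨fun k => ?_, ?_⟩
    · exact (summable_norm_kraus_mul hK (u k) (v k)).1
    · exact Summable.of_nonneg_of_le (fun k => tsum_nonneg fun n => by positivity)
        (fun k => (summable_norm_kraus_mul hK (u k) (v k)).2) hs
  exact h.prod_symm

theorem hasSum_conj (A : E →L[ℂ] E) (hT : ∀ x, HasSum (fun k => ⟪v k, x⟫_ℂ • u k) (T x)) (x : E) :
    HasSum (fun k => ⟪A (v k), x⟫_ℂ • A (u k)) ((A ∘L T ∘L A.adjoint) x) := by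
  have := (hT (A.adjoint x)).mapL A
  simp only [map_smul, ContinuousLinearMap.adjoint_inner_right] at this
  exact this

/-- The map `T ↦ ∑ n, K n T (K n)†`. -/
noncomputable def krausMap (K : ℕ → (E →L[ℂ] E)) (T : E →L[ℂ] E) : E →L[ℂ] E :=
  ∑' n, K n ∘L T ∘L (K n).adjoint

/-- Operator-norm convergence gives meaning to the `tsum` in `krausMap`; trace-norm convergence is
obtained separately in `hasTraceNormSum_krausMap`. -/
theorem hasSum_krausMap (hK : ∀ v, HasSum (fun n => ((K n).adjoint ∘L K n) v) v)
    (hT : traceNorm T < ⊤) : HasSum (fun n => K n ∘L T ∘L (K n).adjoint) (krausMap K T) := by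
  obtain ⟨u, v, h, hs⟩ := exists_traceClass_decomposition hT
  have hd := summable_kraus_dyads hK hs
  refine Summable.hasSum (Summable.of_norm_bounded
    ((summable_prod_of_nonneg fun p => by positivity).1 hd).2 fun n => ?_)
  exact norm_le_tsum_of_hasSum (hasSum_conj (K n) h) (hd.prod_factor n)

theorem hasSum_krausMap_apply (hK : ∀ v, HasSum (fun n => ((K n).adjoint ∘L K n) v) v)
    (hT : ∀ x, HasSum (fun k => ⟪v k, x⟫_ℂ • u k) (T x)) (hs : Summable fun k => ‖u k‖ * ‖v k‖)
    (x : E) : HasSum (fun p : ℕ × ℕ => ⟪K p.1 (v p.2), x⟫_ℂ • K p.1 (u p.2)) (krausMap K T x) := by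
  have hd := summable_kraus_dyads hK hs
  have hsum : Summable fun p : ℕ × ℕ => ⟪K p.1 (v p.2), x⟫_ℂ • K p.1 (u p.2) := by
    refine Summable.of_norm_bounded (hd.mul_right ‖x‖) fun p => ?_
    rw [norm_smul, mul_comm, mul_assoc]
    gcongr
    exact norm_inner_le_norm _ _
  have h1 := hsum.hasSum.prod_fiberwise fun n => hasSum_conj (K n) hT x
  have hT' : traceNorm T < ⊤ := (traceNorm_le_of_hasSum (Equiv.refl ℕ) hT).trans_lt
    (tsum_enorm_mul_enorm_lt_top hs)
  have h2 : HasSum (fun n => (K n ∘L T ∘L (K n).adjoint) x) (krausMap K T x) :=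
    (hasSum_krausMap hK hT').mapL (ContinuousLinearMap.apply ℂ E x)
  rw [h2.unique h1]
  exact hsum.hasSum

theorem traceNorm_krausMap_lt_top (hK : ∀ v, HasSum (fun n => ((K n).adjoint ∘L K n) v) v)
    (hT : traceNorm T < ⊤) : traceNorm (krausMap K T) < ⊤ := by
  obtain ⟨u, v, h, hs⟩ := exists_traceClass_decomposition hT
  exact (traceNorm_le_of_hasSum Nat.pairEquiv.symm (hasSum_krausMap_apply hK h hs)).trans_lt
    (tsum_enorm_mul_enorm_lt_top (summable_kraus_dyads hK hs))

theorem hasTraceNormSum_krausMap (hK : ∀ v, HasSum (fun n => ((K n).adjoint ∘L K n) v) v)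
    (hT : traceNorm T < ⊤) :
    HasTraceNormSum (fun n => K n ∘L T ∘L (K n).adjoint) (krausMap K T) := by
  obtain ⟨u, v, h, hs⟩ := exists_traceClass_decomposition hT
  exact hasTraceNormSum_of_hasSum Nat.pairEquiv.symm (hasSum_krausMap_apply hK h hs)
    (fun n => hasSum_conj (K n) h) (summable_kraus_dyads hK hs)

/-- The linear map on trace-class operators with Kraus operators `K n`. -/
noncomputable def krausChannel (hK : ∀ v, HasSum (fun n => ((K n).adjoint ∘L K n) v) v) :
    TraceClass E →ₗ[ℂ] TraceClass E where
  toFun ρ := ⟨krausMap K ρ.1, traceNorm_krausMap_lt_top hK ρ.2⟩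
  map_add' ρ σ := by
    refine Subtype.ext ?_
    have h := (hasSum_krausMap hK ρ.2).add (hasSum_krausMap hK σ.2)
    refine (hasSum_krausMap hK (ρ + σ).2).unique (h.congr_fun fun n => ?_)
    ext x
    simp
  map_smul' c ρ := by
    refine Subtype.ext ?_
    have h := (hasSum_krausMap hK ρ.2).const_smul c
    refine (hasSum_krausMap hK (c • ρ).2).unique (h.congr_fun fun n => ?_)
    ext x
    simp

/-- Moving `K n†` onto the test vectors turns the `n`-th term into the hypothesis at `K n† x i`; a
convergent sum of nonnegative terms is nonnegative. -/
theorem krausChannel_completelyPositive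
    (hK : ∀ v, HasSum (fun n => ((K n).adjoint ∘L K n) v) v) (k : ℕ)
    (ρ : Fin k → Fin k → TraceClass E)
    (hρ : ∀ x : Fin k → E, 0 ≤ ∑ i, ∑ j, ⟪x i, (ρ i j).1 (x j)⟫_ℂ) (x : Fin k → E) :
    0 ≤ ∑ i, ∑ j, ⟪x i, (krausChannel hK (ρ i j)).1 (x j)⟫_ℂ := by
  have h : HasSum (fun n => ∑ i, ∑ j, ⟪(K n).adjoint (x i), (ρ i j).1 ((K n).adjoint (x j))⟫_ℂ)
      (∑ i, ∑ j, ⟪x i, (krausChannel hK (ρ i j)).1 (x j)⟫_ℂ) := by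
    refine hasSum_sum fun i _ => hasSum_sum fun j _ => ?_
    have h1 : HasSum (fun n => (K n ∘L (ρ i j).1 ∘L (K n).adjoint) (x j))
        ((krausChannel hK (ρ i j)).1 (x j)) :=
      (hasSum_krausMap hK (ρ i j).2).mapL (ContinuousLinearMap.apply ℂ E (x j))
    have h2 := h1.mapL (innerSL ℂ (x i))
    simpa only [innerSL_apply_apply, ContinuousLinearMap.comp_apply,
      ← ContinuousLinearMap.adjoint_inner_left] using h2
  exact h.nonneg fun n => hρ _

end Kraus

/-! ### Characteristic functions of Kraus channels and uniqueness of Gaussian channels -/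

section KrausFock

variable {K : ℕ → (Fock (Fin 1) →L[ℂ] Fock (Fin 1))}

theorem isKrausFamily_krausChannel (hK : ∀ v, HasSum (fun n => ((K n).adjoint ∘L K n) v) v) :
    IsKrausFamily (krausChannel hK) K :=
  ⟨fun ρ => hasTraceNormSum_krausMap hK ρ.2, hK⟩

theorem hasSum_unique_of_prod {g : ℕ × ℕ → ℂ} {s t : ℂ} {a : ℕ → ℂ} (hg : HasSum g s)
    (ha : ∀ k, HasSum (fun n => g (n, k)) (a k)) (ht : HasSum a t) : s = t := by
  have h : HasSum (fun p : ℕ × ℕ => g (p.2, p.1)) s :=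
    (Equiv.prodComm ℕ ℕ).hasSum_iff (f := g) |>.2 hg
  exact (h.prod_fiberwise ha).unique ht

/-- The action on characteristic functions can be read off from the Heisenberg picture. -/
theorem charFn_krausChannel (hK : ∀ v, HasSum (fun n => ((K n).adjoint ∘L K n) v) v)
    {ξ η : Fin 1 × Fin 2 → ℝ} {c : ℂ}
    (hc : ∀ u v, HasSum (fun n => ⟪K n v, displacement (weylParam ξ) (K n u)⟫_ℂ)
      (c * ⟪v, displacement (weylParam η) u⟫_ℂ)) (ρ : TraceClass (Fock (Fin 1))) :
    charFn ξ (krausChannel hK ρ).1 = charFn η ρ.1 * c := by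
  obtain ⟨u, v, h, hs⟩ := exists_traceClass_decomposition ρ.2
  have hd := summable_kraus_dyads hK hs
  obtain ⟨e⟩ : Nonempty (ℕ ≃ ℕ × ℕ) := ⟨Nat.pairEquiv.symm⟩
  have h1 : HasSum (fun k => ⟪K (e k).1 (v (e k).2), displacement (weylParam ξ)
      (K (e k).1 (u (e k).2))⟫_ℂ) (charFn ξ (krausChannel hK ρ).1) :=
    hasSum_charFn (fun x => e.hasSum_iff.2 (hasSum_krausMap_apply hK h hs x))
      (e.summable_iff.2 hd) ξ
  rw [mul_comm]
  exact hasSum_unique_of_prod (g := fun p : ℕ × ℕ => ⟪K p.1 (v p.2), displacement (weylParam ξ)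
    (K p.1 (u p.2))⟫_ℂ) (e.hasSum_iff.1 h1) (fun k => hc (u k) (v k))
    ((hasSum_charFn h hs η).mul_left c)

theorem weyl_zero {ι : Type*} [Fintype ι] [DecidableEq ι] : weyl (0 : ι × Fin 2 → ℝ) = 1 := by
  rw [weyl_eq_displacement, ← displacement_zero]
  congr 1
  ext i
  simp [weylParam]

theorem charFn_zero (ρ : Fock (Fin 1) →L[ℂ] Fock (Fin 1)) : charFn 0 ρ = trace ρ := by
  rw [charFn, weyl_zero]
  rfl

theorem isGaussianChannel_krausChannel (hK : ∀ v, HasSum (fun n => ((K n).adjoint ∘L K n) v) v)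
    {X Y : Matrix (Fin 1 × Fin 2) (Fin 1 × Fin 2) ℝ}
    (hc : ∀ ξ u v, HasSum (fun n => ⟪K n v, displacement (weylParam ξ) (K n u)⟫_ℂ)
      ((Real.exp (-(ξ ⬝ᵥ (Y *ᵥ ξ)) / 2) : ℂ) * ⟪v, displacement (weylParam (X *ᵥ ξ)) u⟫_ℂ)) :
    IsGaussianChannel X Y (krausChannel hK) := by
  have h := fun ξ ρ => charFn_krausChannel hK (hc ξ) ρ
  refine ⟨⟨krausChannel_completelyPositive hK, fun ρ => ?_⟩, h⟩
  -- Trace preservation is the characteristic-function identity at `ξ = 0`, where the Weyl operator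
  -- is `1`.
  have h0 := h 0 ρ
  simpa [charFn_zero] using h0

theorem IsGaussianChannel.unique {ι : Type*} [Fintype ι] [DecidableEq ι]
    {X Y : Matrix (ι × Fin 2) (ι × Fin 2) ℝ}
    {Φ Φ' : TraceClass (Fock ι) →ₗ[ℂ] TraceClass (Fock ι)} (h : IsGaussianChannel X Y Φ)
    (h' : IsGaussianChannel X Y Φ') : Φ' = Φ :=
  LinearMap.ext fun ρ => traceClass_ext_charFn fun ξ => by
    rw [h.charFn_apply, h'.charFn_apply]

end KrausFock

/-! ### Two-mode squeezers and beam splitters -/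

section TwoMode

/-- The action of a two-mode squeezer on phase space. -/
noncomputable def squeezeMap (μ : ℝ) : (Fin 2 → ℂ) ≃+ (Fin 2 → ℂ) where
  toFun α := ![Real.cosh μ * α 0 + Real.sinh μ * star (α 1),
    Real.cosh μ * α 1 + Real.sinh μ * star (α 0)]
  invFun α := ![Real.cosh μ * α 0 - Real.sinh μ * star (α 1),
    Real.cosh μ * α 1 - Real.sinh μ * star (α 0)]
  left_inv α := by
    have h : (Real.cosh μ : ℂ) ^ 2 - (Real.sinh μ : ℂ) ^ 2 = 1 := by
      exact_mod_cast Real.cosh_sq_sub_sinh_sq μ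
    ext i
    fin_cases i
    · simp [-Complex.ofReal_cosh, -Complex.ofReal_sinh]
      linear_combination α 0 * h
    · simp [-Complex.ofReal_cosh, -Complex.ofReal_sinh]
      linear_combination α 1 * h
  right_inv α := by
    have h : (Real.cosh μ : ℂ) ^ 2 - (Real.sinh μ : ℂ) ^ 2 = 1 := by
      exact_mod_cast Real.cosh_sq_sub_sinh_sq μ
    ext i
    fin_cases i
    · simp [-Complex.ofReal_cosh, -Complex.ofReal_sinh]
      linear_combination α 0 * h
    · simp [-Complex.ofReal_cosh, -Complex.ofReal_sinh]
      linear_combination α 1 * h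
  map_add' α β := by
    ext i
    fin_cases i
    · simp
      ring
    · simp
      ring

theorem squeezeMap_apply (μ : ℝ) (α : Fin 2 → ℂ) : squeezeMap μ α =
    ![Real.cosh μ * α 0 + Real.sinh μ * star (α 1),
      Real.cosh μ * α 1 + Real.sinh μ * star (α 0)] := rfl

theorem squeezeMap_symm_apply (μ : ℝ) (α : Fin 2 → ℂ) : (squeezeMap μ).symm α =
    ![Real.cosh μ * α 0 - Real.sinh μ * star (α 1),
      Real.cosh μ * α 1 - Real.sinh μ * star (α 0)] := rfl

theorem isSymplecticMap_squeezeMap (μ : ℝ) : IsSymplecticMap (squeezeMap μ) := by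
  intro α β
  have h : (Real.cosh μ : ℂ) ^ 2 - (Real.sinh μ : ℂ) ^ 2 = 1 := by
    exact_mod_cast Real.cosh_sq_sub_sinh_sq μ
  simp only [squeezeMap_apply, Fin.sum_univ_two, Matrix.cons_val_zero, Matrix.cons_val_one,
    map_add, map_mul, Complex.star_def, Complex.conj_conj, Complex.conj_ofReal]
  linear_combination (α 0 * starRingEnd ℂ (β 0) - starRingEnd ℂ (α 0) * β 0 +
    α 1 * starRingEnd ℂ (β 1) - starRingEnd ℂ (α 1) * β 1) / 2 * h

/-- The action of a beam splitter on phase space. -/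
noncomputable def beamMap (θ : ℝ) : (Fin 2 → ℂ) ≃+ (Fin 2 → ℂ) where
  toFun α := ![Real.cos θ * α 0 + Real.sin θ * α 1, -Real.sin θ * α 0 + Real.cos θ * α 1]
  invFun α := ![Real.cos θ * α 0 - Real.sin θ * α 1, Real.sin θ * α 0 + Real.cos θ * α 1]
  left_inv α := by
    have h : (Real.cos θ : ℂ) ^ 2 + (Real.sin θ : ℂ) ^ 2 = 1 := by
      exact_mod_cast Real.cos_sq_add_sin_sq θ
    ext i
    fin_cases i
    · simp [-Complex.ofReal_cos, -Complex.ofReal_sin]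
      linear_combination α 0 * h
    · simp [-Complex.ofReal_cos, -Complex.ofReal_sin]
      linear_combination α 1 * h
  right_inv α := by
    have h : (Real.cos θ : ℂ) ^ 2 + (Real.sin θ : ℂ) ^ 2 = 1 := by
      exact_mod_cast Real.cos_sq_add_sin_sq θ
    ext i
    fin_cases i
    · simp [-Complex.ofReal_cos, -Complex.ofReal_sin]
      linear_combination α 0 * h
    · simp [-Complex.ofReal_cos, -Complex.ofReal_sin]
      linear_combination α 1 * h
  map_add' α β := by
    ext i
    fin_cases i
    · simp
      ring
    · simp
      ring

theorem beamMap_apply (θ : ℝ) (α : Fin 2 → ℂ) : beamMap θ α =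
    ![Real.cos θ * α 0 + Real.sin θ * α 1, -Real.sin θ * α 0 + Real.cos θ * α 1] := rfl

theorem beamMap_symm_apply (θ : ℝ) (α : Fin 2 → ℂ) : (beamMap θ).symm α =
    ![Real.cos θ * α 0 - Real.sin θ * α 1, Real.sin θ * α 0 + Real.cos θ * α 1] := rfl

theorem isSymplecticMap_beamMap (θ : ℝ) : IsSymplecticMap (beamMap θ) := by
  intro α β
  have h : (Real.cos θ : ℂ) ^ 2 + (Real.sin θ : ℂ) ^ 2 = 1 := by
    exact_mod_cast Real.cos_sq_add_sin_sq θ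
  simp only [beamMap_apply, Fin.sum_univ_two, Matrix.cons_val_zero, Matrix.cons_val_one,
    map_add, map_mul, map_neg, Complex.star_def, Complex.conj_ofReal]
  linear_combination (α 0 * starRingEnd ℂ (β 0) - starRingEnd ℂ (α 0) * β 0 +
    α 1 * starRingEnd ℂ (β 1) - starRingEnd ℂ (α 1) * β 1) / 2 * h

theorem gaussWeight_two (α : Fin 2 → ℂ) :
    gaussWeight α = Complex.exp (-(α 0 * star (α 0) + α 1 * star (α 1)) / 2) := by
  simp only [gaussWeight, Fin.sum_univ_two, ofReal_norm_sq_div_two]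
  ring_nf

theorem gaussWeight_beamMap (θ : ℝ) (α : Fin 2 → ℂ) :
    gaussWeight (beamMap θ α) = gaussWeight α := by
  have h : (Real.cos θ : ℂ) ^ 2 + (Real.sin θ : ℂ) ^ 2 = 1 := by
    exact_mod_cast Real.cos_sq_add_sin_sq θ
  rw [gaussWeight_two, gaussWeight_two]
  congr 1
  simp only [beamMap_apply, Matrix.cons_val_zero, Matrix.cons_val_one,
    map_add, map_mul, map_neg, Complex.star_def, Complex.conj_ofReal]
  linear_combination -(α 0 * starRingEnd ℂ (α 0) + α 1 * starRingEnd ℂ (α 1)) / 2 * h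

theorem inner_vacuum_displacement_beamMap (θ : ℝ) (α : Fin 2 → ℂ) :
    ⟪ket 0, displacement (beamMap θ α) (ket 0)⟫_ℂ = gaussWeight α := by
  rw [displacement_ket_zero, ← gaussWeight, gaussWeight_beamMap, inner_smul_right, ← expVec_zero,
    inner_expVec_expVec]
  simp

/-! ### The two-mode squeezed vacuum -/

theorem ofReal_cosh_ne_zero (μ : ℝ) : (Real.cosh μ : ℂ) ≠ 0 := by
  exact_mod_cast (Real.cosh_pos μ).ne'

theorem ofReal_tanh_mul_cosh (μ : ℝ) : (Real.tanh μ : ℂ) * Real.cosh μ = Real.sinh μ := by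
  rw [← Complex.ofReal_mul, Real.tanh_eq_sinh_div_cosh, div_mul_cancel₀ _ (Real.cosh_pos μ).ne']

theorem inner_expVec_squeezedVacuum (μ : ℝ) (β : Fin 2 → ℂ) :
    ⟪expVec β, squeezedVacuum μ⟫_ℂ =
      (Real.cosh μ : ℂ)⁻¹ * Complex.exp (Real.tanh μ * (star (β 0) * star (β 1))) := by
  have h1 := (summable_squeezedVacuum μ).hasSum.mapL (innerSL ℂ (expVec β))
  have h2 : HasSum (fun j : ℕ => (innerSL ℂ (expVec β))
      (((Real.tanh μ) ^ j : ℂ) • ket₂ j j))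
      (Complex.exp (Real.tanh μ * (star (β 0) * star (β 1)))) := by
    have h3 := NormedSpace.expSeries_div_hasSum_exp (𝔸 := ℂ)
      (Real.tanh μ * (star (β 0) * star (β 1)))
    rw [← Complex.exp_eq_exp_ℂ] at h3
    refine h3.congr_fun fun j => ?_
    rw [innerSL_apply_apply, inner_smul_right, ← inner_conj_symm, inner_ket_left, expVec_apply,
      Fin.prod_univ_two]
    simp only [Matrix.cons_val_zero, Matrix.cons_val_one, map_mul, map_div₀, map_pow,
      Complex.conj_ofReal, Complex.star_def]
    rw [div_mul_div_comm, sqrt_factorial_mul_self]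
    ring
  rw [squeezedVacuum, inner_smul_right, ← h1.unique h2]
  simp [innerSL_apply_apply]

theorem norm_expVec_sq {ι : Type*} [Fintype ι] [DecidableEq ι] (β : ι → ℂ) :
    ‖expVec β‖ ^ 2 = Real.exp (∑ i, ‖β i‖ ^ 2) := by
  have h2 : ∑ i, star (β i) * β i = ((∑ i, ‖β i‖ ^ 2 : ℝ) : ℂ) := by
    push_cast
    refine Finset.sum_congr rfl fun i _ => ?_
    rw [Complex.star_def, ← Complex.normSq_eq_conj_mul_self, Complex.normSq_eq_norm_sq]
    push_cast
    rfl
  rw [← inner_self_eq_norm_sq (𝕜 := ℂ), inner_expVec_expVec, h2, ← Complex.ofReal_exp]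
  exact Complex.ofReal_re _

/-- The integrand in the expansion of the two-mode squeezed vacuum into coherent states. -/
noncomputable def squeezedIntegrand (μ : ℝ) (z : ℂ) : Fock (Fin 2) :=
  Complex.exp (-(z * star z)) • expVec ![√(Real.tanh μ) * z, √(Real.tanh μ) * star z]

theorem integrable_squeezedIntegrand {μ : ℝ} (hμ : 0 ≤ μ) :
    MeasureTheory.Integrable (squeezedIntegrand μ) := by
  have ht : 0 ≤ Real.tanh μ := by
    rw [Real.tanh_eq_sinh_div_cosh]
    exact div_nonneg (Real.sinh_nonneg_iff.2 hμ) (Real.cosh_pos μ).le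
  have h1 : Continuous fun z : ℂ => ![(√(Real.tanh μ) : ℂ) * z, √(Real.tanh μ) * star z] := by
    refine continuous_pi fun i => ?_
    fin_cases i
    · exact continuous_const.mul continuous_id
    · exact continuous_const.mul continuous_star
  have h2 : Continuous fun z : ℂ => Complex.exp (-(z * star z)) := by fun_prop
  have hc : Continuous (squeezedIntegrand μ) := h2.smul (continuous_expVec.comp h1)
  -- The norm of the integrand is exactly `exp (-(1 - tanh μ) |z|²)`.
  refine (integrable_exp_neg_mul_norm_sq (sub_pos.2 (Real.tanh_lt_one μ))).mono'
    hc.aestronglyMeasurable (Eventually.of_forall fun z => le_of_eq ?_)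
  have h1 : ‖(expVec ![(√(Real.tanh μ) : ℂ) * z, √(Real.tanh μ) * star z] : Fock (Fin 2))‖ =
      Real.exp (Real.tanh μ * ‖z‖ ^ 2) := by
    rw [← sq_eq_sq₀ (norm_nonneg _) (Real.exp_pos _).le, norm_expVec_sq, ← Real.exp_nat_mul]
    congr 1
    simp only [Fin.sum_univ_two, Matrix.cons_val_zero, Matrix.cons_val_one, norm_mul, norm_star,
      mul_pow, Complex.norm_real, Real.norm_eq_abs, sq_abs, Real.sq_sqrt ht]
    push_cast
    ring
  rw [squeezedIntegrand, norm_smul, h1, Complex.norm_exp, ← Real.exp_add]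
  congr 1
  rw [Complex.star_def, Complex.mul_conj, Complex.normSq_eq_norm_sq, Complex.neg_re,
    Complex.ofReal_re]
  ring

theorem sqrt_tanh_mul_self {μ : ℝ} (hμ : 0 ≤ μ) :
    (√(Real.tanh μ) : ℂ) * √(Real.tanh μ) = Real.tanh μ := by
  have ht : 0 ≤ Real.tanh μ := by
    rw [Real.tanh_eq_sinh_div_cosh]
    exact div_nonneg (Real.sinh_nonneg_iff.2 hμ) (Real.cosh_pos μ).le
  rw [← Complex.ofReal_mul, Real.mul_self_sqrt ht]

/-- The Gaussian linearisation `exp (t a b) = π⁻¹ ∫ exp (-|z|² + √t a z + √t b star z)`. It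
expresses the squeezed vacuum through exponential vectors, on which displacements act explicitly. -/
theorem squeezedVacuum_eq_integral {μ : ℝ} (hμ : 0 ≤ μ) : squeezedVacuum μ =
    ((Real.cosh μ : ℂ)⁻¹ / Real.pi) • ∫ z, squeezedIntegrand μ z := by
  refine fock_ext fun β => ?_
  rw [inner_expVec_squeezedVacuum, inner_smul_right,
    ← integral_inner (integrable_squeezedIntegrand hμ)]
  have h1 : ∀ z, ⟪expVec β, squeezedIntegrand μ z⟫_ℂ = Complex.exp (-(((1 : ℝ) : ℂ) *
      (z * star z)) + (√(Real.tanh μ) * star (β 0)) * z + (√(Real.tanh μ) * star (β 1)) * star z) :=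
    fun z => by
      rw [squeezedIntegrand, inner_smul_right, inner_expVec_expVec, ← Complex.exp_add]
      congr 1
      simp [Fin.sum_univ_two]
      ring
  simp only [h1]
  rw [integral_complex_gaussian one_pos, mul_mul_mul_comm, sqrt_tanh_mul_self hμ]
  have : (Real.pi : ℂ) ≠ 0 := by exact_mod_cast Real.pi_ne_zero
  rw [Complex.ofReal_one, div_one, div_one]
  field_simp

theorem inner_squeezedVacuum_expVec (μ : ℝ) (β : Fin 2 → ℂ) :
    ⟪squeezedVacuum μ, expVec β⟫_ℂ =
      (Real.cosh μ : ℂ)⁻¹ * Complex.exp (Real.tanh μ * (β 0 * β 1)) := by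
  rw [← inner_conj_symm, inner_expVec_squeezedVacuum, map_mul, map_inv₀, Complex.conj_ofReal,
    ← Complex.exp_conj]
  simp only [map_mul, Complex.conj_ofReal, Complex.star_def, Complex.conj_conj]

theorem one_sub_ofReal_tanh_sq (μ : ℝ) :
    ((1 - Real.tanh μ ^ 2 : ℝ) : ℂ) = (Real.cosh μ : ℂ)⁻¹ ^ 2 := by
  have h : 1 - Real.tanh μ ^ 2 = (Real.cosh μ)⁻¹ ^ 2 := by
    have := Real.cosh_sq_sub_sinh_sq μ
    have hc := (Real.cosh_pos μ).ne'
    rw [Real.tanh_eq_sinh_div_cosh]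
    field_simp
    linarith
  rw [h, Complex.ofReal_pow, Complex.ofReal_inv]

/-- The hypothesis of `exists_unitary_of_symplectic` for the squeezer. Only the right-hand copy is
expanded as an integral, which leaves a Gaussian in `z` of rate `1 - tanh² μ = (cosh μ)⁻²`. -/
theorem inner_squeezedVacuum_displacement {μ : ℝ} (hμ : 0 ≤ μ) (α : Fin 2 → ℂ) :
    ⟪squeezedVacuum μ, displacement (squeezeMap μ α) (squeezedVacuum μ)⟫_ℂ = gaussWeight α := by
  have hcs : (Real.cosh μ : ℂ) ^ 2 - (Real.sinh μ : ℂ) ^ 2 = 1 := by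
    exact_mod_cast Real.cosh_sq_sub_sinh_sq μ
  have hc0 := ofReal_cosh_ne_zero μ
  have htc := ofReal_tanh_mul_cosh μ
  have ht2 := one_sub_ofReal_tanh_sq μ
  have hpos : 0 < 1 - Real.tanh μ ^ 2 := sub_pos.2 (Real.tanh_sq_lt_one μ)
  have hci : (Real.cosh μ : ℂ)⁻¹ = Real.cosh μ - Real.tanh μ * Real.sinh μ := by
    refine (eq_inv_of_mul_eq_one_left ?_).symm
    linear_combination hcs - Real.sinh μ * htc
  -- The coefficients linear in `z` and `star z` collapse by `cosh μ - tanh μ sinh μ = (cosh μ)⁻¹`.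
  have h1 : ∀ z, ⟪squeezedVacuum μ, displacement (squeezeMap μ α) (squeezedIntegrand μ z)⟫_ℂ =
      ((Real.cosh μ : ℂ)⁻¹ * Complex.exp (Real.tanh μ * (squeezeMap μ α 0 * squeezeMap μ α 1)) *
        gaussWeight (squeezeMap μ α)) *
      Complex.exp (-(((1 - Real.tanh μ ^ 2 : ℝ) : ℂ) * (z * star z)) +
        (√(Real.tanh μ) * (-(Real.cosh μ : ℂ)⁻¹ * star (α 0))) * z +
        (√(Real.tanh μ) * (-(Real.cosh μ : ℂ)⁻¹ * star (α 1))) * star z) := fun z => by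
    have hr : ∀ p q r s : ℂ, p * (q * (r * s)) = r * (p * q * s) := fun p q r s => by ring
    rw [squeezedIntegrand, map_smul, displacement_expVec, inner_smul_right, inner_smul_right,
      inner_squeezedVacuum_expVec, gaussWeight, hr, mul_assoc, mul_assoc, mul_assoc, ← Complex.exp_add, ← Complex.exp_add, ← Complex.exp_add,
      ← Complex.exp_add]
    congr 2
    have hs := sqrt_tanh_mul_self hμ
    simp only [squeezeMap_apply, Fin.sum_univ_two, Matrix.cons_val_zero, Matrix.cons_val_one,
      Pi.add_apply, map_add, map_mul, Complex.star_def, Complex.conj_conj, Complex.conj_ofReal,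
      hci]
    push_cast [-Complex.ofReal_cosh, -Complex.ofReal_sinh, -Complex.ofReal_tanh]
    linear_combination (Real.tanh μ * z * starRingEnd ℂ z) * hs + (√(Real.tanh μ) * z * α 1 +
      √(Real.tanh μ) * starRingEnd ℂ z * α 0) * htc
  have h2 : ⟪squeezedVacuum μ, displacement (squeezeMap μ α) (squeezedVacuum μ)⟫_ℂ =
      (Real.cosh μ : ℂ)⁻¹ / Real.pi *
        ∫ z, ⟪squeezedVacuum μ, displacement (squeezeMap μ α) (squeezedIntegrand μ z)⟫_ℂ := by
    -- Both copies get expanded; once the scalar of the second is pulled out, the backward rewrite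
    -- folds up only the first.
    conv_lhs => rw [squeezedVacuum_eq_integral hμ]
    rw [map_smul, inner_smul_right, ← squeezedVacuum_eq_integral hμ,
      ← ContinuousLinearMap.integral_comp_comm _ (integrable_squeezedIntegrand hμ), integral_inner]
    exact (displacement (squeezeMap μ α)).integrable_comp (integrable_squeezedIntegrand hμ)
  have hpi : (Real.pi : ℂ) ≠ 0 := by exact_mod_cast Real.pi_ne_zero
  rw [h2]
  simp only [h1]
  rw [MeasureTheory.integral_const_mul, integral_complex_gaussian hpos, ht2]
  have h3 : (√(Real.tanh μ) * (-(Real.cosh μ : ℂ)⁻¹ * star (α 0))) *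
      (√(Real.tanh μ) * (-(Real.cosh μ : ℂ)⁻¹ * star (α 1))) / (Real.cosh μ : ℂ)⁻¹ ^ 2 =
      Real.tanh μ * (star (α 0) * star (α 1)) := by
    rw [← sqrt_tanh_mul_self hμ]
    field_simp
  have h4 : ∀ a b c : ℂ, (Real.cosh μ : ℂ)⁻¹ / Real.pi * ((Real.cosh μ : ℂ)⁻¹ * a * b *
      (Real.pi / (Real.cosh μ : ℂ)⁻¹ ^ 2 * c)) = a * b * c := fun a b c => by
    field_simp
  rw [h3, h4, gaussWeight_two, gaussWeight_two, ← Complex.exp_add, ← Complex.exp_add]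
  congr 1
  simp only [squeezeMap_apply, Matrix.cons_val_zero, Matrix.cons_val_one,
      map_add, map_mul, Complex.star_def, Complex.conj_conj, Complex.conj_ofReal]
  linear_combination (α 0 * α 1 * Real.cosh μ + (α 0 * starRingEnd ℂ (α 0) +
    α 1 * starRingEnd ℂ (α 1)) * Real.sinh μ + starRingEnd ℂ (α 0) * starRingEnd ℂ (α 1) *
    Real.cosh μ) * htc - ((α 0 * starRingEnd ℂ (α 0) + α 1 * starRingEnd ℂ (α 1)) / 2 +
    Real.tanh μ * starRingEnd ℂ (α 0) * starRingEnd ℂ (α 1)) * hcs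

end TwoMode

/-! ### Fock matrix elements of squeezers and beam splitters -/

section MatrixElements

theorem exists_squeezer {μ : ℝ} (hμ : 0 ≤ μ) : ∃ V : Fock (Fin 2) ≃ₗᵢ[ℂ] Fock (Fin 2),
    (∀ α x, V (displacement α x) = displacement (squeezeMap μ α) (V x)) ∧
      V (ket 0) = squeezedVacuum μ :=
  exists_unitary_of_symplectic (isSymplecticMap_squeezeMap μ)
    (inner_squeezedVacuum_displacement hμ)

theorem exists_beamSplitter (θ : ℝ) : ∃ V : Fock (Fin 2) ≃ₗᵢ[ℂ] Fock (Fin 2),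
    (∀ α x, V (displacement α x) = displacement (beamMap θ α) (V x)) ∧ V (ket 0) = ket 0 :=
  exists_unitary_of_symplectic (isSymplecticMap_beamMap θ) (inner_vacuum_displacement_beamMap θ)

theorem gaussWeight_ne_zero {ι : Type*} [Fintype ι] (α : ι → ℂ) : gaussWeight α ≠ 0 :=
  Complex.exp_ne_zero _

variable {V : Fock (Fin 2) ≃ₗᵢ[ℂ] Fock (Fin 2)}

/-- A beam splitter preserves the Gaussian weight, so the normalisations cancel and exponential
vectors go to exponential vectors. -/
theorem beamSplitter_expVec {θ : ℝ}
    (hV : ∀ α x, V (displacement α x) = displacement (beamMap θ α) (V x)) (h0 : V (ket 0) = ket 0)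
    (β : Fin 2 → ℂ) : V (expVec β) = expVec (beamMap θ β) := by
  have h := apply_expVec_of_intertwines hV h0 β
  rw [displacement_ket_zero, ← gaussWeight, gaussWeight_beamMap] at h
  exact smul_right_injective _ (gaussWeight_ne_zero β) h

/-- The generating function of all number-state matrix elements of the squeezer, found by moving the
displacement in `gaussWeight β • V ε(β) = D(A β) Ψ` onto the left exponential vector. -/
theorem inner_expVec_squeezer {μ : ℝ}
    (hV : ∀ α x, V (displacement α x) = displacement (squeezeMap μ α) (V x))
    (h0 : V (ket 0) = squeezedVacuum μ) (z β : Fin 2 → ℂ) :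
    ⟪expVec (star z), V (expVec β)⟫_ℂ = (Real.cosh μ : ℂ)⁻¹ *
      Complex.exp (Real.tanh μ * (z 0 * z 1) + (Real.cosh μ : ℂ)⁻¹ * (β 0 * z 0 + β 1 * z 1) -
        Real.tanh μ * (β 0 * β 1)) := by
  have hcs : (Real.cosh μ : ℂ) ^ 2 - (Real.sinh μ : ℂ) ^ 2 = 1 := by
    exact_mod_cast Real.cosh_sq_sub_sinh_sq μ
  have htc := ofReal_tanh_mul_cosh μ
  have hci : (Real.cosh μ : ℂ)⁻¹ = Real.cosh μ - Real.tanh μ * Real.sinh μ := by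
    refine (eq_inv_of_mul_eq_one_left ?_).symm
    linear_combination hcs - Real.sinh μ * htc
  have h := congrArg (fun x => ⟪expVec (star z), x⟫_ℂ) (apply_expVec_of_intertwines hV h0 β)
  have h1 := inner_displacement_left (-squeezeMap μ β) (expVec (star z)) (squeezedVacuum μ)
  rw [neg_neg] at h1
  simp only [inner_smul_right] at h
  refine mul_left_cancel₀ (gaussWeight_ne_zero β) ?_
  rw [h, ← h1, displacement_expVec, inner_smul_left, inner_expVec_squeezedVacuum,
    ← Complex.exp_conj, gaussWeight_two, mul_left_comm, mul_left_comm _ (_⁻¹ : ℂ),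
    ← Complex.exp_add, ← Complex.exp_add]
  congr 2
  simp only [ofReal_norm_sq_div_two, Fin.sum_univ_two, squeezeMap_apply, Matrix.cons_val_zero,
    Matrix.cons_val_one, Pi.neg_apply, Pi.add_apply, Pi.star_apply, map_add, map_sub, map_neg,
    map_mul, map_div₀, map_ofNat, Complex.star_def, Complex.conj_conj, Complex.conj_ofReal]
  rw [hci]
  linear_combination (starRingEnd ℂ (β 0) * starRingEnd ℂ (β 1) * Real.cosh μ +
    (β 0 * starRingEnd ℂ (β 0) + β 1 * starRingEnd ℂ (β 1)) * Real.sinh μ + β 0 * β 1 *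
    Real.cosh μ - z 0 * starRingEnd ℂ (β 1) - z 1 * starRingEnd ℂ (β 0)) * htc -
    ((β 0 * starRingEnd ℂ (β 0) + β 1 * starRingEnd ℂ (β 1)) / 2 +
    Real.tanh μ * β 0 * β 1) * hcs

theorem hasSum_expVec₁ (β : ℂ) :
    HasSum (fun m : ℕ => (β ^ m / (√(m.factorial : ℝ) : ℂ)) • ket₁ m) (expVec ![β]) := by
  refine (hasSum_ket₁ (expVec ![β])).congr_fun fun m => ?_
  rw [expVec_apply]
  simp

/-- As `ε(β) = ∑ βᵐ / √m! |m⟩`, values on number states are Taylor coefficients in `β` times `√m!`.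
-/
theorem apply_ket₁_of_hasSum (L : Fock (Fin 1) →L[ℂ] ℂ) {a : ℕ → ℂ}
    (h : ∀ β : ℂ, HasSum (fun m => a m * β ^ m) (L (expVec ![β]))) (m : ℕ) :
    L (ket₁ m) = a m * √(m.factorial : ℝ) := by
  have h1 : ∀ β : ℂ, HasSum (fun m : ℕ => L (ket₁ m) / (√(m.factorial : ℝ) : ℂ) * β ^ m)
      (L (expVec ![β])) := fun β => by
    refine ((hasSum_expVec₁ β).mapL L).congr_fun fun m => ?_
    rw [map_smul, smul_eq_mul]
    ring
  rw [← congrFun (powerSeries_coeff_unique h1 h) m, div_mul_cancel₀ _ (sqrt_factorial_ne_zero m)]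

theorem hasSum_exp (x : ℂ) : HasSum (fun m : ℕ => x ^ m / (m.factorial : ℂ)) (Complex.exp x) := by
  have := NormedSpace.expSeries_div_hasSum_exp (𝔸 := ℂ) x
  rwa [← Complex.exp_eq_exp_ℂ] at this

theorem apply_ket₁_of_exp (L : Fock (Fin 1) →L[ℂ] ℂ) {a b : ℂ}
    (h : ∀ β : ℂ, L (expVec ![β]) = a * Complex.exp (b * β)) (m : ℕ) :
    L (ket₁ m) = a * b ^ m / √(m.factorial : ℝ) := by
  have h1 := apply_ket₁_of_hasSum L (a := fun m => a * b ^ m / (m.factorial : ℂ)) (fun β => by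
    rw [h]
    refine ((hasSum_exp (b * β)).mul_left a).congr_fun fun m => ?_
    rw [mul_pow]
    ring) m
  rw [h1, ← sqrt_factorial_mul_self]
  have := sqrt_factorial_ne_zero m
  field_simp

/-- Fock coefficients of a vector with generating function `c (z i) ^ m exp (t z₀ z₁)`. -/
theorem coord_of_inner_expVec (i : Fin 2) (m : ℕ) {c t : ℂ} {x : Fock (Fin 2)}
    (hx : ∀ z, ⟪expVec (star z), x⟫_ℂ = c * z i ^ m * Complex.exp (t * (z 0 * z 1)))
    (n : Fin 2 → ℕ) : x n / (∏ a, (√((n a).factorial : ℝ) : ℂ)) =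
      Function.extend (fun (k : ℕ) (a : Fin 2) => k + Pi.single (M := fun _ => ℕ) i m a)
        (fun k => c * (t ^ k / (k.factorial : ℂ))) 0 n := by
  have hinj : Function.Injective
      (fun (k : ℕ) (a : Fin 2) => k + Pi.single (M := fun _ => ℕ) i m a) := fun k k' h => by
    simpa using congrFun h 0
  refine congrFun (multiPowerSeries_coeff_unique (fun z => hasSum_inner_expVec z x)
    fun z => ?_) n
  rw [hx]
  -- Only the multi-indices `(k, k) + m eᵢ` carry a coefficient, so the sum reduces to the
  -- exponential series in `k`.
  refine (hinj.hasSum_iff ?_).1 ?_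
  · intro n hn
    rw [Function.extend_apply' _ _ _ (by simpa using hn)]
    simp
  · refine ((hasSum_exp (t * (z 0 * z 1))).mul_left (c * z i ^ m)).congr_fun fun k => ?_
    have hp : ∏ a, z a ^ (k + Pi.single (M := fun _ => ℕ) i m a) = (z 0 * z 1) ^ k * z i ^ m := by
      simp only [pow_add, Finset.prod_mul_distrib, Finset.prod_pow, Fin.prod_univ_two (f := z)]
      congr 1
      rw [Finset.prod_eq_single i]
      · simp
      · intro b _ hb
        simp [Pi.single_eq_of_ne hb]
      · simp
    rw [Function.comp_apply, hinj.extend_apply, hp, mul_pow]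
    ring

theorem sqrt_choose_eq (m k : ℕ) : (√((m + k).choose k : ℝ) : ℂ) =
    √((m + k).factorial : ℝ) / (√(m.factorial : ℝ) * √(k.factorial : ℝ)) := by
  rw [Nat.add_choose, Nat.cast_div (Nat.factorial_mul_factorial_dvd_factorial_add m k)
    (by positivity), Real.sqrt_div (by positivity), Nat.cast_mul, Real.sqrt_mul (by positivity)]
  push_cast
  rfl

/-- `exp (t z₀ z₁)` creates photons in pairs, so the first mode keeps its excess of `m` over the
second; the factorials `√(l! n!) / (√m! n!)` combine to the root of a binomial coefficient. -/
theorem coord_squeezed_zero {m : ℕ} {c s t : ℂ} {x : Fock (Fin 2)}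
    (hx : ∀ z, ⟪expVec (star z), x⟫_ℂ =
      (c * Complex.exp (t * (z 0 * z 1))) * (s * z 0) ^ m / √(m.factorial : ℝ)) (l n : ℕ) :
    x ![l, n] = if l = m + n then c * s ^ m * t ^ n * √((m + n).choose n : ℝ) else 0 := by
  have h := coord_of_inner_expVec 0 m (c := c * s ^ m / √(m.factorial : ℝ)) (t := t)
    (fun z => (hx z).trans (by rw [mul_pow]; ring)) ![l, n]
  have hp : (∏ a, (√((![l, n] a).factorial : ℝ) : ℂ)) ≠ 0 :=
    Finset.prod_ne_zero_iff.2 fun i _ => sqrt_factorial_ne_zero _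
  rw [div_eq_iff hp] at h
  rw [h]
  split_ifs with hl
  · have hn : ![l, n] = fun a => n + Pi.single (M := fun _ => ℕ) (0 : Fin 2) m a := by
      ext a; fin_cases a <;> simp [hl, add_comm]
    have hinj : Function.Injective
        (fun (k : ℕ) (a : Fin 2) => k + Pi.single (M := fun _ => ℕ) (0 : Fin 2) m a) :=
      fun k k' h => by simpa using congrFun h 0
    have he := hinj.extend_apply (fun k => c * s ^ m / √(m.factorial : ℝ) *
      (t ^ k / (k.factorial : ℂ))) 0 n
    rw [← hn] at he
    rw [he, Fin.prod_univ_two, sqrt_choose_eq, ← sqrt_factorial_mul_self n]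
    have h1 := sqrt_factorial_ne_zero m
    have h2 := sqrt_factorial_ne_zero n
    simp only [Matrix.cons_val_zero, Matrix.cons_val_one, hl]
    field_simp
  · rw [Function.extend_apply']
    · simp
    · rintro ⟨k, hk⟩
      have h1 := congrFun hk 0
      have h2 := congrFun hk 1
      simp at h1 h2
      omega

theorem coord_squeezed_one {m : ℕ} {c s t : ℂ} {x : Fock (Fin 2)}
    (hx : ∀ z, ⟪expVec (star z), x⟫_ℂ =
      (c * Complex.exp (t * (z 0 * z 1))) * (s * z 1) ^ m / √(m.factorial : ℝ)) (l n : ℕ) :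
    x ![l, n] = if n = m + l then c * s ^ m * t ^ l * √((m + l).choose l : ℝ) else 0 := by
  have h := coord_of_inner_expVec 1 m (c := c * s ^ m / √(m.factorial : ℝ)) (t := t)
    (fun z => (hx z).trans (by rw [mul_pow]; ring)) ![l, n]
  have hp : (∏ a, (√((![l, n] a).factorial : ℝ) : ℂ)) ≠ 0 :=
    Finset.prod_ne_zero_iff.2 fun i _ => sqrt_factorial_ne_zero _
  rw [div_eq_iff hp] at h
  rw [h]
  split_ifs with hl
  · have hn : ![l, n] = fun a => l + Pi.single (M := fun _ => ℕ) (1 : Fin 2) m a := by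
      ext a; fin_cases a <;> simp [hl, add_comm]
    have hinj : Function.Injective
        (fun (k : ℕ) (a : Fin 2) => k + Pi.single (M := fun _ => ℕ) (1 : Fin 2) m a) :=
      fun k k' h => by simpa using congrFun h 0
    have he := hinj.extend_apply (fun k => c * s ^ m / √(m.factorial : ℝ) *
      (t ^ k / (k.factorial : ℂ))) 0 l
    rw [← hn] at he
    rw [he, Fin.prod_univ_two, sqrt_choose_eq, ← sqrt_factorial_mul_self l]
    have h1 := sqrt_factorial_ne_zero m
    have h2 := sqrt_factorial_ne_zero l
    simp only [Matrix.cons_val_zero, Matrix.cons_val_one, hl]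
    field_simp
  · rw [Function.extend_apply']
    · simp
    · rintro ⟨k, hk⟩
      have h1 := congrFun hk 0
      have h2 := congrFun hk 1
      simp at h1 h2
      omega

theorem rightEmbed_zero_expVec (β : ℂ) : rightEmbed 0 (expVec ![β]) = expVec ![β, 0] := by
  rw [rightEmbed_apply, ket₁_zero, ← expVec_zero, tensor_expVec]
  simp

theorem leftEmbed_expVec (β : ℂ) : leftEmbed (expVec ![β]) = expVec ![0, β] := by
  rw [leftEmbed_apply, ket₁_zero, ← expVec_zero, tensor_expVec]
  simp

theorem squeezer_ket_zero_right {μ : ℝ}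
    (hV : ∀ α x, V (displacement α x) = displacement (squeezeMap μ α) (V x))
    (h0 : V (ket 0) = squeezedVacuum μ) (m l n : ℕ) :
    V (ket₂ m 0) ![l, n] = if l = m + n then
      (Real.cosh μ : ℂ)⁻¹ * (Real.cosh μ : ℂ)⁻¹ ^ m * Real.tanh μ ^ n * √((m + n).choose n : ℝ)
      else 0 := by
  rw [← rightEmbed_ket]
  refine coord_squeezed_zero (fun z => ?_) l n
  exact apply_ket₁_of_exp ((innerSL ℂ (expVec (star z))) ∘L
    (V : Fock (Fin 2) →L[ℂ] Fock (Fin 2)) ∘L rightEmbed 0) (fun β => by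
      refine (congrArg (fun x => ⟪expVec (star z), V x⟫_ℂ) (rightEmbed_zero_expVec β)).trans ?_
      rw [inner_expVec_squeezer hV h0, mul_assoc, ← Complex.exp_add]
      congr 2
      simp
      ring) m

theorem squeezer_ket_zero_left {μ : ℝ}
    (hV : ∀ α x, V (displacement α x) = displacement (squeezeMap μ α) (V x))
    (h0 : V (ket 0) = squeezedVacuum μ) (m l n : ℕ) :
    V (ket₂ 0 m) ![l, n] = if n = m + l then
      (Real.cosh μ : ℂ)⁻¹ * (Real.cosh μ : ℂ)⁻¹ ^ m * Real.tanh μ ^ l * √((m + l).choose l : ℝ)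
      else 0 := by
  rw [← leftEmbed_ket]
  refine coord_squeezed_one (fun z => ?_) l n
  exact apply_ket₁_of_exp ((innerSL ℂ (expVec (star z))) ∘L
    (V : Fock (Fin 2) →L[ℂ] Fock (Fin 2)) ∘L leftEmbed) (fun β => by
      refine (congrArg (fun x => ⟪expVec (star z), V x⟫_ℂ) (leftEmbed_expVec β)).trans ?_
      rw [inner_expVec_squeezer hV h0, mul_assoc, ← Complex.exp_add]
      congr 2
      simp
      ring) m

/-- The generating function is `(cos θ z₀ - sin θ z₁)ᵐ / √m!`, and the coordinates are read off its
binomial expansion. -/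
theorem beamSplitter_ket_zero_right {θ : ℝ}
    (hV : ∀ α x, V (displacement α x) = displacement (beamMap θ α) (V x)) (h0 : V (ket 0) = ket 0)
    (m l n : ℕ) : V (ket₂ m 0) ![l, n] = if l + n = m then
      (Real.cos θ : ℂ) ^ l * (-Real.sin θ) ^ n * √(m.choose n : ℝ) else 0 := by
  have h1 : ∀ z : Fin 2 → ℂ, ⟪expVec (star z), V (ket₂ m 0)⟫_ℂ =
      (Real.cos θ * z 0 + -Real.sin θ * z 1) ^ m / √(m.factorial : ℝ) := fun z => by
    have := apply_ket₁_of_exp ((innerSL ℂ (expVec (star z))) ∘L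
      (V : Fock (Fin 2) →L[ℂ] Fock (Fin 2)) ∘L rightEmbed 0) (a := 1)
      (b := Real.cos θ * z 0 + -Real.sin θ * z 1) (fun β => by
        refine (congrArg (fun x => ⟪expVec (star z), V x⟫_ℂ) (rightEmbed_zero_expVec β)).trans ?_
        rw [beamSplitter_expVec hV h0, inner_expVec_expVec, one_mul]
        congr 1
        simp [beamMap_apply]
        ring) m
    rw [one_mul] at this
    rw [← this, ← rightEmbed_ket]
    rfl
  let y : ℕ × ℕ → ℂ := fun p => if p.1 + p.2 = m then
    m.choose p.2 * Real.cos θ ^ p.1 * (-Real.sin θ) ^ p.2 / √(m.factorial : ℝ) else 0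
  have h2 : ∀ z : Fin 2 → ℂ, HasSum (fun p : ℕ × ℕ => y p * (z 0 ^ p.1 * z 1 ^ p.2))
      ((Real.cos θ * z 0 + -Real.sin θ * z 1) ^ m / √(m.factorial : ℝ)) := fun z => by
    rw [(Commute.all _ _).add_pow', Finset.sum_div]
    have : ∑ p ∈ Finset.HasAntidiagonal.antidiagonal m, (m.choose p.1 •
        ((Real.cos θ * z 0) ^ p.1 * (-Real.sin θ * z 1) ^ p.2)) / (√(m.factorial : ℝ) : ℂ) =
        ∑ p ∈ Finset.HasAntidiagonal.antidiagonal m, y p * (z 0 ^ p.1 * z 1 ^ p.2) := by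
      refine Finset.sum_congr rfl fun p hp => ?_
      rw [Finset.HasAntidiagonal.mem_antidiagonal] at hp
      have hch : m.choose p.1 = m.choose p.2 := by
        rw [← hp, Nat.choose_symm_add]
      simp only [y, hp, if_true, hch, nsmul_eq_mul]
      ring
    rw [this]
    refine hasSum_sum_of_ne_finset_zero fun p hp => ?_
    rw [Finset.HasAntidiagonal.mem_antidiagonal] at hp
    simp [y, hp]
  have h3 := congrFun (multiPowerSeries_coeff_unique
    (fun z => hasSum_inner_expVec z (V (ket₂ m 0))) (b := fun n => y (n 0, n 1)) fun z => by
      rw [h1]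
      have := (finTwoArrowEquiv ℕ).hasSum_iff (f := fun p : ℕ × ℕ =>
        y p * (z 0 ^ p.1 * z 1 ^ p.2)) |>.2 (h2 z)
      refine this.congr_fun fun n => ?_
      simp [Fin.prod_univ_two]) ![l, n]
  have hp : (∏ a, (√((![l, n] a).factorial : ℝ) : ℂ)) ≠ 0 :=
    Finset.prod_ne_zero_iff.2 fun i _ => sqrt_factorial_ne_zero _
  rw [div_eq_iff hp] at h3
  rw [h3, Fin.prod_univ_two]
  simp only [y, Matrix.cons_val_zero, Matrix.cons_val_one]
  split_ifs with hm
  · subst hm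
    have hs : ((l + n).choose n : ℂ) =
        (√((l + n).choose n : ℝ) : ℂ) * (√((l + n).choose n : ℝ) : ℂ) := by
      rw [← Complex.ofReal_mul, Real.mul_self_sqrt (by positivity)]
      simp
    rw [hs, sqrt_choose_eq]
    have e1 := sqrt_factorial_ne_zero l
    have e2 := sqrt_factorial_ne_zero n
    have e3 := sqrt_factorial_ne_zero (l + n)
    field_simp
  · simp

end MatrixElements

/-! ### Damping operators and number-state dyads -/

section Damping

theorem norm_sq_eq_tsum {ι : Type*} (x : Fock ι) : ‖x‖ ^ 2 = ∑' n, ‖x n‖ ^ 2 := by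
  have := lp.norm_rpow_eq_tsum (p := 2) (by norm_num) x
  simpa only [ENNReal.toReal_ofNat, Real.rpow_ofNat] using this

theorem summable_norm_sq {ι : Type*} (x : Fock ι) : Summable fun n => ‖x n‖ ^ 2 := by
  have := (lp.memℓp x).summable (by norm_num)
  simpa only [ENNReal.toReal_ofNat, Real.rpow_ofNat] using this

theorem norm_tanh_pow_le (r : ℝ) (k : ℕ) : ‖(Real.tanh r : ℂ) ^ k‖ ≤ 1 := by
  rw [norm_pow, Complex.norm_real, Real.norm_eq_abs]
  exact pow_le_one₀ (abs_nonneg _) (Real.abs_tanh_lt_one r).le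

theorem norm_tanh_pow_mul_sq_le (r : ℝ) (k : ℕ) (c : ℂ) :
    ‖(Real.tanh r : ℂ) ^ k * c‖ ^ 2 ≤ ‖c‖ ^ 2 := by
  rw [norm_mul]
  gcongr
  exact mul_le_of_le_one_left (norm_nonneg _) (norm_tanh_pow_le r k)

/-- The operator `(tanh r) ^ (a† a)`. -/
noncomputable def damping (r : ℝ) : Fock (Fin 1) →L[ℂ] Fock (Fin 1) :=
  LinearMap.mkContinuous
    { toFun := fun x => ⟨fun n => (Real.tanh r : ℂ) ^ n 0 * x n, by
        refine memℓp_gen ?_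
        simp only [ENNReal.toReal_ofNat, Real.rpow_ofNat]
        exact Summable.of_nonneg_of_le (fun _ => sq_nonneg _)
          (fun n => norm_tanh_pow_mul_sq_le r _ _) (summable_norm_sq x)⟩
      map_add' := fun x y => by ext n; exact mul_add _ _ _
      map_smul' := fun c x => by ext n; simp [mul_left_comm] } 1
    fun x => by
      rw [one_mul, ← sq_le_sq₀ (norm_nonneg _) (norm_nonneg _), norm_sq_eq_tsum, norm_sq_eq_tsum]
      exact Summable.tsum_le_tsum (fun n => norm_tanh_pow_mul_sq_le r _ _) (summable_norm_sq _)
        (summable_norm_sq x)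

theorem damping_apply (r : ℝ) (x : Fock (Fin 1)) (n : Fin 1 → ℕ) :
    damping r x n = (Real.tanh r : ℂ) ^ n 0 * x n := rfl

theorem damping_ket (r : ℝ) (j : ℕ) : damping r (ket₁ j) = (Real.tanh r : ℂ) ^ j • ket₁ j := by
  ext n
  rw [damping_apply, lp.coeFn_smul, Pi.smul_apply, smul_eq_mul, ket_apply]
  split_ifs with h
  · simp [h]
  · simp

theorem adjoint_damping (r : ℝ) : (damping r).adjoint = damping r := by
  rw [eq_comm, ContinuousLinearMap.eq_adjoint_iff]
  intro x y
  refine (hasSum_coord_mul _ _).unique ((hasSum_coord_mul _ _).congr_fun fun n => ?_)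
  simp only [damping_apply, star_mul', star_pow, Complex.star_def, Complex.conj_ofReal]
  ring

theorem tendsto_tanh_atTop : Tendsto Real.tanh atTop (𝓝 1) := by
  have h : ∀ r, Real.tanh r = 1 - 2 / (Real.exp (2 * r) + 1) := fun r => by
    have h1 := Real.exp_pos r
    rw [Real.tanh_eq, Real.exp_neg, two_mul r, Real.exp_add]
    field_simp
    ring
  have h2 : Tendsto (fun r : ℝ => 2 / (Real.exp (2 * r) + 1)) atTop (𝓝 0) := by
    refine Tendsto.div_atTop tendsto_const_nhds (tendsto_atTop_add_const_right _ _ ?_)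
    exact Real.tendsto_exp_atTop.comp (tendsto_id.const_mul_atTop two_pos)
  have h3 := (tendsto_const_nhds (x := (1 : ℝ))).sub h2
  rw [sub_zero] at h3
  exact h3.congr fun r => (h r).symm

theorem tendsto_tanh_pow (k : ℕ) : Tendsto (fun r => (Real.tanh r : ℂ) ^ k) atTop (𝓝 1) := by
  have := ((Complex.continuous_ofReal.tendsto 1).comp tendsto_tanh_atTop).pow k
  simpa using this

theorem tendsto_damping (x : Fock (Fin 1)) : Tendsto (fun r => damping r x) atTop (𝓝 x) := by
  rw [tendsto_iff_norm_sub_tendsto_zero]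
  have h1 : Tendsto (fun r => ‖damping r x - x‖ ^ 2) atTop (𝓝 0) := by
    have h2 : ∀ r, ‖damping r x - x‖ ^ 2 = ∑' n, ‖((Real.tanh r : ℂ) ^ n 0 - 1) * x n‖ ^ 2 :=
      fun r => by
        rw [norm_sq_eq_tsum]
        refine tsum_congr fun n => ?_
        rw [lp.coeFn_sub, Pi.sub_apply, damping_apply, sub_mul, one_mul]
    simp only [h2]
    rw [← tsum_zero (α := ℝ) (β := Fin 1 → ℕ)]
    -- The constant is `2²`, from `|tⁿ - 1| ≤ 2`.
    refine tendsto_tsum_of_dominated_convergence (bound := fun n => 4 * ‖x n‖ ^ 2)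
      ((summable_norm_sq x).mul_left 4) (fun n => ?_) (Eventually.of_forall fun r n => ?_)
    · have h3 := (((tendsto_tanh_pow (n 0)).sub_const 1).mul_const (x n)).norm.pow 2
      simpa using h3
    · rw [Real.norm_eq_abs, abs_of_nonneg (sq_nonneg _), norm_mul, mul_pow]
      gcongr
      have h4 : ‖(Real.tanh r : ℂ) ^ n 0 - 1‖ ≤ 2 := by
        refine (norm_sub_le _ _).trans ?_
        have := norm_tanh_pow_le r (n 0)
        rw [norm_one]
        linarith
      calc ‖(Real.tanh r : ℂ) ^ n 0 - 1‖ ^ 2 ≤ 2 ^ 2 := by gcongr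
        _ = 4 := by norm_num
  have h5 := (Real.continuous_sqrt.tendsto 0).comp h1
  rw [Real.sqrt_zero] at h5
  exact h5.congr fun r => Real.sqrt_sq (norm_nonneg _)

/-- With `T_n = K_n tᴺ`, where `tᴺ` is the self-adjoint damping operator, `∑ T_n† T_n = tᴺ (∑ K_n†
K_n) tᴺ = t²ᴺ`. -/
theorem finiteSqueezingCompleteness_comp_damping {K : ℕ → (Fock (Fin 1) →L[ℂ] Fock (Fin 1))}
    (hK : ∀ v, HasSum (fun n => ((K n).adjoint ∘L K n) v) v) :
    FiniteSqueezingCompleteness fun r n => K n ∘L damping r := by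
  refine ⟨fun r => damping r ∘L damping r, fun r j => ?_, fun r _ v => ?_, fun v => ?_⟩
  · rw [ContinuousLinearMap.comp_apply, damping_ket, map_smul, damping_ket, smul_smul, ← mul_pow,
      sq]
  · have h := (hK (damping r v)).mapL (damping r)
    simp only [ContinuousLinearMap.adjoint_comp, adjoint_damping]
    exact h
  · have h1 : Tendsto (fun r => damping r (damping r v - v)) atTop (𝓝 0) := by
      refine squeeze_zero_norm (a := fun r => ‖damping r v - v‖) (fun r => ?_)
        (tendsto_iff_norm_sub_tendsto_zero.1 (tendsto_damping v))
      refine ((damping r).le_of_opNorm_le (LinearMap.mkContinuous_norm_le _ zero_le_one _)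
        _).trans_eq (one_mul _)
    have h2 := h1.add (tendsto_damping v)
    rw [zero_add] at h2
    refine h2.congr fun r => ?_
    rw [map_sub, sub_add_cancel]
    rfl

theorem clm_ext_ket₁ {F : Type*} [NormedAddCommGroup F] [NormedSpace ℂ F]
    {A B : Fock (Fin 1) →L[ℂ] F} (h : ∀ m, A (ket₁ m) = B (ket₁ m)) : A = B := by
  ext x
  have hA := (hasSum_ket₁ x).mapL A
  have hB := (hasSum_ket₁ x).mapL B
  refine hA.unique (hB.congr_fun fun m => ?_)
  rw [map_smul, map_smul, h]

theorem hasDyadSum_of_apply_ket {K : Fock (Fin 1) →L[ℂ] Fock (Fin 1)} {c : ℕ → ℝ} {a b : ℕ → ℕ}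
    (hb : Function.Injective b) (hK : ∀ m, K (ket₁ (b m)) = (c m : ℂ) • ket₁ (a m))
    (h0 : ∀ j ∉ Set.range b, K (ket₁ j) = 0) : HasDyadSum c a b K := by
  intro v
  have h := (hasSum_ket₁ v).mapL K
  refine ((hb.hasSum_iff fun j hj => ?_).2 h).congr_fun fun m => ?_
  · rw [map_smul, h0 j hj, smul_zero]
  · rw [Function.comp_apply, map_smul, hK, InnerProductSpace.rankOne_apply, inner_ket_left,
      smul_comm]

/-- A norm-convergent sum of dyads is approximated in norm by its damped versions. -/
theorem tendsto_comp_damping {K : Fock (Fin 1) →L[ℂ] Fock (Fin 1)} {c : ℕ → ℝ} {a b : ℕ → ℕ}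
    (hK : HasDyadSum c a b K) (hc : Summable fun m => |c m|) :
    Tendsto (fun r => K ∘L damping r) atTop (𝓝 K) := by
  rw [tendsto_iff_norm_sub_tendsto_zero]
  have hle : ∀ r, ‖K ∘L damping r - K‖ ≤ ∑' m, ‖((Real.tanh r : ℂ) ^ b m - 1) * c m‖ := fun r => by
    have hnorm : ∀ m, ‖(((Real.tanh r : ℂ) ^ b m - 1) * c m) • ket₁ (a m)‖ * ‖ket₁ (b m)‖ =
        ‖((Real.tanh r : ℂ) ^ b m - 1) * c m‖ := fun m => by
      rw [norm_smul, norm_ket, norm_ket, mul_one, mul_one]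
    refine (norm_le_tsum_of_hasSum
      (u := fun m => (((Real.tanh r : ℂ) ^ b m - 1) * c m) • ket₁ (a m))
      (v := fun m => ket₁ (b m)) (fun x => ?_) ?_).trans_eq (tsum_congr hnorm)
    · refine ((hK (damping r x)).sub (hK x)).congr_fun fun m => ?_
      simp only [InnerProductSpace.rankOne_apply, inner_ket_left, damping_apply, smul_smul,
        ← sub_smul, Matrix.cons_val_zero]
      congr 1
      ring
    · simp only [hnorm]
      refine Summable.of_nonneg_of_le (fun _ => norm_nonneg _) (fun m => ?_) (hc.mul_left 2)
      rw [norm_mul, Complex.norm_real, Real.norm_eq_abs]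
      gcongr
      refine (norm_sub_le _ _).trans ?_
      have := norm_tanh_pow_le r (b m)
      rw [norm_one]
      linarith
  refine squeeze_zero (fun _ => norm_nonneg _) hle ?_
  rw [← tsum_zero (α := ℝ) (β := ℕ)]
  refine tendsto_tsum_of_dominated_convergence (bound := fun m => 2 * |c m|) (hc.mul_left 2)
    (fun m => ?_) (Eventually.of_forall fun r m => ?_)
  · have h3 := (((tendsto_tanh_pow (b m)).sub_const 1).mul_const (c m : ℂ)).norm
    simpa using h3
  · rw [norm_norm, norm_mul, Complex.norm_real, Real.norm_eq_abs]
    gcongr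
    refine (norm_sub_le _ _).trans ?_
    have := norm_tanh_pow_le r (b m)
    rw [norm_one]
    linarith

end Damping

/-! ### The Choi construction -/

section Choi

/-- The squeezed vacuum is the squeezer applied to `|0, 0⟩`, so this is the case `m = 0` of its
matrix elements. -/
theorem squeezedVacuum_coord {r : ℝ} (hr : 0 ≤ r) (l n : ℕ) :
    squeezedVacuum r ![l, n] = if l = n then (Real.cosh r : ℂ)⁻¹ * Real.tanh r ^ n else 0 := by
  obtain ⟨V, hV, h0⟩ := exists_squeezer hr
  have h := squeezer_ket_zero_right hV h0 0 l n
  have hk : ket₂ 0 0 = ket 0 := by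
    rw [ket₂]
    congr 1
    ext i; fin_cases i <;> rfl
  rw [hk, h0] at h
  simpa using h

theorem inner_squeezedGamma {r : ℝ} (hr : 0 ≤ r) (l i m j : ℕ) :
    ⟪ket₂ l i, squeezedGamma r (ket₂ m j)⟫_ℂ =
      if l = i ∧ m = j then (Real.tanh r : ℂ) ^ i * Real.tanh r ^ j else 0 := by
  rw [squeezedGamma, smul_apply, inner_smul_right, InnerProductSpace.rankOne_apply,
    inner_smul_right, ← inner_conj_symm, inner_ket_left, inner_ket_left, squeezedVacuum_coord hr,
    squeezedVacuum_coord hr]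
  have hc := ofReal_cosh_ne_zero r
  by_cases h1 : l = i <;> by_cases h2 : m = j <;>
    simp [h1, h2, -Complex.ofReal_cosh, -Complex.ofReal_tanh]
  field_simp

theorem traceNorm_ketBra_lt_top {E : Type*} [NormedAddCommGroup E] [InnerProductSpace ℂ E]
    (u v : E) : traceNorm (ketBra u v) < ⊤ := by
  refine (traceNorm_lt_top_iff _).2 ⟨Pi.single 0 u, Pi.single 0 v, fun x => ?_, ?_⟩
  · have h := hasSum_single (f := fun k : ℕ => ⟪(Pi.single 0 v : ℕ → E) k, x⟫_ℂ •
      (Pi.single 0 u : ℕ → E) k) 0 fun k hk => by simp [Pi.single_eq_of_ne hk]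
    simpa using h
  · rw [tsum_eq_single 0 fun k hk => by simp [Pi.single_eq_of_ne hk]]
    exact ENNReal.mul_lt_top enorm_lt_top enorm_lt_top

theorem exists_hasTraceNormSum_ketBra {E : Type*} [NormedAddCommGroup E] [InnerProductSpace ℂ E]
    [CompleteSpace E] {ψ : ℕ → E} (hψ : Summable fun n => ‖ψ n‖ * ‖ψ n‖) :
    ∃ R : TraceClass E, HasTraceNormSum (fun n => ketBra (ψ n) (ψ n)) R.1 := by
  have hs : Summable fun n => ketBra (ψ n) (ψ n) := by
    refine Summable.of_norm_bounded hψ fun n => ?_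
    exact (InnerProductSpace.norm_rankOne (ψ n) (ψ n)).le
  have hx : ∀ x, HasSum (fun n => ⟪ψ n, x⟫_ℂ • ψ n) ((∑' n, ketBra (ψ n) (ψ n)) x) := fun x =>
    (hs.hasSum.mapL (ContinuousLinearMap.apply ℂ E x)).congr_fun fun n => by
      simp
  refine ⟨⟨∑' n, ketBra (ψ n) (ψ n), (traceNorm_le_of_hasSum (Equiv.refl ℕ) hx).trans_lt
    (tsum_enorm_mul_enorm_lt_top hψ)⟩, ?_⟩
  -- Each summand is a single dyad, hence the one-point inner index.
  let e : ℕ ≃ ℕ × Unit := (Equiv.prodPUnit ℕ).symm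
  refine hasTraceNormSum_of_hasSum e (u := fun p => ψ p.1) (v := fun p => ψ p.1)
    (fun x => e.hasSum_iff.1 (hx x)) (fun n x => ?_) (e.summable_iff.1 hψ)
  simp

variable {K : ℕ → (Fock (Fin 1) →L[ℂ] Fock (Fin 1))}

/-- The `(i, j)` block of `Γ_r` is `tⁱ⁺ʲ |i⟩⟨j|`, with image `∑ n, tⁱ⁺ʲ K_n |i⟩⟨j| K_n†`; by `hflip`
this is the same block of `∑ n, |ψ_n⟩⟨ψ_n|`. -/
theorem isOneSidedImage_of_flip (hK : ∀ v, HasSum (fun n => ((K n).adjoint ∘L K n) v) v)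
    {r : ℝ} (hr : 0 ≤ r) {ψ : ℕ → Fock (Fin 2)} {R : Fock (Fin 2) →L[ℂ] Fock (Fin 2)}
    (hR : HasTraceNormSum (fun n => ketBra (ψ n) (ψ n)) R)
    (hflip : ∀ n l i, ψ n ![l, i] = (Real.tanh r : ℂ) ^ i * K n (ket₁ i) ![l]) :
    IsOneSidedImage (krausChannel hK) (squeezedGamma r) R := by
  intro i j
  refine ⟨((Real.tanh r : ℂ) ^ i * Real.tanh r ^ j) • ⟨ketBra (ket₁ i) (ket₁ j),
    traceNorm_ketBra_lt_top _ _⟩, fun l m => ?_, fun l m => ?_⟩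
  · rw [inner_squeezedGamma hr]
    have : (((Real.tanh r : ℂ) ^ i * Real.tanh r ^ j) • (⟨ketBra (ket₁ i) (ket₁ j),
      traceNorm_ketBra_lt_top _ _⟩ : TraceClass (Fock (Fin 1)))).1 =
      ((Real.tanh r : ℂ) ^ i * Real.tanh r ^ j) • ketBra (ket₁ i) (ket₁ j) := rfl
    rw [this, smul_apply, inner_smul_right, InnerProductSpace.rankOne_apply, inner_smul_right,
      inner_ket_left, inner_ket_left, ket_apply, ket_apply]
    by_cases h1 : l = i <;> by_cases h2 : m = j <;>
      simp [h1, h2, @eq_comm ℕ j m]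
  · have h1 := ((hasTraceNormSum_krausMap hK (traceNorm_ketBra_lt_top (ket₁ i)
      (ket₁ j))).hasSum_apply (ket₁ m)).mapL (innerSL ℂ (ket₁ l))
    have h2 := ((hR.hasSum_apply (ket₂ m j)).mapL (innerSL ℂ (ket₂ l i)))
    rw [map_smul]
    have : (((Real.tanh r : ℂ) ^ i * Real.tanh r ^ j) • krausChannel hK ⟨ketBra (ket₁ i) (ket₁ j),
      traceNorm_ketBra_lt_top _ _⟩).1 =
      ((Real.tanh r : ℂ) ^ i * Real.tanh r ^ j) • krausMap K (ketBra (ket₁ i) (ket₁ j)) := rfl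
    rw [this, smul_apply, inner_smul_right]
    refine (h1.mul_left _).unique (h2.congr_fun fun n => ?_)
    rw [innerSL_apply_apply, innerSL_apply_apply, InnerProductSpace.rankOne_apply,
      inner_smul_right, ContinuousLinearMap.comp_apply, ContinuousLinearMap.comp_apply,
      InnerProductSpace.rankOne_apply, map_smul, inner_smul_right,
      ContinuousLinearMap.adjoint_inner_right, ← inner_conj_symm (K n (ket₁ j)),
      ← inner_conj_symm (ψ n), inner_ket_left, inner_ket_left, inner_ket_left, inner_ket_left,
      hflip, hflip, map_mul, map_pow, Complex.conj_ofReal]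
    ring

theorem isFlip_of_flip {r : ℝ} {L : Fock (Fin 1) →L[ℂ] Fock (Fin 1)} {ψ : Fock (Fin 2)}
    (hflip : ∀ l i, ψ ![l, i] = (Real.tanh r : ℂ) ^ i * L (ket₁ i) ![l]) :
    IsFlip (L ∘L damping r) ψ := by
  intro l m
  rw [ContinuousLinearMap.comp_apply, damping_ket, map_smul, inner_ket_left, inner_ket_left,
    hflip]
  rfl

/-- Reduces the construction to one scalar identity per coordinate, `√N xⁿ V |seed n⟩ = ∑ i, tⁱ K_n
|i⟩ ⊗ |i⟩`. The condition `x < 1` makes `∑ ‖ψ n‖²` a convergent geometric series, hence the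
trace-norm convergence. -/
theorem isChoiConstruction_of_flip (hK : ∀ v, HasSum (fun n => ((K n).adjoint ∘L K n) v) v)
    {S : ℝ → Matrix (Fin 2 × Fin 2) (Fin 2 × Fin 2) ℝ} {N x : ℝ → ℝ} {seed : ℕ → Fock (Fin 2)}
    (hseed : ∀ n, ‖seed n‖ = 1) (hx0 : ∀ r, 0 < r → 0 ≤ x r) (hx1 : ∀ r, 0 < r → x r < 1)
    (h : ∀ r, 0 < r → ∃ V : Fock (Fin 2) ≃ₗᵢ[ℂ] Fock (Fin 2), IsGaussianUnitary (S r) V.symm ∧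
      0 < V (ket₂ 0 0) ![0, 0] ∧ ∀ n l i, ((√(N r) * x r ^ n : ℝ) : ℂ) * V (seed n) ![l, i] =
        (Real.tanh r : ℂ) ^ i * K n (ket₁ i) ![l]) :
    IsChoiConstruction (krausChannel hK) S N x seed fun r n => K n ∘L damping r := by
  intro r hr
  obtain ⟨V, hV, hpos, hflip⟩ := h r hr
  refine ⟨V.symm, hV, ?_, fun n => ((√(N r) * x r ^ n : ℝ) : ℂ) • V (seed n), fun n => rfl, ?_,
    fun n => isFlip_of_flip (hflip n)⟩
  · have h1 : ⟪ket₂ 0 0, V.symm (ket₂ 0 0)⟫_ℂ = star (V (ket₂ 0 0) ![0, 0]) := by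
      rw [← V.inner_map_map, V.apply_symm_apply, ← inner_conj_symm, inner_ket_left]
      rfl
    rw [h1]
    exact star_pos_iff.2 hpos
  · obtain ⟨R, hR⟩ := exists_hasTraceNormSum_ketBra
      (ψ := fun n => ((√(N r) * x r ^ n : ℝ) : ℂ) • V (seed n)) (by
        have hx2 : x r * x r < 1 := by nlinarith [hx0 r hr, hx1 r hr]
        refine ((summable_geometric_of_lt_one (mul_self_nonneg (x r)) hx2).mul_left
          (√(N r) * √(N r))).congr fun n => ?_
        rw [norm_smul, V.norm_map, hseed, Complex.norm_real, Real.norm_eq_abs, mul_one,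
          abs_mul_abs_self, mul_pow]
        ring)
    exact ⟨R, isOneSidedImage_of_flip hK hr.le hR hflip, hR⟩

end Choi

/-! ### Phase-space matrices -/

section PhaseSpace

/-- In the coordinate `α = i (q + ip)` the matrix `σ₃` acts as `α ↦ -star α`, so the entries `-sinh
μ σ₃` become `+ sinh μ star α`. -/
theorem weylParam_squeezeMat (μ : ℝ) (ξ : Fin 2 × Fin 2 → ℝ) :
    weylParam ((squeezeMat μ)ᵀ *ᵥ ξ) = squeezeMap μ (weylParam ξ) := by
  rw [squeezeMap_apply]
  funext i
  fin_cases i <;> apply Complex.ext <;>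
    simp [weylParam, squeezeMat, pauliZ, Matrix.mulVec, dotProduct, Fintype.sum_prod_type,
      Matrix.one_apply, -Complex.ofReal_cosh, -Complex.ofReal_sinh] <;> ring

theorem weylParam_beamSplitterMat (θ : ℝ) (ξ : Fin 2 × Fin 2 → ℝ) :
    weylParam ((beamSplitterMat θ)ᵀ *ᵥ ξ) = beamMap θ (weylParam ξ) := by
  rw [beamMap_apply]
  funext i
  fin_cases i <;> apply Complex.ext <;>
    simp [weylParam, beamSplitterMat, Matrix.mulVec, dotProduct, Fintype.sum_prod_type,
      Matrix.one_apply, -Complex.ofReal_cos, -Complex.ofReal_sin] <;> ring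

theorem weylParam_fin_one (ξ : Fin 1 × Fin 2 → ℝ) : weylParam ξ = ![weylParam ξ 0] := by
  funext i
  fin_cases i
  rfl

theorem weylParam_smul_one (κ : ℝ) (ξ : Fin 1 × Fin 2 → ℝ) :
    weylParam ((κ • (1 : Matrix (Fin 1 × Fin 2) (Fin 1 × Fin 2) ℝ)) *ᵥ ξ) =
      ![κ * weylParam ξ 0] := by
  rw [weylParam_fin_one, Matrix.smul_mulVec, Matrix.one_mulVec]
  simp only [weylParam, Pi.smul_apply, smul_eq_mul]
  congr 1
  push_cast
  ring

theorem weylParam_conjX (κ : ℝ) (ξ : Fin 1 × Fin 2 → ℝ) :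
    weylParam (conjX κ *ᵥ ξ) = ![-(κ * star (weylParam ξ 0))] := by
  rw [weylParam_fin_one]
  congr 1
  apply Complex.ext <;>
    simp [weylParam, conjX, pauliZ, Matrix.mulVec, dotProduct, Fintype.sum_prod_type]

theorem dotProduct_smul_one_mulVec (c : ℝ) (ξ : Fin 1 × Fin 2 → ℝ) :
    ξ ⬝ᵥ ((c • (1 : Matrix (Fin 1 × Fin 2) (Fin 1 × Fin 2) ℝ)) *ᵥ ξ) =
      c * ‖weylParam ξ 0‖ ^ 2 := by
  rw [Matrix.smul_mulVec, Matrix.one_mulVec, dotProduct_smul, smul_eq_mul,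
    ← Complex.normSq_eq_norm_sq]
  simp [weylParam, dotProduct, Fintype.sum_prod_type, Complex.normSq_apply]
  left
  ring

end PhaseSpace

/-! ### Heisenberg picture -/

section Heisenberg

theorem inner_map_displacement {ι : Type*} [Fintype ι] [DecidableEq ι]
    {V : Fock ι ≃ₗᵢ[ℂ] Fock ι} {A : (ι → ℂ) ≃+ (ι → ℂ)}
    (hV : ∀ α x, V (displacement α x) = displacement (A α) (V x)) (β : ι → ℂ) (x y : Fock ι) :
    ⟪V x, displacement β (V y)⟫_ℂ = ⟪x, displacement (A.symm β) y⟫_ℂ := by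
  rw [← V.inner_map_map x, hV, A.apply_symm_apply]

theorem eq_smul_ket₁ {x : Fock (Fin 1)} {c : ℂ} {a : ℕ}
    (h : ∀ l, x ![l] = if l = a then c else 0) : x = c • ket₁ a := by
  ext k
  have hk : k = ![k 0] := by ext i; fin_cases i; rfl
  rw [hk, h, lp.coeFn_smul, Pi.smul_apply, ket_apply, smul_eq_mul]
  by_cases hl : k 0 = a <;> simp [hl]

theorem apply_ket₁_eq_zero {x : Fock (Fin 1)} (h : ∀ l, x ![l] = 0) : x = 0 := by
  ext k
  have hk : k = ![k 0] := by ext i; fin_cases i; rfl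
  rw [hk, h]
  rfl

variable {V : Fock (Fin 2) ≃ₗᵢ[ℂ] Fock (Fin 2)}

/-- Pulled back through `V`, the displacement `(a, 0)` becomes `(cos θ a, sin θ a)`: the first
component gives `X`, the second meets the vacuum and gives noise `sin² θ = 1 - cos² θ`. -/
theorem isGaussianChannel_beamSplitter {θ : ℝ} {e : Fock (Fin 1) →L[ℂ] Fock (Fin 2)}
    (he : e = rightEmbed 0)
    (hV : ∀ α x, V (displacement α x) = displacement (beamMap θ α) (V x))
    (hK : ∀ v, HasSum
      (fun n => ((dilationKraus V e n).adjoint ∘L dilationKraus V e n) v) v) :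
    IsGaussianChannel (Real.cos θ • 1) ((1 - Real.cos θ ^ 2) • 1) (krausChannel hK) := by
  refine isGaussianChannel_krausChannel hK fun ξ u v => ?_
  rw [dotProduct_smul_one_mulVec, weylParam_smul_one, weylParam_fin_one ξ]
  convert! hasSum_inner_dilationKraus (V := V) (e := e) (weylParam ξ 0) u v using 1
  have hb : (beamMap θ).symm ![weylParam ξ 0, 0] =
      ![Real.cos θ * weylParam ξ 0, Real.sin θ * weylParam ξ 0] := by
    rw [beamMap_symm_apply]
    simp
  rw [inner_map_displacement hV, hb, he, inner_rightEmbed_displacement]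
  congr 3
  rw [norm_mul, Complex.norm_real, mul_pow, Real.norm_eq_abs, sq_abs, ← Real.sin_sq]
  simp

/-- Here `(a, 0)` pulls back to `(cosh μ a, -sinh μ star a)`, so the vacuum in the second mode
contributes noise `sinh² μ = cosh² μ - 1`. -/
theorem isGaussianChannel_squeezer_rightEmbed {μ : ℝ} {e : Fock (Fin 1) →L[ℂ] Fock (Fin 2)}
    (he : e = rightEmbed 0)
    (hV : ∀ α x, V (displacement α x) = displacement (squeezeMap μ α) (V x))
    (hK : ∀ v, HasSum
      (fun n => ((dilationKraus V e n).adjoint ∘L dilationKraus V e n) v) v) :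
    IsGaussianChannel (Real.cosh μ • 1) ((Real.cosh μ ^ 2 - 1) • 1) (krausChannel hK) := by
  refine isGaussianChannel_krausChannel hK fun ξ u v => ?_
  rw [dotProduct_smul_one_mulVec, weylParam_smul_one, weylParam_fin_one ξ]
  convert! hasSum_inner_dilationKraus (V := V) (e := e) (weylParam ξ 0) u v using 1
  have hb : (squeezeMap μ).symm ![weylParam ξ 0, 0] =
      ![Real.cosh μ * weylParam ξ 0, -(Real.sinh μ * star (weylParam ξ 0))] := by
    rw [squeezeMap_symm_apply]
    simp
  rw [inner_map_displacement hV, hb, he, inner_rightEmbed_displacement]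
  congr 3
  rw [norm_neg, norm_mul, norm_star, Complex.norm_real, mul_pow, Real.norm_eq_abs, sq_abs,
    ← Real.sinh_sq]
  simp

/-- The same pullback with the ports exchanged: the input sees the conjugated component `-sinh μ
star a`, and the vacuum in the first mode contributes noise `cosh² μ = sinh² μ + 1`. -/
theorem isGaussianChannel_squeezer_leftEmbed {μ : ℝ} {e : Fock (Fin 1) →L[ℂ] Fock (Fin 2)}
    (he : e = leftEmbed)
    (hV : ∀ α x, V (displacement α x) = displacement (squeezeMap μ α) (V x))
    (hK : ∀ v, HasSum
      (fun n => ((dilationKraus V e n).adjoint ∘L dilationKraus V e n) v) v) :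
    IsGaussianChannel (conjX (Real.sinh μ)) ((Real.sinh μ ^ 2 + 1) • 1) (krausChannel hK) := by
  refine isGaussianChannel_krausChannel hK fun ξ u v => ?_
  rw [dotProduct_smul_one_mulVec, weylParam_conjX, weylParam_fin_one ξ]
  convert! hasSum_inner_dilationKraus (V := V) (e := e) (weylParam ξ 0) u v using 1
  have hb : (squeezeMap μ).symm ![weylParam ξ 0, 0] =
      ![Real.cosh μ * weylParam ξ 0, -(Real.sinh μ * star (weylParam ξ 0))] := by
    rw [squeezeMap_symm_apply]
    simp
  rw [inner_map_displacement hV, hb, he, inner_leftEmbed_displacement]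
  congr 3
  rw [norm_mul, Complex.norm_real, mul_pow, Real.norm_eq_abs, sq_abs, ← Real.cosh_sq]
  simp

theorem tendsto_comp_damping_apply (L : Fock (Fin 1) →L[ℂ] Fock (Fin 1)) (v : Fock (Fin 1)) :
    Tendsto (fun r => (L ∘L damping r) v) atTop (𝓝 (L v)) :=
  (L.continuous.tendsto v).comp (tendsto_damping v)

end Heisenberg

/-! ### The Choi construction of the three families -/

section ChoiCoordinates

theorem exists_choi_squeezer {μ : ℝ} (hμ : 0 ≤ μ) : ∃ V : Fock (Fin 2) ≃ₗᵢ[ℂ] Fock (Fin 2),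
    IsGaussianUnitary (squeezeMat μ) V.symm ∧ 0 < V (ket₂ 0 0) ![0, 0] ∧
    (∀ m l n, V (ket₂ m 0) ![l, n] = if l = m + n then (((Real.cosh μ)⁻¹ * (Real.cosh μ)⁻¹ ^ m *
      Real.tanh μ ^ n * √((m + n).choose n) : ℝ) : ℂ) else 0) ∧
    ∀ m l n, V (ket₂ 0 m) ![l, n] = if n = m + l then (((Real.cosh μ)⁻¹ * (Real.cosh μ)⁻¹ ^ m *
      Real.tanh μ ^ l * √((m + l).choose l) : ℝ) : ℂ) else 0 := by
  obtain ⟨V, hV, h0⟩ := exists_squeezer hμ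
  refine ⟨V, isGaussianUnitary_symm hV (weylParam_squeezeMat μ), ?_, fun m l n => ?_,
    fun m l n => ?_⟩
  · rw [squeezer_ket_zero_right hV h0]
    have h : (0 : ℂ) < ((Real.cosh μ)⁻¹ : ℝ) :=
      Complex.zero_lt_real.2 (inv_pos.2 (Real.cosh_pos μ))
    simpa [-Complex.ofReal_cosh] using h
  · rw [squeezer_ket_zero_right hV h0]
    push_cast
    rfl
  · rw [squeezer_ket_zero_left hV h0]
    push_cast
    rfl

theorem exists_choi_beamSplitter (θ : ℝ) : ∃ V : Fock (Fin 2) ≃ₗᵢ[ℂ] Fock (Fin 2),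
    IsGaussianUnitary (beamSplitterMat θ) V.symm ∧ 0 < V (ket₂ 0 0) ![0, 0] ∧
    ∀ m l n, V (ket₂ m 0) ![l, n] = if l + n = m then ((Real.cos θ ^ l * (-Real.sin θ) ^ n *
      √(m.choose n) : ℝ) : ℂ) else 0 := by
  obtain ⟨V, hV, h0⟩ := exists_beamSplitter θ
  refine ⟨V, isGaussianUnitary_symm hV (weylParam_beamSplitterMat θ), ?_, fun m l n => ?_⟩
  · rw [beamSplitter_ket_zero_right hV h0]
    simp
  · rw [beamSplitter_ket_zero_right hV h0]
    push_cast
    rfl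

theorem norm_ket₂ (l m : ℕ) : ‖ket₂ l m‖ = 1 := norm_ket _

end ChoiCoordinates

/-! ### The quantum-limited attenuator -/

section Attenuator

/-- A binomial coefficient that is at least `1` dominates its square root, which leaves a convergent
binomial series. This is the input for operator-norm limits. -/
theorem summable_sqrt_choose_mul_pow (n : ℕ) {q : ℝ} (h0 : 0 ≤ q) (h1 : q < 1) :
    Summable fun m : ℕ => √((m + n).choose n) * q ^ m := by
  refine Summable.of_nonneg_of_le (fun m => by positivity) (fun m => ?_)
    (summable_choose_mul_geometric_of_norm_lt_one n (r := q)
      (by rwa [Real.norm_eq_abs, abs_of_nonneg h0]))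
  have h : (1 : ℝ) ≤ (m + n).choose n :=
    Nat.one_le_cast.2 (Nat.choose_pos (Nat.le_add_left n m))
  gcongr
  rw [Real.sqrt_le_left (by positivity)]
  nlinarith

theorem tanh_mem_Ioo {r : ℝ} (hr : 0 < r) : Real.tanh r ∈ Set.Ioo (0 : ℝ) 1 :=
  ⟨by rw [Real.tanh_eq_sinh_div_cosh]
      exact div_pos (Real.sinh_pos_iff.2 hr) (Real.cosh_pos r), Real.tanh_lt_one r⟩

theorem mul_tanh_mem_Ioo {κ r : ℝ} (h0 : 0 < κ) (h1 : κ ≤ 1) (hr : 0 < r) :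
    κ * Real.tanh r ∈ Set.Ioo (0 : ℝ) 1 := by
  have ht := tanh_mem_Ioo hr
  exact ⟨mul_pos h0 ht.1, (mul_le_of_le_one_left ht.1.le h1).trans_lt ht.2⟩

theorem inv_cosh_artanh {y : ℝ} (hy : y ∈ Set.Ioo (0 : ℝ) 1) :
    (Real.cosh (Real.artanh y))⁻¹ = √(1 - y ^ 2) := by
  rw [Real.cosh_artanh ⟨by linarith [hy.1], hy.2⟩, one_div, inv_inv]

theorem tanh_artanh_of_mem {y : ℝ} (hy : y ∈ Set.Ioo (0 : ℝ) 1) :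
    Real.tanh (Real.artanh y) = y := Real.tanh_artanh ⟨by linarith [hy.1], hy.2⟩

theorem attenuator_weight_lt_one {κ t : ℝ} (h0 : 0 < κ) (h1 : κ ≤ 1)
    (ht : t ∈ Set.Ioo (0 : ℝ) 1) : √((1 - κ ^ 2) / (t⁻¹ ^ 2 - κ ^ 2)) < 1 := by
  have h2 : 1 < t⁻¹ := (one_lt_inv₀ ht.1).2 ht.2
  rw [Real.sqrt_lt' one_pos, div_lt_iff₀ (by nlinarith)]
  nlinarith

/-- Both sides are square roots, and `t⁻² - κ² = (1 - κ² t²) / t²`. -/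
theorem attenuator_weight_mul {κ t : ℝ} (h0 : 0 < κ) (h1 : κ ≤ 1)
    (ht : t ∈ Set.Ioo (0 : ℝ) 1) :
    √((1 - κ ^ 2) / (t⁻¹ ^ 2 - κ ^ 2)) * √(1 - (κ * t) ^ 2) = t * √(1 - κ ^ 2) := by
  have h2 : 1 < t⁻¹ := (one_lt_inv₀ ht.1).2 ht.2
  have h3 : 0 < t⁻¹ ^ 2 - κ ^ 2 := by nlinarith
  have h4 : 0 ≤ 1 - κ ^ 2 := by nlinarith
  have ht0 := ht.1.ne'
  rw [← Real.sqrt_mul (div_nonneg h4 h3.le), ← Real.sqrt_sq ht.1.le, ← Real.sqrt_mul (sq_nonneg t),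
    Real.sqrt_sq ht.1.le]
  congr 1
  rw [div_mul_eq_mul_div, div_eq_iff h3.ne']
  field_simp

/-- With `tanh μ = κ t` and `(cosh μ)⁻¹ = √(1 - (κ t)²)`, the factor `√N` cancels one `(cosh μ)⁻¹`
and each `x` absorbs another. The power is `tⁿ⁺ˡ` because `B_n` maps `|l + n⟩` to a multiple of
`|l⟩`. -/
theorem attenuator_choi_identity {κ t : ℝ} (h0 : 0 < κ) (h1 : κ ≤ 1)
    (ht : t ∈ Set.Ioo (0 : ℝ) 1) (hκt : κ * t ∈ Set.Ioo (0 : ℝ) 1) (n l : ℕ) (c : ℝ) :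
    √(1 - κ ^ 2 * t ^ 2)⁻¹ * √((1 - κ ^ 2) / (t⁻¹ ^ 2 - κ ^ 2)) ^ n *
      (√(1 - (κ * t) ^ 2) * √(1 - (κ * t) ^ 2) ^ n * (κ * t) ^ l * c) =
    t ^ (n + l) * (κ ^ l * √(1 - κ ^ 2) ^ n * c) := by
  have hp : 0 < √(1 - (κ * t) ^ 2) := Real.sqrt_pos.2 (by nlinarith [hκt.1, hκt.2])
  have hN : √(1 - κ ^ 2 * t ^ 2)⁻¹ * √(1 - (κ * t) ^ 2) = 1 := by
    rw [← mul_pow, Real.sqrt_inv, inv_mul_cancel₀ hp.ne']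
  calc _ = (√(1 - κ ^ 2 * t ^ 2)⁻¹ * √(1 - (κ * t) ^ 2)) *
        (√((1 - κ ^ 2) / (t⁻¹ ^ 2 - κ ^ 2)) * √(1 - (κ * t) ^ 2)) ^ n * (κ * t) ^ l * c := by
        rw [mul_pow (√((1 - κ ^ 2) / (t⁻¹ ^ 2 - κ ^ 2)))]
        ring
    _ = _ := by
        rw [hN, attenuator_weight_mul h0 h1 ht, mul_pow, mul_pow, pow_add]
        ring

theorem attenuator (κ : ℝ) (h0 : 0 < κ) (h1 : κ ≤ 1) :
    ∃ (Φ : TraceClass (Fock (Fin 1)) →ₗ[ℂ] TraceClass (Fock (Fin 1)))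
      (B : ℕ → (Fock (Fin 1) →L[ℂ] Fock (Fin 1)))
      (T : ℝ → ℕ → (Fock (Fin 1) →L[ℂ] Fock (Fin 1))),
      IsGaussianChannel (κ • 1) ((1 - κ ^ 2) • 1) Φ ∧
      (∀ Φ', IsGaussianChannel (κ • 1) ((1 - κ ^ 2) • 1) Φ' → Φ' = Φ) ∧
      (∀ n, HasDyadSum (fun m => √((m + n).choose n) * κ ^ m * √(1 - κ ^ 2) ^ n)
        (fun m => m) (fun m => m + n) (B n)) ∧
      IsKrausFamily Φ B ∧
      IsChoiConstruction Φ (fun r => squeezeMat (Real.artanh (κ * Real.tanh r)))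
        (fun r => (1 - κ ^ 2 * Real.tanh r ^ 2)⁻¹)
        (fun r => √((1 - κ ^ 2) / ((Real.tanh r)⁻¹ ^ 2 - κ ^ 2))) (fun n => ket₂ 0 n) T ∧
      FiniteSqueezingCompleteness T ∧
      (∀ n v, Tendsto (fun r => T r n v) atTop (𝓝 (B n v))) ∧
      (κ < 1 → ∀ n, Tendsto (fun r => T r n) atTop (𝓝 (B n))) := by
  -- The negative angle makes `-sin θ = √(1 - κ²)`, so all Kraus coefficients come out nonnegative.
  obtain ⟨V, hV, hV0⟩ := exists_beamSplitter (-Real.arccos κ)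
  have hcos : Real.cos (-Real.arccos κ) = κ := by
    rw [Real.cos_neg, Real.cos_arccos (by linarith) h1]
  have hsin : Real.sin (-Real.arccos κ) = -√(1 - κ ^ 2) := by
    rw [Real.sin_neg, Real.sin_arccos]
  have hB := hasSum_adjoint_dilationKraus (V := V) (inner_rightEmbed 0)
  have hcoord : ∀ n i l, dilationKraus V (rightEmbed 0) n (ket₁ i) ![l] =
      if l + n = i then ((κ ^ l * √(1 - κ ^ 2) ^ n * √(i.choose n) : ℝ) : ℂ) else 0 := by
    intro n i l
    rw [dilationKraus_coord, rightEmbed_ket, beamSplitter_ket_zero_right hV hV0, hcos, hsin]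
    push_cast
    rw [neg_neg]
  have hΦ := isGaussianChannel_beamSplitter rfl hV hB
  rw [hcos] at hΦ
  have hdyad : ∀ n, HasDyadSum (fun m => √((m + n).choose n) * κ ^ m * √(1 - κ ^ 2) ^ n)
      (fun m => m) (fun m => m + n) (dilationKraus V (rightEmbed 0) n) := by
    intro n
    refine hasDyadSum_of_apply_ket (add_left_injective n) (fun m => eq_smul_ket₁ fun l => ?_)
      fun j hj => apply_ket₁_eq_zero fun l => ?_
    · rw [hcoord]
      simp only [add_left_inj]
      split_ifs with h
      · rw [h]
        congr 1
        ring
      · rfl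
    · rw [hcoord, if_neg fun h => hj ⟨l, h⟩]
  refine ⟨krausChannel hB, dilationKraus V (rightEmbed 0),
    fun r n => dilationKraus V (rightEmbed 0) n ∘L damping r, hΦ, fun Φ' => hΦ.unique, hdyad,
    isKrausFamily_krausChannel hB, ?_, finiteSqueezingCompleteness_comp_damping hB,
    fun n v => tendsto_comp_damping_apply _ v, fun hκ n => tendsto_comp_damping (hdyad n) ?_⟩
  · refine isChoiConstruction_of_flip hB (fun n => norm_ket₂ 0 n) (fun _ _ => Real.sqrt_nonneg _)
      (fun r hr => attenuator_weight_lt_one h0 h1 (tanh_mem_Ioo hr)) fun r hr => ?_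
    have hκt := mul_tanh_mem_Ioo h0 h1 hr
    obtain ⟨W, hW, hpos, -, hket⟩ := exists_choi_squeezer (Real.artanh_nonneg hκt.1.le)
    refine ⟨W, hW, hpos, fun n l i => ?_⟩
    rw [hket, hcoord, inv_cosh_artanh hκt, tanh_artanh_of_mem hκt]
    by_cases h : i = n + l
    · rw [if_pos h, if_pos (by omega), ← Complex.ofReal_pow, ← Complex.ofReal_mul,
        ← Complex.ofReal_mul, attenuator_choi_identity h0 h1 (tanh_mem_Ioo hr) hκt, h,
        Nat.choose_symm_add]
    · rw [if_neg h, if_neg (by omega), mul_zero, mul_zero]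
  -- Norm convergence needs summable coefficients; at `κ = 1` those of `B 0` are all `1`.
  · refine ((summable_sqrt_choose_mul_pow n h0.le hκ).mul_right (√(1 - κ ^ 2) ^ n)).congr
      fun m => ?_
    rw [abs_of_nonneg (by positivity)]

end Attenuator

/-! ### The quantum-limited amplifier -/

section Amplifier

theorem amplifier_weight_lt_one {κ t : ℝ} (h1 : 1 ≤ κ) (ht : t ∈ Set.Ioo (0 : ℝ) 1) :
    √((κ ^ 2 - 1) / (κ ^ 2 - t ^ 2)) < 1 := by
  rw [Real.sqrt_lt' one_pos, div_lt_iff₀ (by nlinarith [ht.1, ht.2])]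
  nlinarith [ht.1, ht.2]

theorem amplifier_choi_identity {κ t : ℝ} (h1 : 1 ≤ κ) (ht : t ∈ Set.Ioo (0 : ℝ) 1)
    (n i : ℕ) (c : ℝ) :
    √(κ ^ 2 - t ^ 2)⁻¹ * √((κ ^ 2 - 1) / (κ ^ 2 - t ^ 2)) ^ n *
      (√(1 - (κ⁻¹ * t) ^ 2) * √(1 - (κ⁻¹ * t) ^ 2) ^ n * (κ⁻¹ * t) ^ i * c) =
    t ^ i * (κ⁻¹ * κ⁻¹ ^ i * (√(κ ^ 2 - 1) / κ) ^ n * c) := by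
  have hκ : 0 < κ := by linarith
  -- This is `(cosh μ)⁻¹` for `tanh μ = t / κ`; its powers cancel against those of `√N` and `x`.
  have hs : √(1 - (κ⁻¹ * t) ^ 2) = √(κ ^ 2 - t ^ 2) / κ := by
    rw [eq_div_iff hκ.ne', ← Real.sqrt_sq hκ.le, ← Real.sqrt_mul' _ (sq_nonneg κ),
      Real.sqrt_sq hκ.le]
    congr 1
    field_simp
  have hp : 0 < √(κ ^ 2 - t ^ 2) := Real.sqrt_pos.2 (by nlinarith [ht.1, ht.2])
  rw [hs, Real.sqrt_inv, Real.sqrt_div (by nlinarith), div_pow, div_pow, div_pow, mul_pow]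
  field_simp

theorem amplifier (κ : ℝ) (h1 : 1 ≤ κ) :
    ∃ (Φ : TraceClass (Fock (Fin 1)) →ₗ[ℂ] TraceClass (Fock (Fin 1)))
      (A : ℕ → (Fock (Fin 1) →L[ℂ] Fock (Fin 1)))
      (T : ℝ → ℕ → (Fock (Fin 1) →L[ℂ] Fock (Fin 1))),
      IsGaussianChannel (κ • 1) ((κ ^ 2 - 1) • 1) Φ ∧
      (∀ Φ', IsGaussianChannel (κ • 1) ((κ ^ 2 - 1) • 1) Φ' → Φ' = Φ) ∧
      (∀ n, HasDyadSum
        (fun m => √((m + n).choose n) * (1 / κ) ^ (m + 1) * (√(κ ^ 2 - 1) / κ) ^ n)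
        (fun m => m + n) (fun m => m) (A n)) ∧
      IsKrausFamily Φ A ∧
      IsChoiConstruction Φ (fun r => squeezeMat (Real.artanh (κ⁻¹ * Real.tanh r)))
        (fun r => (κ ^ 2 - Real.tanh r ^ 2)⁻¹)
        (fun r => √((κ ^ 2 - 1) / (κ ^ 2 - Real.tanh r ^ 2))) (fun n => ket₂ n 0) T ∧
      FiniteSqueezingCompleteness T ∧
      (∀ n v, Tendsto (fun r => T r n v) atTop (𝓝 (A n v))) ∧
      (1 < κ → ∀ n, Tendsto (fun r => T r n) atTop (𝓝 (A n))) := by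
  have hκ : 0 < κ := by linarith
  -- The nonnegative squeezing parameter with `cosh μ = κ`.
  obtain ⟨V, hV, hV0⟩ := exists_squeezer (Real.arsinh_nonneg_iff.2 (Real.sqrt_nonneg (κ ^ 2 - 1)))
  have hsq : √(κ ^ 2 - 1) ^ 2 = κ ^ 2 - 1 := Real.sq_sqrt (by nlinarith)
  have hcosh : Real.cosh (Real.arsinh √(κ ^ 2 - 1)) = κ := by
    rw [Real.cosh_arsinh, hsq, add_sub_cancel, Real.sqrt_sq hκ.le]
  have htanh : Real.tanh (Real.arsinh √(κ ^ 2 - 1)) = √(κ ^ 2 - 1) / κ := by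
    rw [Real.tanh_eq_sinh_div_cosh, hcosh, Real.sinh_arsinh]
  have hA := hasSum_adjoint_dilationKraus (V := V) (inner_rightEmbed 0)
  have hcoord : ∀ n i l, dilationKraus V (rightEmbed 0) n (ket₁ i) ![l] = if l = i + n then
      ((κ⁻¹ * κ⁻¹ ^ i * (√(κ ^ 2 - 1) / κ) ^ n * √((i + n).choose n) : ℝ) : ℂ) else 0 := by
    intro n i l
    rw [dilationKraus_coord, rightEmbed_ket, squeezer_ket_zero_right hV hV0, hcosh, htanh]
    push_cast
    rfl
  have hΦ := isGaussianChannel_squeezer_rightEmbed rfl hV hA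
  rw [hcosh] at hΦ
  have hdyad : ∀ n, HasDyadSum
      (fun m => √((m + n).choose n) * (1 / κ) ^ (m + 1) * (√(κ ^ 2 - 1) / κ) ^ n)
      (fun m => m + n) (fun m => m) (dilationKraus V (rightEmbed 0) n) := by
    intro n
    refine hasDyadSum_of_apply_ket Function.injective_id (fun m => eq_smul_ket₁ fun l => ?_)
      fun j hj => absurd ⟨j, rfl⟩ hj
    rw [hcoord]
    split_ifs with h
    · congr 1
      rw [one_div, pow_succ]
      ring
    · rfl
  refine ⟨krausChannel hA, dilationKraus V (rightEmbed 0),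
    fun r n => dilationKraus V (rightEmbed 0) n ∘L damping r, hΦ, fun Φ' => hΦ.unique, hdyad,
    isKrausFamily_krausChannel hA, ?_, finiteSqueezingCompleteness_comp_damping hA,
    fun n v => tendsto_comp_damping_apply _ v, fun h n => tendsto_comp_damping (hdyad n) ?_⟩
  · refine isChoiConstruction_of_flip hA (fun n => norm_ket₂ n 0) (fun _ _ => Real.sqrt_nonneg _)
      (fun r hr => amplifier_weight_lt_one h1 (tanh_mem_Ioo hr)) fun r hr => ?_
    have hκt := mul_tanh_mem_Ioo (inv_pos.2 hκ) (inv_le_one_of_one_le₀ h1) hr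
    obtain ⟨W, hW, hpos, hket, -⟩ := exists_choi_squeezer (Real.artanh_nonneg hκt.1.le)
    refine ⟨W, hW, hpos, fun n l i => ?_⟩
    rw [hket, hcoord, inv_cosh_artanh hκt, tanh_artanh_of_mem hκt]
    by_cases h : l = n + i
    · rw [if_pos h, if_pos (by omega), ← Complex.ofReal_pow, ← Complex.ofReal_mul,
        ← Complex.ofReal_mul, amplifier_choi_identity h1 (tanh_mem_Ioo hr), add_comm i n,
        Nat.choose_symm_add]
    · rw [if_neg h, if_neg (by omega), mul_zero, mul_zero]
  · refine ((summable_sqrt_choose_mul_pow n (q := 1 / κ) (by positivity)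
      (by rwa [div_lt_one hκ])).mul_right (1 / κ * (√(κ ^ 2 - 1) / κ) ^ n)).congr fun m => ?_
    rw [abs_of_nonneg (by positivity), pow_succ]
    ring

end Amplifier

/-! ### The quantum-limited phase conjugation -/

section PhaseConjugation

theorem conjugation_weight_lt_one {κ t : ℝ} (ht : t ∈ Set.Ioo (0 : ℝ) 1) :
    √((κ ^ 2 + t ^ 2) / (κ ^ 2 + 1)) < 1 := by
  rw [Real.sqrt_lt' one_pos, div_lt_iff₀ (by positivity)]
  nlinarith [ht.1, ht.2]

theorem sqrt_one_add_div_sq {κ : ℝ} (hκ : 0 < κ) (t : ℝ) :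
    √(1 + (-t / κ) ^ 2) = √(κ ^ 2 + t ^ 2) / κ := by
  rw [eq_div_iff hκ.ne', ← Real.sqrt_sq hκ.le, ← Real.sqrt_mul' _ (sq_nonneg κ),
    Real.sqrt_sq hκ.le]
  congr 1
  field_simp

/-- The denominators `√(κ² + t²)` of `cos θ` and of `-sin θ` occur `l + i = n` times in total and
cancel the numerator of `xⁿ`. -/
theorem conjugation_choi_identity {κ t : ℝ} (hκ : 0 < κ) (l i : ℕ) (c : ℝ) :
    √(1 + κ ^ 2)⁻¹ * √((κ ^ 2 + t ^ 2) / (κ ^ 2 + 1)) ^ (i + l) *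
      ((κ / √(κ ^ 2 + t ^ 2)) ^ l * (t / √(κ ^ 2 + t ^ 2)) ^ i * c) =
    t ^ i * ((√(1 + κ ^ 2))⁻¹ * (√(1 + κ ^ 2))⁻¹ ^ i * (κ / √(1 + κ ^ 2)) ^ l * c) := by
  have hp : 0 < √(κ ^ 2 + t ^ 2) := Real.sqrt_pos.2 (by positivity)
  have hq : 0 < √(1 + κ ^ 2) := Real.sqrt_pos.2 (by positivity)
  rw [add_comm (κ ^ 2) 1, Real.sqrt_inv, Real.sqrt_div (by positivity), div_pow, div_pow, div_pow,
    div_pow, inv_pow, pow_add, pow_add]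
  field_simp

theorem phaseConjugation (κ : ℝ) (hκ : 0 < κ) :
    ∃ (Φ : TraceClass (Fock (Fin 1)) →ₗ[ℂ] TraceClass (Fock (Fin 1)))
      (C : ℕ → (Fock (Fin 1) →L[ℂ] Fock (Fin 1)))
      (T : ℝ → ℕ → (Fock (Fin 1) →L[ℂ] Fock (Fin 1))),
      IsGaussianChannel (conjX κ) ((κ ^ 2 + 1) • 1) Φ ∧
      (∀ Φ', IsGaussianChannel (conjX κ) ((κ ^ 2 + 1) • 1) Φ' → Φ' = Φ) ∧
      (∀ n, C n = ((1 / √(1 + κ ^ 2) : ℝ) : ℂ) • ∑ m ∈ Finset.range (n + 1),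
        ((√(n.choose m) * (κ / √(1 + κ ^ 2)) ^ (n - m) * (1 / √(1 + κ ^ 2)) ^ m : ℝ) : ℂ) •
          ketBra (ket₁ (n - m)) (ket₁ m)) ∧
      IsKrausFamily Φ C ∧
      IsChoiConstruction Φ (fun r => beamSplitterMat (Real.arctan (-Real.tanh r / κ)))
        (fun _ => (1 + κ ^ 2)⁻¹) (fun r => √((κ ^ 2 + Real.tanh r ^ 2) / (κ ^ 2 + 1)))
        (fun n => ket₂ n 0) T ∧
      FiniteSqueezingCompleteness T ∧
      ∀ n, Tendsto (fun r => T r n) atTop (𝓝 (C n)) := by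
  obtain ⟨V, hV, hV0⟩ := exists_squeezer (Real.arsinh_nonneg_iff.2 hκ.le)
  have hC := hasSum_adjoint_dilationKraus (V := V) inner_leftEmbed
  have hcoord : ∀ n i l, dilationKraus V leftEmbed n (ket₁ i) ![l] = if n = i + l then
      (((√(1 + κ ^ 2))⁻¹ * (√(1 + κ ^ 2))⁻¹ ^ i * (κ / √(1 + κ ^ 2)) ^ l *
        √((i + l).choose l) : ℝ) : ℂ) else 0 := by
    intro n i l
    rw [dilationKraus_coord, leftEmbed_ket, squeezer_ket_zero_left hV hV0, Real.cosh_arsinh,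
      Real.tanh_arsinh]
    push_cast
    rfl
  have hΦ := isGaussianChannel_squeezer_leftEmbed rfl hV hC
  rw [Real.sinh_arsinh] at hΦ
  -- For `m > n` the coefficient vanishes, so the truncated subtraction in `ket₁ (n - m)` is
  -- harmless.
  have hket : ∀ n m, dilationKraus V leftEmbed n (ket₁ m) = ((if m ≤ n then 1 / √(1 + κ ^ 2) *
      (√(n.choose m) * (κ / √(1 + κ ^ 2)) ^ (n - m) * (1 / √(1 + κ ^ 2)) ^ m) else 0 : ℝ) : ℂ) •
        ket₁ (n - m) := by
    intro n m
    refine eq_smul_ket₁ fun l => ?_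
    rw [hcoord]
    by_cases hm : m ≤ n
    · by_cases hl : l = n - m
      · rw [if_pos (by omega), if_pos hl, if_pos hm, hl, Nat.add_sub_cancel' hm, Nat.choose_symm hm]
        congr 1
        ring
      · rw [if_neg (by omega), if_neg hl]
    · rw [if_neg (by omega), if_neg hm, Complex.ofReal_zero, ite_self]
  refine ⟨krausChannel hC, dilationKraus V leftEmbed,
    fun r n => dilationKraus V leftEmbed n ∘L damping r, hΦ, fun Φ' => hΦ.unique,
    fun n => clm_ext_ket₁ fun j => ?_, isKrausFamily_krausChannel hC, ?_,
    finiteSqueezingCompleteness_comp_damping hC, fun n => tendsto_comp_damping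
      (hasDyadSum_of_apply_ket Function.injective_id (hket n) fun j hj => absurd ⟨j, rfl⟩ hj) ?_⟩
  · rw [hket, smul_apply, sum_apply]
    simp only [smul_apply, InnerProductSpace.rankOne_apply, inner_ket_left, ket_apply]
    by_cases hj : j ≤ n
    · rw [if_pos hj, Finset.sum_eq_single_of_mem j (Finset.mem_range_succ_iff.2 hj), if_pos rfl,
        one_smul, smul_smul, ← Complex.ofReal_mul]
      intro m _ hm
      rw [if_neg fun h => hm (by simpa using h), zero_smul, smul_zero]
    · rw [if_neg hj, Complex.ofReal_zero, zero_smul, Finset.sum_eq_zero, smul_zero]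
      intro m hm
      have hmj : m ≠ j := fun h => hj (h ▸ Finset.mem_range_succ_iff.1 hm)
      rw [if_neg fun h => hmj (by simpa using h), zero_smul, smul_zero]
  · refine isChoiConstruction_of_flip hC (fun n => norm_ket₂ n 0) (fun _ _ => Real.sqrt_nonneg _)
      (fun r hr => conjugation_weight_lt_one (tanh_mem_Ioo hr)) fun r hr => ?_
    obtain ⟨W, hW, hpos, hketW⟩ := exists_choi_beamSplitter (Real.arctan (-Real.tanh r / κ))
    have hp : 0 < √(κ ^ 2 + Real.tanh r ^ 2) := Real.sqrt_pos.2 (by positivity)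
    have hcos : Real.cos (Real.arctan (-Real.tanh r / κ)) = κ / √(κ ^ 2 + Real.tanh r ^ 2) := by
      rw [Real.cos_arctan, sqrt_one_add_div_sq hκ, one_div_div]
    have hsin : -Real.sin (Real.arctan (-Real.tanh r / κ)) =
        Real.tanh r / √(κ ^ 2 + Real.tanh r ^ 2) := by
      rw [Real.sin_arctan, sqrt_one_add_div_sq hκ]
      field_simp
    refine ⟨W, hW, hpos, fun n l i => ?_⟩
    rw [hketW, hcoord, hcos, hsin]
    by_cases h : n = i + l
    · rw [if_pos h, if_pos (by omega), ← Complex.ofReal_pow, ← Complex.ofReal_mul,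
        ← Complex.ofReal_mul, h, conjugation_choi_identity hκ, Nat.choose_symm_add]
    · rw [if_neg h, if_neg (by omega), mul_zero, mul_zero]
  -- Each `C n` has finite rank, so its coefficients are trivially summable and the norm limit holds
  -- for every `κ > 0`.
  · refine summable_of_ne_finset_zero (s := Finset.range (n + 1)) fun m hm => ?_
    rw [if_neg fun h => hm (Finset.mem_range_succ_iff.2 h), abs_zero]

end PhaseConjugation

end Bosonic

/-! ### The three families together -/

theorem mainTheorem2 :
    -- quantum-limited attenuator
    (∀ κ : ℝ, 0 < κ → κ ≤ 1 →
      ∃ (Φ : Bosonic.TraceClass (Bosonic.Fock (Fin 1)) →ₗ[ℂ] Bosonic.TraceClass (Bosonic.Fock (Fin 1)))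
        (B : ℕ → (Bosonic.Fock (Fin 1) →L[ℂ] Bosonic.Fock (Fin 1)))
        (T : ℝ → ℕ → (Bosonic.Fock (Fin 1) →L[ℂ] Bosonic.Fock (Fin 1))),
        Bosonic.IsGaussianChannel (κ • 1) ((1 - κ ^ 2) • 1) Φ ∧
        (∀ Φ', Bosonic.IsGaussianChannel (κ • 1) ((1 - κ ^ 2) • 1) Φ' → Φ' = Φ) ∧
        (∀ n, Bosonic.HasDyadSum
          (fun m => √((m + n).choose n) * κ ^ m * √(1 - κ ^ 2) ^ n)
          (fun m => m) (fun m => m + n) (B n)) ∧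
        Bosonic.IsKrausFamily Φ B ∧
        Bosonic.IsChoiConstruction Φ
          (fun r => Bosonic.squeezeMat (Real.artanh (κ * Real.tanh r)))
          (fun r => (1 - κ ^ 2 * Real.tanh r ^ 2)⁻¹)
          (fun r => √((1 - κ ^ 2) / ((Real.tanh r)⁻¹ ^ 2 - κ ^ 2)))
          (fun n => Bosonic.ket₂ 0 n) T ∧
        Bosonic.FiniteSqueezingCompleteness T ∧
        (∀ n v, Tendsto (fun r => T r n v) atTop (𝓝 (B n v))) ∧
        (κ < 1 → ∀ n, Tendsto (fun r => T r n) atTop (𝓝 (B n)))) ∧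
    -- quantum-limited amplifier
    (∀ κ : ℝ, 1 ≤ κ →
      ∃ (Φ : Bosonic.TraceClass (Bosonic.Fock (Fin 1)) →ₗ[ℂ] Bosonic.TraceClass (Bosonic.Fock (Fin 1)))
        (A : ℕ → (Bosonic.Fock (Fin 1) →L[ℂ] Bosonic.Fock (Fin 1)))
        (T : ℝ → ℕ → (Bosonic.Fock (Fin 1) →L[ℂ] Bosonic.Fock (Fin 1))),
        Bosonic.IsGaussianChannel (κ • 1) ((κ ^ 2 - 1) • 1) Φ ∧
        (∀ Φ', Bosonic.IsGaussianChannel (κ • 1) ((κ ^ 2 - 1) • 1) Φ' → Φ' = Φ) ∧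
        (∀ n, Bosonic.HasDyadSum
          (fun m => √((m + n).choose n) * (1 / κ) ^ (m + 1) * (√(κ ^ 2 - 1) / κ) ^ n)
          (fun m => m + n) (fun m => m) (A n)) ∧
        Bosonic.IsKrausFamily Φ A ∧
        Bosonic.IsChoiConstruction Φ
          (fun r => Bosonic.squeezeMat (Real.artanh (κ⁻¹ * Real.tanh r)))
          (fun r => (κ ^ 2 - Real.tanh r ^ 2)⁻¹)
          (fun r => √((κ ^ 2 - 1) / (κ ^ 2 - Real.tanh r ^ 2)))
          (fun n => Bosonic.ket₂ n 0) T ∧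
        Bosonic.FiniteSqueezingCompleteness T ∧
        (∀ n v, Tendsto (fun r => T r n v) atTop (𝓝 (A n v))) ∧
        (1 < κ → ∀ n, Tendsto (fun r => T r n) atTop (𝓝 (A n)))) ∧
    -- quantum-limited phase conjugation
    (∀ κ : ℝ, 0 < κ →
      ∃ (Φ : Bosonic.TraceClass (Bosonic.Fock (Fin 1)) →ₗ[ℂ] Bosonic.TraceClass (Bosonic.Fock (Fin 1)))
        (C : ℕ → (Bosonic.Fock (Fin 1) →L[ℂ] Bosonic.Fock (Fin 1)))
        (T : ℝ → ℕ → (Bosonic.Fock (Fin 1) →L[ℂ] Bosonic.Fock (Fin 1))),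
        Bosonic.IsGaussianChannel (Bosonic.conjX κ) ((κ ^ 2 + 1) • 1) Φ ∧
        (∀ Φ', Bosonic.IsGaussianChannel (Bosonic.conjX κ) ((κ ^ 2 + 1) • 1) Φ' → Φ' = Φ) ∧
        (∀ n, C n = ((1 / √(1 + κ ^ 2) : ℝ) : ℂ) • ∑ m ∈ Finset.range (n + 1),
          ((√(n.choose m) * (κ / √(1 + κ ^ 2)) ^ (n - m) * (1 / √(1 + κ ^ 2)) ^ m : ℝ) : ℂ) •
            Bosonic.ketBra (Bosonic.ket₁ (n - m)) (Bosonic.ket₁ m)) ∧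
        Bosonic.IsKrausFamily Φ C ∧
        Bosonic.IsChoiConstruction Φ
          (fun r => Bosonic.beamSplitterMat (Real.arctan (-Real.tanh r / κ)))
          (fun _ => (1 + κ ^ 2)⁻¹)
          (fun r => √((κ ^ 2 + Real.tanh r ^ 2) / (κ ^ 2 + 1)))
          (fun n => Bosonic.ket₂ n 0) T ∧
        Bosonic.FiniteSqueezingCompleteness T ∧
        ∀ n, Tendsto (fun r => T r n) atTop (𝓝 (C n))) :=
  ⟨Bosonic.attenuator, Bosonic.amplifier, Bosonic.phaseConjugation⟩
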